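/- \textbf{Conventions.} Categories are locally small, "small" refers to a fixed universe, and a model category is complete and cocomplete and has functorial factorizations. For a category $\mathcal G$, $Iso(\mathcal G)$ is its subcategory of all objects and all isomorphisms, and $\mathcal G^{\otimes}$ is the free symmetric monoidal category on $\mathcal G$. A \emph{Feynman category} $\mathfrak F=(\mathcal V,\mathcal F,\imath)$ consists of an essentially small groupoid $\mathcal V$, a symmetric monoidal category $\mathcal F$ and a functor $\imath\colon\mathcal V\to\mathcal F$ such that (i) the induced symmetric monoidal functor $\mathcal V^{\otimes}\to Iso(\mathcal F)$ is an equivalence; (ii) the symmetric monoidal functor $Iso(\mathcal F\downarrow\mathcal V)^{\otimes}\to Iso(\mathcal F\downarrow\mathcal F)$ induced by sending $\phi\colon X\to\imath(v)$ to $\phi$ is an equivalence, where $(\mathcal F\downarrow\mathcal V)=(\mathrm{id}_{\mathcal F}\downarrow\imath)$ and $(\mathcal F\downarrow\mathcal F)$ are comma categories and the tensor product on $(\mathcal F\downarrow\mathcal F)$ is that of morphisms of $\mathcal F$; (iii) for every $v\in\mathcal V$ the comma category $(\mathcal F\downarrow \imath(v))$ is essentially small. For a symmetric monoidal category $\mathcal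 C$, $\mathcal F\text{-}\mathcal Ops_{\mathcal C}$ is the category of strong symmetric monoidal functors $\mathcal F\to\mathcal C$ and monoidal natural transformations. A $\mathcal V$-sequence in $\mathcal C$ is a family $(A_v)_{v\in\mathcal V}$ of objects of $\mathcal C$; these form the category $\mathcal V\text{-Seq}_{\mathcal C}$. \textbf{Theorem.} Let $\mathfrak F$ be a Feynman category and let $\mathcal C$ be a cofibrantly generated model category which is also a closed symmetric monoidal category (no compatibility of the two structures is assumed) such that: 1. All objects of $\mathcal C$ are small: for each $X$ there is a cardinal $\kappa$ such that for every regular cardinal $\lambda\ge\kappa$, $Hom(X,-)$ preserves the colimit of every $\lambda$-sequence (colimit-continuous functor $\lambda\to\mathcal C$). 2. $\mathcal C$ has a symmetric monoidal fibrant replacement functor: a lax symmetric monoidal functor $R\colon\mathcal C\to\mathcal C$ with all $R(X)$ fibrant, and a monoidal natural transformation $\mathrm{id}_{\mathcal C}\Rightarrow R$ all of whose components are weak equivalences. 3. $\mathcal C$ has $\otimes$-coherent path objects for fibrant objects: let $\mathcal C^{fib}_{\otimes}$ be the full symmetric monoidal subcategory of $\mathcal C$ generated by the fibrant objects (the finite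 tensor products of fibrant objects), and let $\Delta_{\mathcal C}(X)=X\times X$ with the lax symmetric monoidal structure $(\pi_1\otimes\pi_1,\pi_2\otimes\pi_2)\colon (X\times X)\otimes(Y\times Y)\to(X\otimes Y)\times(X\otimes Y)$ and the diagonal of the unit object. There are a lax symmetric monoidal functor $P\colon\mathcal C^{fib}_{\otimes}\to\mathcal C$ and monoidal natural transformations $A\xrightarrow{\phi_A}P(A)\xrightarrow{\psi_A}\Delta_{\mathcal C}(A)$ of functors $\mathcal C^{fib}_{\otimes}\to\mathcal C$ with $\psi_A\circ\phi_A$ the diagonal, such that $\phi_A$ is a weak equivalence and $\psi_A$ is a fibration for every fibrant $A$. Then $\mathcal F\text{-}\mathcal Ops_{\mathcal C}$ is a (cofibrantly generated) model category in which $\phi\colon\mathcal O\to\mathcal Q$ is a weak equivalence (resp. fibration) if and only if $\phi_{\imath(v)}\colon\mathcal O(\imath(v))\to\mathcal Q(\imath(v))$ is a weak equivalence (resp. fibration) in $\mathcal C$ for every $v\in\mathcal V$. Moreover, if $\mathcal V$ has a small set of objects, this structure is transferred from the levelwise, cofibrantly generated model structure on $\mathcal V\text{-Seq}_{\mathcal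 C}$ along the forgetful functor $G\colon\mathcal F\text{-}\mathcal Ops_{\mathcal C}\to\mathcal V\text{-Seq}_{\mathcal C}$, $G(\mathcal O)_v=\mathcal O(\imath(v))$, and its left adjoint $L$: weak equivalences and fibrations are the maps whose image under $G$ is such, and whenever sets $I$, $J$ of maps are generating cofibrations and generating acyclic cofibrations of $\mathcal V\text{-Seq}_{\mathcal C}$, the sets $L(I)$, $L(J)$ are such for $\mathcal F\text{-}\mathcal Ops_{\mathcal C}$. -/

import Mathlib

open CategoryTheory MonoidalCategory Limits HomotopicalAlgebra

universe w v₁ v₂ v u₁ u₂ u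

/-! ## The free symmetric monoidal category on a category -/

/-- Objects of the free symmetric monoidal category on `G`: formal tensor words in the objects
of `G`. -/
inductive FreeSymm (G : Type u₁) : Type u₁
  | of : G → FreeSymm G
  | unit : FreeSymm G
  | tensor : FreeSymm G → FreeSymm G → FreeSymm G

namespace FreeSymm

variable {G : Type u₁} [Category.{v₁} G]

/-- Formal morphisms: generated by the morphisms of `G` and the structure morphisms of a symmetric
monoidal category. -/
inductive Hom : FreeSymm G → FreeSymm G → Type (max u₁ v₁)
  | of {x y : G} (f : x ⟶ y) : Hom (of x) (of y)
  | id (X) : Hom X X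
  | α_hom (X Y Z : FreeSymm G) : Hom ((X.tensor Y).tensor Z) (X.tensor (Y.tensor Z))
  | α_inv (X Y Z : FreeSymm G) : Hom (X.tensor (Y.tensor Z)) ((X.tensor Y).tensor Z)
  | l_hom (X) : Hom (unit.tensor X) X
  | l_inv (X) : Hom X (unit.tensor X)
  | ρ_hom (X : FreeSymm G) : Hom (X.tensor unit) X
  | ρ_inv (X : FreeSymm G) : Hom X (X.tensor unit)
  | β (X Y : FreeSymm G) : Hom (X.tensor Y) (Y.tensor X)
  | comp {X Y Z} (f : Hom X Y) (g : Hom Y Z) : Hom X Z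
  | whiskerLeft (X : FreeSymm G) {Y₁ Y₂} (f : Hom Y₁ Y₂) : Hom (X.tensor Y₁) (X.tensor Y₂)
  | whiskerRight {X₁ X₂} (f : Hom X₁ X₂) (Y : FreeSymm G) : Hom (X₁.tensor Y) (X₂.tensor Y)
  | tensor {W X Y Z} (f : Hom W Y) (g : Hom X Z) : Hom (W.tensor X) (Y.tensor Z)

/-- The congruence on formal morphisms generated by functoriality of `G → FreeSymm G` and the
axioms of a symmetric monoidal category. -/
inductive HomEquiv : ∀ {X Y : FreeSymm G}, Hom X Y → Hom X Y → Prop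
  | refl {X Y} (f : Hom X Y) : HomEquiv f f
  | symm {X Y} (f g : Hom X Y) : HomEquiv f g → HomEquiv g f
  | trans {X Y} {f g h : Hom X Y} : HomEquiv f g → HomEquiv g h → HomEquiv f h
  | comp {X Y Z} {f f' : Hom X Y} {g g' : Hom Y Z} :
      HomEquiv f f' → HomEquiv g g' → HomEquiv (f.comp g) (f'.comp g')
  | whiskerLeft (X) {Y Z} (f f' : Hom Y Z) :
      HomEquiv f f' → HomEquiv (f.whiskerLeft X) (f'.whiskerLeft X)
  | whiskerRight {Y Z} (f f' : Hom Y Z) (X) :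
      HomEquiv f f' → HomEquiv (f.whiskerRight X) (f'.whiskerRight X)
  | tensor {W X Y Z} {f f' : Hom W X} {g g' : Hom Y Z} :
      HomEquiv f f' → HomEquiv g g' → HomEquiv (f.tensor g) (f'.tensor g')
  | of_id (x : G) : HomEquiv (Hom.of (𝟙 x)) (Hom.id (FreeSymm.of x))
  | of_comp {x y z : G} (f : x ⟶ y) (g : y ⟶ z) :
      HomEquiv (Hom.of (f ≫ g)) ((Hom.of f).comp (Hom.of g))
  | tensorHom_def {X₁ Y₁ X₂ Y₂} (f : Hom X₁ Y₁) (g : Hom X₂ Y₂) :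
      HomEquiv (f.tensor g) ((f.whiskerRight X₂).comp (g.whiskerLeft Y₁))
  | comp_id {X Y} (f : Hom X Y) : HomEquiv (f.comp (Hom.id _)) f
  | id_comp {X Y} (f : Hom X Y) : HomEquiv ((Hom.id _).comp f) f
  | assoc {X Y U W : FreeSymm G} (f : Hom X U) (g : Hom U W) (h : Hom W Y) :
      HomEquiv ((f.comp g).comp h) (f.comp (g.comp h))
  | id_tensorHom_id {X Y} : HomEquiv ((Hom.id X).tensor (Hom.id Y)) (Hom.id _)
  | tensorHom_comp_tensorHom {X₁ Y₁ Z₁ X₂ Y₂ Z₂ : FreeSymm G} (f₁ : Hom X₁ Y₁) (f₂ : Hom X₂ Y₂)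
      (g₁ : Hom Y₁ Z₁) (g₂ : Hom Y₂ Z₂) :
      HomEquiv ((f₁.tensor f₂).comp (g₁.tensor g₂)) ((f₁.comp g₁).tensor (f₂.comp g₂))
  | whiskerLeft_id (X Y) : HomEquiv ((Hom.id Y).whiskerLeft X) (Hom.id (X.tensor Y))
  | id_whiskerRight (X Y) : HomEquiv ((Hom.id X).whiskerRight Y) (Hom.id (X.tensor Y))
  | α_hom_inv {X Y Z} : HomEquiv ((Hom.α_hom X Y Z).comp (Hom.α_inv X Y Z)) (Hom.id _)
  | α_inv_hom {X Y Z} : HomEquiv ((Hom.α_inv X Y Z).comp (Hom.α_hom X Y Z)) (Hom.id _)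
  | associator_naturality {X₁ X₂ X₃ Y₁ Y₂ Y₃} (f₁ : Hom X₁ Y₁) (f₂ : Hom X₂ Y₂)
      (f₃ : Hom X₃ Y₃) :
      HomEquiv (((f₁.tensor f₂).tensor f₃).comp (Hom.α_hom Y₁ Y₂ Y₃))
        ((Hom.α_hom X₁ X₂ X₃).comp (f₁.tensor (f₂.tensor f₃)))
  | ρ_hom_inv {X} : HomEquiv ((Hom.ρ_hom X).comp (Hom.ρ_inv X)) (Hom.id _)
  | ρ_inv_hom {X} : HomEquiv ((Hom.ρ_inv X).comp (Hom.ρ_hom X)) (Hom.id _)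
  | ρ_naturality {X Y} (f : Hom X Y) :
      HomEquiv ((f.whiskerRight unit).comp (Hom.ρ_hom Y)) ((Hom.ρ_hom X).comp f)
  | l_hom_inv {X} : HomEquiv ((Hom.l_hom X).comp (Hom.l_inv X)) (Hom.id _)
  | l_inv_hom {X} : HomEquiv ((Hom.l_inv X).comp (Hom.l_hom X)) (Hom.id _)
  | l_naturality {X Y} (f : Hom X Y) :
      HomEquiv ((f.whiskerLeft unit).comp (Hom.l_hom Y)) ((Hom.l_hom X).comp f)
  | pentagon {W X Y Z} :
      HomEquiv
        (((Hom.α_hom W X Y).whiskerRight Z).comp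
          ((Hom.α_hom W (X.tensor Y) Z).comp ((Hom.α_hom X Y Z).whiskerLeft W)))
        ((Hom.α_hom (W.tensor X) Y Z).comp (Hom.α_hom W X (Y.tensor Z)))
  | triangle {X Y} :
      HomEquiv ((Hom.α_hom X unit Y).comp ((Hom.l_hom Y).whiskerLeft X))
        ((Hom.ρ_hom X).whiskerRight Y)
  | β_β {X Y} : HomEquiv ((Hom.β X Y).comp (Hom.β Y X)) (Hom.id _)
  | β_naturality_right (X) {Y Z} (f : Hom Y Z) :
      HomEquiv ((f.whiskerLeft X).comp (Hom.β X Z)) ((Hom.β X Y).comp (f.whiskerRight X))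
  | β_naturality_left {X Y} (f : Hom X Y) (Z) :
      HomEquiv ((f.whiskerRight Z).comp (Hom.β Y Z)) ((Hom.β X Z).comp (f.whiskerLeft Z))
  | hexagon_forward (X Y Z) :
      HomEquiv
        ((Hom.α_hom X Y Z).comp ((Hom.β X (Y.tensor Z)).comp (Hom.α_hom Y Z X)))
        (((Hom.β X Y).whiskerRight Z).comp
          ((Hom.α_hom Y X Z).comp ((Hom.β X Z).whiskerLeft Y)))
  | hexagon_reverse (X Y Z) :
      HomEquiv
        ((Hom.α_inv X Y Z).comp ((Hom.β (X.tensor Y) Z).comp (Hom.α_inv Z X Y)))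
        (((Hom.β Y Z).whiskerLeft X).comp
          ((Hom.α_inv X Z Y).comp ((Hom.β X Z).whiskerRight Y)))

instance setoidHom (X Y : FreeSymm G) : Setoid (Hom X Y) :=
  ⟨HomEquiv, ⟨HomEquiv.refl, HomEquiv.symm _ _, HomEquiv.trans⟩⟩

instance : Category.{max u₁ v₁} (FreeSymm G) where
  Hom X Y := Quotient (FreeSymm.setoidHom X Y)
  id X := ⟦Hom.id X⟧
  comp := Quotient.map₂ Hom.comp (fun _ _ hf _ _ hg ↦ HomEquiv.comp hf hg)
  id_comp := by
    rintro X Y ⟨f⟩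
    exact Quotient.sound (.id_comp f)
  comp_id := by
    rintro X Y ⟨f⟩
    exact Quotient.sound (.comp_id f)
  assoc := by
    rintro W X Y Z ⟨f⟩ ⟨g⟩ ⟨h⟩
    exact Quotient.sound (.assoc f g h)

instance : MonoidalCategory (FreeSymm G) where
  tensorObj X Y := FreeSymm.tensor X Y
  tensorHom := Quotient.map₂ Hom.tensor (fun _ _ hf _ _ hg ↦ HomEquiv.tensor hf hg)
  whiskerLeft X _ _ f := Quot.map (fun f ↦ Hom.whiskerLeft X f) (fun f f' ↦ .whiskerLeft X f f') f
  whiskerRight f Y := Quot.map (fun f ↦ Hom.whiskerRight f Y) (fun f f' ↦ .whiskerRight f f' Y) f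
  tensorHom_def {W X Y Z} := by
    rintro ⟨f⟩ ⟨g⟩
    exact Quotient.sound (.tensorHom_def _ _)
  id_tensorHom_id _ _ := Quot.sound .id_tensorHom_id
  tensorHom_comp_tensorHom {X₁ Y₁ Z₁ X₂ Y₂ Z₂} := by
    rintro ⟨f₁⟩ ⟨f₂⟩ ⟨g₁⟩ ⟨g₂⟩
    exact Quotient.sound (.tensorHom_comp_tensorHom _ _ _ _)
  whiskerLeft_id X Y := Quot.sound (.whiskerLeft_id X Y)
  id_whiskerRight X Y := Quot.sound (.id_whiskerRight X Y)
  tensorUnit := FreeSymm.unit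
  associator X Y Z :=
    ⟨⟦Hom.α_hom X Y Z⟧, ⟦Hom.α_inv X Y Z⟧, Quotient.sound .α_hom_inv, Quotient.sound .α_inv_hom⟩
  associator_naturality {X₁ X₂ X₃ Y₁ Y₂ Y₃} := by
    rintro ⟨f₁⟩ ⟨f₂⟩ ⟨f₃⟩
    exact Quotient.sound (.associator_naturality _ _ _)
  leftUnitor X :=
    ⟨⟦Hom.l_hom X⟧, ⟦Hom.l_inv X⟧, Quotient.sound .l_hom_inv, Quotient.sound .l_inv_hom⟩
  leftUnitor_naturality {X Y} := by
    rintro ⟨f⟩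
    exact Quotient.sound (.l_naturality _)
  rightUnitor X :=
    ⟨⟦Hom.ρ_hom X⟧, ⟦Hom.ρ_inv X⟧, Quotient.sound .ρ_hom_inv, Quotient.sound .ρ_inv_hom⟩
  rightUnitor_naturality {X Y} := by
    rintro ⟨f⟩
    exact Quotient.sound (.ρ_naturality _)
  pentagon _ _ _ _ := Quotient.sound .pentagon
  triangle _ _ := Quotient.sound .triangle

instance : SymmetricCategory (FreeSymm G) where
  braiding X Y := ⟨⟦Hom.β X Y⟧, ⟦Hom.β Y X⟧, Quotient.sound .β_β, Quotient.sound .β_β⟩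
  braiding_naturality_right X Y Z := by
    rintro ⟨f⟩
    exact Quotient.sound (.β_naturality_right X f)
  braiding_naturality_left := by
    rintro X Y ⟨f⟩ Z
    exact Quotient.sound (.β_naturality_left f Z)
  hexagon_forward X Y Z := Quotient.sound (.hexagon_forward X Y Z)
  hexagon_reverse X Y Z := Quotient.sound (.hexagon_reverse X Y Z)
  symmetry X Y := Quotient.sound .β_β

/-- The canonical functor `G ⥤ FreeSymm G`. -/
def incl (G : Type u₁) [Category.{v₁} G] : G ⥤ FreeSymm G where
  obj x := .of x
  map f := ⟦Hom.of f⟧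
  map_id x := Quotient.sound (.of_id x)
  map_comp f g := Quotient.sound (.of_comp f g)

section Lift

variable {D : Type u₂} [Category.{v₂} D] [MonoidalCategory D] [SymmetricCategory D] (Φ : G ⥤ D)

/-- The functor `Φ` extended to tensor words. -/
def liftObj : FreeSymm G → D
  | FreeSymm.of x => Φ.obj x
  | FreeSymm.unit => 𝟙_ D
  | FreeSymm.tensor X Y => liftObj X ⊗ liftObj Y

/-- The functor `Φ` extended to formal morphisms. -/
def liftMapAux : ∀ {X Y : FreeSymm G}, Hom X Y → (liftObj Φ X ⟶ liftObj Φ Y)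
  | _, _, Hom.of f => Φ.map f
  | _, _, Hom.id _ => 𝟙 _
  | _, _, Hom.α_hom _ _ _ => (α_ _ _ _).hom
  | _, _, Hom.α_inv _ _ _ => (α_ _ _ _).inv
  | _, _, Hom.l_hom _ => (λ_ _).hom
  | _, _, Hom.l_inv _ => (λ_ _).inv
  | _, _, Hom.ρ_hom _ => (ρ_ _).hom
  | _, _, Hom.ρ_inv _ => (ρ_ _).inv
  | _, _, Hom.β _ _ => (β_ _ _).hom
  | _, _, Hom.comp f g => liftMapAux f ≫ liftMapAux g
  | _, _, Hom.whiskerLeft X p => liftObj Φ X ◁ liftMapAux p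
  | _, _, Hom.whiskerRight p X => liftMapAux p ▷ liftObj Φ X
  | _, _, Hom.tensor f g => liftMapAux f ⊗ₘ liftMapAux g

lemma liftMapAux_eq {X Y : FreeSymm G} {f g : Hom X Y} (h : HomEquiv f g) :
    liftMapAux Φ f = liftMapAux Φ g := by
  induction h with
  | refl => rfl
  | symm _ _ _ hfg' => exact hfg'.symm
  | trans _ _ hfg hgh => exact hfg.trans hgh
  | comp _ _ hf hg => dsimp only [liftMapAux]; rw [hf, hg]
  | whiskerLeft _ _ _ _ hf => dsimp only [liftMapAux, liftObj]; rw [hf]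
  | whiskerRight _ _ _ _ hf => dsimp only [liftMapAux, liftObj]; rw [hf]
  | tensor _ _ hfg hfg' => dsimp only [liftMapAux]; rw [hfg, hfg']
  | of_id x => exact Φ.map_id x
  | of_comp f g => exact Φ.map_comp f g
  | tensorHom_def _ _ => exact MonoidalCategory.tensorHom_def _ _
  | comp_id => exact Category.comp_id _
  | id_comp => exact Category.id_comp _
  | assoc => exact Category.assoc _ _ _
  | id_tensorHom_id => exact MonoidalCategory.id_tensorHom_id _ _
  | tensorHom_comp_tensorHom => exact MonoidalCategory.tensorHom_comp_tensorHom _ _ _ _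
  | whiskerLeft_id => exact MonoidalCategory.whiskerLeft_id _ _
  | id_whiskerRight => exact MonoidalCategory.id_whiskerRight _ _
  | α_hom_inv => exact Iso.hom_inv_id _
  | α_inv_hom => exact Iso.inv_hom_id _
  | associator_naturality => exact MonoidalCategory.associator_naturality _ _ _
  | ρ_hom_inv => exact Iso.hom_inv_id _
  | ρ_inv_hom => exact Iso.inv_hom_id _
  | ρ_naturality => exact MonoidalCategory.rightUnitor_naturality _
  | l_hom_inv => exact Iso.hom_inv_id _
  | l_inv_hom => exact Iso.inv_hom_id _
  | l_naturality => exact MonoidalCategory.leftUnitor_naturality _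
  | pentagon => exact MonoidalCategory.pentagon _ _ _ _
  | triangle => exact MonoidalCategory.triangle _ _
  | β_β => exact SymmetricCategory.symmetry _ _
  | β_naturality_right => exact BraidedCategory.braiding_naturality_right _ _
  | β_naturality_left => exact BraidedCategory.braiding_naturality_left _ _
  | hexagon_forward => exact BraidedCategory.hexagon_forward _ _ _
  | hexagon_reverse => exact BraidedCategory.hexagon_reverse _ _ _

/-- The symmetric monoidal functor `FreeSymm G ⥤ D` induced by a functor `G ⥤ D` into a symmetric
monoidal category. -/
def lift : FreeSymm G ⥤ D where
  obj := liftObj Φ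
  map {_ _} := Quotient.lift (liftMapAux Φ) (fun _ _ h ↦ liftMapAux_eq Φ h)
  map_id _ := rfl
  map_comp := by rintro _ _ _ ⟨_⟩ ⟨_⟩; rfl

instance : (lift Φ).Monoidal :=
  Functor.CoreMonoidal.toMonoidal
    { εIso := Iso.refl _
      μIso := fun _ _ ↦ Iso.refl _
      μIso_hom_natural_left := by
        rintro _ _ ⟨f⟩ X
        exact (Category.comp_id _).trans (Category.id_comp _).symm
      μIso_hom_natural_right := by
        rintro _ _ X ⟨f⟩
        exact (Category.comp_id _).trans (Category.id_comp _).symm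
      associativity := fun X Y Z => by
        change 𝟙 (liftObj Φ X ⊗ liftObj Φ Y) ▷ liftObj Φ Z ≫ 𝟙 _ ≫
            (α_ (liftObj Φ X) (liftObj Φ Y) (liftObj Φ Z)).hom =
          (α_ (liftObj Φ X) (liftObj Φ Y) (liftObj Φ Z)).hom ≫
            liftObj Φ X ◁ 𝟙 (liftObj Φ Y ⊗ liftObj Φ Z) ≫ 𝟙 _
        rw [MonoidalCategory.id_whiskerRight, MonoidalCategory.whiskerLeft_id]
        exact (Category.id_comp _).trans ((Category.id_comp _).trans
          (((congrArg _ (Category.comp_id _)).trans (Category.comp_id _)).symm))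
      left_unitality := fun X => by
        change (λ_ (liftObj Φ X)).hom = 𝟙 (𝟙_ D) ▷ liftObj Φ X ≫ 𝟙 _ ≫ (λ_ (liftObj Φ X)).hom
        rw [MonoidalCategory.id_whiskerRight]
        exact ((Category.id_comp _).trans (Category.id_comp _)).symm
      right_unitality := fun X => by
        change (ρ_ (liftObj Φ X)).hom = liftObj Φ X ◁ 𝟙 (𝟙_ D) ≫ 𝟙 _ ≫ (ρ_ (liftObj Φ X)).hom
        rw [MonoidalCategory.whiskerLeft_id]
        exact ((Category.id_comp _).trans (Category.id_comp _)).symm }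

instance : (lift Φ).Braided where
  braided _ _ := (Category.id_comp _).trans (Category.comp_id _).symm

end Lift

end FreeSymm

/-! ## Feynman categories -/

section Feynman

variable {F : Type u₂} [Category.{v₂} F] [MonoidalCategory F]

/-- The pointwise monoidal structure on the groupoid of isomorphisms of a monoidal category. -/
instance Core.instMonoidal : MonoidalCategory (Core F) where
  tensorObj X Y := ⟨X.of ⊗ Y.of⟩
  whiskerLeft X _ _ f := ⟨whiskerLeftIso X.of f.iso⟩
  whiskerRight f Y := ⟨whiskerRightIso f.iso Y.of⟩
  tensorHom f g := ⟨f.iso ⊗ᵢ g.iso⟩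
  tensorUnit := ⟨𝟙_ F⟩
  associator X Y Z := Core.isoMk (α_ X.of Y.of Z.of)
  leftUnitor X := Core.isoMk (λ_ X.of)
  rightUnitor X := Core.isoMk (ρ_ X.of)
  tensorHom_def f g := by ext; simp [MonoidalCategory.tensorHom_def]
  id_tensorHom_id X Y := by ext; simp
  tensorHom_comp_tensorHom _ _ _ _ := by ext; simp
  whiskerLeft_id X Y := by ext; simp
  id_whiskerRight X Y := by ext; simp
  associator_naturality _ _ _ := by ext; simp
  leftUnitor_naturality _ := by ext; simp
  rightUnitor_naturality _ := by ext; simp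
  pentagon W X Y Z := by ext; simp
  triangle X Y := by ext; simp

instance Core.instSymmetric [SymmetricCategory F] : SymmetricCategory (Core F) where
  braiding X Y := Core.isoMk (β_ X.of Y.of)
  braiding_naturality_right X Y Z f := by
    ext; exact BraidedCategory.braiding_naturality_right _ _
  braiding_naturality_left f Z := by
    ext; exact BraidedCategory.braiding_naturality_left _ _
  hexagon_forward X Y Z := by ext; exact BraidedCategory.hexagon_forward _ _ _
  hexagon_reverse X Y Z := by ext; exact BraidedCategory.hexagon_reverse _ _ _
  symmetry X Y := by ext; exact SymmetricCategory.symmetry _ _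

variable (F) in
/-- The comma category `(F ↓ F)`: its objects are the morphisms `X ⟶ X'` of `F`, its morphisms the
commutative squares. -/
abbrev ArrowComma : Type (max u₂ v₂) := Comma (𝟭 F) (𝟭 F)

/-- The pointwise tensor product of morphisms and of commutative squares. -/
instance ArrowComma.instMonoidal : MonoidalCategory (ArrowComma F) where
  tensorObj X Y := ⟨X.left ⊗ Y.left, X.right ⊗ Y.right, X.hom ⊗ₘ Y.hom⟩
  whiskerLeft X _ _ f := ⟨X.left ◁ f.left, X.right ◁ f.right, by
    have := f.w
    dsimp at this ⊢
    rw [← MonoidalCategory.id_tensorHom, ← MonoidalCategory.id_tensorHom,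
      MonoidalCategory.tensorHom_comp_tensorHom, MonoidalCategory.tensorHom_comp_tensorHom, this]
    simp⟩
  whiskerRight f Y := ⟨f.left ▷ Y.left, f.right ▷ Y.right, by
    have := f.w
    dsimp at this ⊢
    rw [← MonoidalCategory.tensorHom_id, ← MonoidalCategory.tensorHom_id,
      MonoidalCategory.tensorHom_comp_tensorHom, MonoidalCategory.tensorHom_comp_tensorHom, this]
    simp⟩
  tensorHom f g := ⟨f.left ⊗ₘ g.left, f.right ⊗ₘ g.right, by
    have h₁ := f.w
    have h₂ := g.w
    dsimp at h₁ h₂ ⊢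
    rw [MonoidalCategory.tensorHom_comp_tensorHom, MonoidalCategory.tensorHom_comp_tensorHom,
      h₁, h₂]⟩
  tensorUnit := ⟨𝟙_ F, 𝟙_ F, 𝟙 _⟩
  associator X Y Z := Comma.isoMk (α_ _ _ _) (α_ _ _ _)
    (MonoidalCategory.associator_naturality _ _ _).symm
  leftUnitor X := Comma.isoMk (λ_ _) (λ_ _) (by simp)
  rightUnitor X := Comma.isoMk (ρ_ _) (ρ_ _) (by simp)
  tensorHom_def f g := by ext <;> simp [MonoidalCategory.tensorHom_def]
  id_tensorHom_id X Y := by ext <;> simp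
  tensorHom_comp_tensorHom _ _ _ _ := by ext <;> simp
  whiskerLeft_id X Y := by ext <;> simp
  id_whiskerRight X Y := by ext <;> simp
  associator_naturality _ _ _ := by ext <;> simp
  leftUnitor_naturality _ := by ext <;> simp
  rightUnitor_naturality _ := by ext <;> simp
  pentagon W X Y Z := by ext <;> simp
  triangle X Y := by ext <;> simp

instance ArrowComma.instSymmetric [SymmetricCategory F] : SymmetricCategory (ArrowComma F) where
  braiding X Y := Comma.isoMk (β_ _ _) (β_ _ _) (BraidedCategory.braiding_naturality _ _).symm
  braiding_naturality_right X Y Z f := by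
    ext
    · exact BraidedCategory.braiding_naturality_right _ _
    · exact BraidedCategory.braiding_naturality_right _ _
  braiding_naturality_left f Z := by
    ext
    · exact BraidedCategory.braiding_naturality_left _ _
    · exact BraidedCategory.braiding_naturality_left _ _
  hexagon_forward X Y Z := by
    ext
    · exact BraidedCategory.hexagon_forward _ _ _
    · exact BraidedCategory.hexagon_forward _ _ _
  hexagon_reverse X Y Z := by
    ext
    · exact BraidedCategory.hexagon_reverse _ _ _
    · exact BraidedCategory.hexagon_reverse _ _ _
  symmetry X Y := by
    ext
    · exact SymmetricCategory.symmetry _ _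
    · exact SymmetricCategory.symmetry _ _

/-- The functor `(F ↓ V) ⥤ (F ↓ F)` sending `φ : X ⟶ ι v` to `φ`. -/
def commaInclusion {V : Type u₁} [Category.{v₁} V] (ι : V ⥤ F) :
    Comma (𝟭 F) ι ⥤ ArrowComma F where
  obj φ := ⟨φ.left, ι.obj φ.right, φ.hom⟩
  map f := ⟨f.left, ι.map f.right, f.w⟩

/-- `(V, F, ι)` is a Feynman category; `w` is the universe of small sets. Since `lift` is always a
symmetric monoidal functor, the first two conditions say that it is an equivalence of symmetric
monoidal categories. -/
structure IsFeynmanCategory [SymmetricCategory F] {V : Type u₁} [Groupoid.{v₁} V] (ι : V ⥤ F) :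
    Prop where
  /-- `ι` induces an equivalence `V^⊗ ≌ Iso(F)`. -/
  isomorphism_condition : (FreeSymm.lift (Core.functorToCore ι)).IsEquivalence
  /-- `ι` induces an equivalence `Iso(F ↓ V)^⊗ ≌ Iso(F ↓ F)`. -/
  hereditary_condition : (FreeSymm.lift (commaInclusion ι).core).IsEquivalence
  /-- Each comma category `(F ↓ v)` is essentially small. -/
  size_condition : ∀ v : V, EssentiallySmall.{w} (Over (ι.obj v))

end Feynman

/-! ## Ops, modules and sequences -/

section Ops

variable (F : Type u₂) [Category.{v₂} F] [MonoidalCategory F] [SymmetricCategory F]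
  (C : Type u) [Category.{v} C] [MonoidalCategory C] [SymmetricCategory C]

/-- An `F`-Op in `C`: a strong symmetric monoidal functor `F ⥤ C`. -/
structure FOp where
  functor : F ⥤ C
  braided : functor.Braided

attribute [instance] FOp.braided

variable {F C}

/-- A morphism of `F`-Ops: a monoidal natural transformation. -/
@[ext]
structure FOp.Hom (O Q : FOp F C) where
  natTrans : O.functor ⟶ Q.functor
  isMonoidal : NatTrans.IsMonoidal natTrans

instance : Category (FOp F C) where
  Hom := FOp.Hom
  id O := ⟨𝟙 O.functor, inferInstance⟩
  comp f g := ⟨f.natTrans ≫ g.natTrans,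
    haveI := f.isMonoidal
    haveI := g.isMonoidal
    inferInstance⟩
  id_comp _ := FOp.Hom.ext (Category.id_comp _)
  comp_id _ := FOp.Hom.ext (Category.comp_id _)
  assoc _ _ _ := FOp.Hom.ext (Category.assoc _ _ _)

end Ops

/-- `V`-sequences in `C`: functors to `C` from the category with the objects of `V` and only
identity morphisms. -/
abbrev VSeq (V : Type u₁) (C : Type u) [Category.{v} C] := Discrete V ⥤ C

/-- The forgetful functor from `V`-modules, i.e. functors `V ⥤ C`, to `V`-sequences. -/
def vModToVSeq (V : Type u₁) [Category.{v₁} V] (C : Type u) [Category.{v} C] :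
    (V ⥤ C) ⥤ VSeq V C :=
  (Functor.whiskeringLeft (Discrete V) V C).obj (Discrete.functor id)

section Forget

variable {F : Type u₂} [Category.{v₂} F] [MonoidalCategory F] [SymmetricCategory F]
  (C : Type u) [Category.{v} C] [MonoidalCategory C] [SymmetricCategory C]
  {V : Type u₁} [Category.{v₁} V] (ι : V ⥤ F)

/-- The forgetful functor from `F`-Ops to `V`-modules. -/
def FOp.toVMod : FOp F C ⥤ (V ⥤ C) where
  obj O := ι ⋙ O.functor
  map f := Functor.whiskerLeft ι f.natTrans
  map_id _ := rfl
  map_comp _ _ := rfl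

/-- The forgetful functor from `F`-Ops to `V`-sequences, `O ↦ (O (ι v))_v`. -/
def FOp.toVSeq : FOp F C ⥤ VSeq V C := FOp.toVMod C ι ⋙ vModToVSeq V C

end Forget

/-! ## Smallness and cofibrant generation -/

/-- `X` is small: for some cardinal `κ`, every regular `lam ≥ κ` and every `lam`-sequence `Φ` in
`C`, the functor `Hom(X, -)` preserves the colimit of `Φ`. -/
def IsSmallObject {C : Type u} [Category.{v} C] (X : C) : Prop :=
  ∃ κ : Cardinal.{w}, ∀ lam : Cardinal.{w}, lam.IsRegular → κ ≤ lam →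
    ∀ Φ : lam.ord.ToType ⥤ C, Φ.IsWellOrderContinuous →
      PreservesColimit Φ (coyoneda.obj (Opposite.op X))

/-- The model category `D` is cofibrantly generated, with `I` and `J` as sets of generating
cofibrations and of generating trivial cofibrations: `I` and `J` are (`w`-small) sets which permit
the small object argument, a map is a trivial fibration iff it has the right lifting property with
respect to `I`, and a fibration iff it has the right lifting property with respect to `J`. -/
structure IsCofibrantlyGeneratedBy (D : Type u) [Category.{v} D] [ModelCategory D]
    (I J : MorphismProperty D) : Prop where
  isSmall_I : MorphismProperty.IsSmall.{w} I
  isSmall_J : MorphismProperty.IsSmall.{w} J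
  smallObjectArgument_I : MorphismProperty.HasSmallObjectArgument.{w} I
  smallObjectArgument_J : MorphismProperty.HasSmallObjectArgument.{w} J
  rlp_I : I.rlp = trivialFibrations D
  rlp_J : J.rlp = fibrations D

/-- The model category `D` is cofibrantly generated. -/
def IsCofibrantlyGenerated (D : Type u) [Category.{v} D] [ModelCategory D] : Prop :=
  ∃ I J : MorphismProperty D, IsCofibrantlyGeneratedBy.{w} D I J

/-! ## The levelwise model structure on `V`-sequences -/

namespace VSeq

section Classes

variable {V : Type u₁} {C : Type u} [Category.{v} C]

instance [CategoryWithFibrations C] : CategoryWithFibrations (VSeq V C) :=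
  ⟨(fibrations C).functorCategory _⟩

instance [CategoryWithCofibrations C] : CategoryWithCofibrations (VSeq V C) :=
  ⟨(cofibrations C).functorCategory _⟩

instance [CategoryWithWeakEquivalences C] : CategoryWithWeakEquivalences (VSeq V C) :=
  ⟨(weakEquivalences C).functorCategory _⟩

lemma fibration_iff_levelwise [CategoryWithFibrations C] {X Y : VSeq V C} (f : X ⟶ Y) :
    Fibration f ↔ ∀ v, Fibration (f.app v) :=
  ⟨fun h v ↦ ⟨(show (fibrations C).functorCategory _ f from h.mem) v⟩,
    fun h ↦ ⟨show (fibrations C).functorCategory _ f from fun v ↦ (h v).mem⟩⟩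

lemma cofibration_iff_levelwise [CategoryWithCofibrations C] {X Y : VSeq V C} (f : X ⟶ Y) :
    Cofibration f ↔ ∀ v, Cofibration (f.app v) :=
  ⟨fun h v ↦ ⟨(show (cofibrations C).functorCategory _ f from h.mem) v⟩,
    fun h ↦ ⟨show (cofibrations C).functorCategory _ f from fun v ↦ (h v).mem⟩⟩

lemma weakEquivalence_iff_levelwise [CategoryWithWeakEquivalences C] {X Y : VSeq V C}
    (f : X ⟶ Y) : WeakEquivalence f ↔ ∀ v, WeakEquivalence (f.app v) :=
  ⟨fun h v ↦ ⟨(show (weakEquivalences C).functorCategory _ f from h.mem) v⟩,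
    fun h ↦ ⟨show (weakEquivalences C).functorCategory _ f from fun v ↦ (h v).mem⟩⟩

lemma hasLiftingProperty {A B X Y : VSeq V C} (i : A ⟶ B) (p : X ⟶ Y)
    (h : ∀ v, HasLiftingProperty (i.app v) (p.app v)) : HasLiftingProperty i p where
  sq_hasLift {f g} sq := by
    have sq' (v) : CommSq (f.app v) (i.app v) (p.app v) (g.app v) := ⟨congr_app sq.w v⟩
    exact ⟨⟨{ l := Discrete.natTrans fun v ↦ (sq' v).lift }⟩⟩

lemma hasFactorization (W₁ W₂ : MorphismProperty C) [W₁.HasFactorization W₂] :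
    (W₁.functorCategory (Discrete V)).HasFactorization (W₂.functorCategory (Discrete V)) where
  nonempty_mapFactorizationData f :=
    have d (v : Discrete V) := MorphismProperty.factorizationData W₁ W₂ (f.app v)
    ⟨{  Z := Discrete.functor fun v ↦ (d ⟨v⟩).Z
        i := Discrete.natTrans fun v ↦ (d v).i
        p := Discrete.natTrans fun v ↦ (d v).p
        hi := fun v ↦ (d v).hi
        hp := fun v ↦ (d v).hp }⟩

end Classes

/-- The levelwise model structure on `V`-sequences. -/
instance instModelCategory (V : Type u₁) (C : Type u) [Category.{v} C] [ModelCategory C] :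
    ModelCategory (VSeq V C) where
  cm2 :=
    { comp_mem := fun f g hf hg ↦ by
        simp only [← weakEquivalence_iff, weakEquivalence_iff_levelwise] at hf hg ⊢
        exact fun v ↦ (weakEquivalence_iff _).2 ((weakEquivalences C).comp_mem _ _
          ((weakEquivalence_iff _).1 (hf v)) ((weakEquivalence_iff _).1 (hg v)))
      of_postcomp := fun f g hg hfg ↦ by
        simp only [← weakEquivalence_iff, weakEquivalence_iff_levelwise] at hg hfg ⊢
        exact fun v ↦ (weakEquivalence_iff _).2 ((weakEquivalences C).of_postcomp
          (f.app v) (g.app v) ((weakEquivalence_iff _).1 (hg v)) ((weakEquivalence_iff _).1 (hfg v)))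
      of_precomp := fun f g hf hfg ↦ by
        simp only [← weakEquivalence_iff, weakEquivalence_iff_levelwise] at hf hfg ⊢
        exact fun v ↦ (weakEquivalence_iff _).2 ((weakEquivalences C).of_precomp
          (f.app v) (g.app v) ((weakEquivalence_iff _).1 (hf v))
          ((weakEquivalence_iff _).1 (hfg v))) }
  cm3a := by
    change ((weakEquivalences C).functorCategory (Discrete V)).IsStableUnderRetracts
    infer_instance
  cm3b := by
    change ((fibrations C).functorCategory (Discrete V)).IsStableUnderRetracts
    infer_instance
  cm3c := by
    change ((cofibrations C).functorCategory (Discrete V)).IsStableUnderRetracts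
    infer_instance
  cm4a i p hi hi' hp := hasLiftingProperty i p fun v ↦
    have := (cofibration_iff_levelwise i).1 hi v
    have := (weakEquivalence_iff_levelwise i).1 hi' v
    have := (fibration_iff_levelwise p).1 hp v
    inferInstance
  cm4b i p hi hp hp' := hasLiftingProperty i p fun v ↦
    have := (cofibration_iff_levelwise i).1 hi v
    have := (weakEquivalence_iff_levelwise p).1 hp' v
    have := (fibration_iff_levelwise p).1 hp v
    inferInstance
  cm5a := by
    have h : trivialCofibrations (VSeq V C) = (trivialCofibrations C).functorCategory _ := by
      ext X Y f
      exact forall_and.symm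
    rw [h]
    exact hasFactorization _ (fibrations C)
  cm5b := by
    have h : trivialFibrations (VSeq V C) = (trivialFibrations C).functorCategory _ := by
      ext X Y f
      exact forall_and.symm
    rw [h]
    exact hasFactorization (cofibrations C) _

end VSeq

/-! ## Monoidal fibrant replacement and coherent path objects -/

section Path

variable (C : Type u) [Category.{v} C] [MonoidalCategory C] [SymmetricCategory C]

/-- The functor `X ↦ X ⨯ X`. -/
noncomputable def squareFunctor [HasBinaryProducts C] : C ⥤ C where
  obj X := X ⨯ X
  map f := prod.map f f

variable {C} in
/-- The map `(π₁ ⊗ π₁, π₂ ⊗ π₂) : (X ⨯ X) ⊗ (Y ⨯ Y) ⟶ (X ⊗ Y) ⨯ (X ⊗ Y)`. -/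
noncomputable def squareμ [HasBinaryProducts C] (X Y : C) :
    (X ⨯ X) ⊗ (Y ⨯ Y) ⟶ (X ⊗ Y) ⨯ (X ⊗ Y) :=
  prod.lift (prod.fst ⊗ₘ prod.fst) (prod.snd ⊗ₘ prod.snd)

/-- The (lax) symmetric monoidal structure on `X ↦ X ⨯ X` given by `squareμ` and the diagonal of
the unit object. -/
noncomputable instance [HasBinaryProducts C] : (squareFunctor C).LaxBraided where
  ε := diag (𝟙_ C)
  μ X Y := squareμ X Y
  μ_natural_left {X Y} f Z := by
    change prod.map f f ▷ (Z ⨯ Z) ≫ squareμ Y Z = squareμ X Z ≫ prod.map (f ▷ Z) (f ▷ Z)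
    apply prod.hom_ext <;>
      simp [squareμ, prod.lift_fst, prod.lift_snd, prod.lift_fst_assoc,
        prod.lift_snd_assoc, -prod.comp_lift, -prod.lift_map, ← tensorHom_id]
  μ_natural_right {X Y} Z f := by
    change (Z ⨯ Z) ◁ prod.map f f ≫ squareμ Z Y = squareμ Z X ≫ prod.map (Z ◁ f) (Z ◁ f)
    apply prod.hom_ext <;>
      simp [squareμ, prod.lift_fst, prod.lift_snd, prod.lift_fst_assoc,
        prod.lift_snd_assoc, -prod.comp_lift, -prod.lift_map, ← id_tensorHom]
  associativity X Y Z := by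
    change squareμ X Y ▷ (Z ⨯ Z) ≫ squareμ (X ⊗ Y) Z ≫ prod.map (α_ X Y Z).hom (α_ X Y Z).hom =
      (α_ (X ⨯ X) (Y ⨯ Y) (Z ⨯ Z)).hom ≫ (X ⨯ X) ◁ squareμ Y Z ≫ squareμ X (Y ⊗ Z)
    apply prod.hom_ext <;>
      simp [squareμ, prod.lift_fst, prod.lift_snd, prod.lift_fst_assoc,
        prod.lift_snd_assoc, -prod.comp_lift, -prod.lift_map, ← tensorHom_id, ← id_tensorHom]
  left_unitality X := by
    change (λ_ (X ⨯ X)).hom =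
      diag (𝟙_ C) ▷ (X ⨯ X) ≫ squareμ (𝟙_ C) X ≫ prod.map (λ_ X).hom (λ_ X).hom
    apply prod.hom_ext <;>
      simp [squareμ, diag, prod.lift_fst, prod.lift_snd, prod.lift_fst_assoc,
        prod.lift_snd_assoc, -prod.comp_lift, -prod.lift_map, ← tensorHom_id]
  right_unitality X := by
    change (ρ_ (X ⨯ X)).hom =
      (X ⨯ X) ◁ diag (𝟙_ C) ≫ squareμ X (𝟙_ C) ≫ prod.map (ρ_ X).hom (ρ_ X).hom
    apply prod.hom_ext <;>
      simp [squareμ, diag, prod.lift_fst, prod.lift_snd, prod.lift_fst_assoc,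
        prod.lift_snd_assoc, -prod.comp_lift, -prod.lift_map, ← id_tensorHom]
  braided X Y := by
    change squareμ X Y ≫ prod.map (β_ X Y).hom (β_ X Y).hom =
      (β_ (X ⨯ X) (Y ⨯ Y)).hom ≫ squareμ Y X
    apply prod.hom_ext <;>
      simp [squareμ, prod.lift_fst, prod.lift_snd, prod.lift_fst_assoc, prod.lift_snd_assoc,
        -prod.comp_lift, -prod.lift_map]

/-- The diagonal transformation `X ⟶ X ⨯ X`. -/
noncomputable def diagonalTransformation [HasBinaryProducts C] : 𝟭 C ⟶ squareFunctor C where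
  app X := diag X
  naturality X Y f := by simp [squareFunctor]

variable [ModelCategory C]

/-- A symmetric monoidal fibrant replacement functor: a (lax) symmetric monoidal functor `R` with a
monoidal natural weak equivalence `X ⟶ R X`, all `R X` being fibrant. -/
structure MonoidalFibrantReplacement where
  R : C ⥤ C
  laxBraided : R.LaxBraided
  j : 𝟭 C ⟶ R
  isMonoidal : NatTrans.IsMonoidal j
  weakEquivalence (X : C) : WeakEquivalence (j.app X)
  isFibrant (X : C) : IsFibrant (R.obj X)

/-- The objects of the full symmetric monoidal subcategory of `C` generated by the fibrant
objects, i.e. the finite tensor products of fibrant objects. -/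
inductive fibrantTensors : ObjectProperty C
  | of (X : C) (hX : IsFibrant X) : fibrantTensors X
  | unit : fibrantTensors (𝟙_ C)
  | tensor (X Y : C) (hX : fibrantTensors X) (hY : fibrantTensors Y) : fibrantTensors (X ⊗ Y)

instance : (fibrantTensors C).IsMonoidal where
  prop_unit := .unit
  prop_tensor X Y hX hY := .tensor X Y hX hY

/-- Coherent path objects for fibrant objects: a (lax) symmetric monoidal functor `P` on the full
symmetric monoidal subcategory generated by the fibrant objects, with monoidal natural
transformations `A ⟶ P A ⟶ A ⨯ A` which factor the diagonal and are respectively a weak equivalence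
and a fibration if `A` is fibrant. -/
structure CoherentPathObjects where
  P : (fibrantTensors C).FullSubcategory ⥤ C
  laxBraided : P.LaxBraided
  φ : (fibrantTensors C).ι ⟶ P
  ψ : P ⟶ (fibrantTensors C).ι ⋙ squareFunctor C
  isMonoidal_φ : NatTrans.IsMonoidal φ
  isMonoidal_ψ : NatTrans.IsMonoidal ψ
  fac : φ ≫ ψ = Functor.whiskerLeft (fibrantTensors C).ι (diagonalTransformation C)
  weakEquivalence_φ (A : (fibrantTensors C).FullSubcategory) (hA : IsFibrant A.obj) :
    WeakEquivalence (φ.app A)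
  fibration_ψ (A : (fibrantTensors C).FullSubcategory) (hA : IsFibrant A.obj) :
    Fibration (ψ.app A)

end Path

/-! The model structure is transferred along the evaluation of `F`-Ops at the vertices, or at a
small family of objects representing them when `V` has too many objects. Transfer
(`exists_modelCategory_of_adjunction`) asks that `F`-Ops be complete and cocomplete, that evaluation
be a right adjoint preserving filtered colimits, and that every map with the left lifting property
against fibrations be a weak equivalence.

The last point is Quillen's path object argument (`weakEquivalence_map_of_pathObject`). It needs
fibrant replacements and path objects in `F`-Ops, but composing an Op with the lax functors `R` or
`P` yields only a lax symmetric monoidal functor. The remedy, and the heart of the proof, is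
`IsFeynmanCategory.nonempty_strongCoreflection`: every lax symmetric monoidal functor `A` on a
Feynman category has a coreflection into the strong ones whose counit is invertible at the vertices.
On `Iso(F) ≃ V^⊗` it is the strong functor freely generated by the values of `A` at the vertices. A
morphism to a vertex acts as it does in `A`, and the hereditary condition `Iso(F ↓ F) ≃ Iso(F ↓
V)^⊗` spreads this action to all morphisms. Since weak equivalences and fibrations are read off at
the vertices, nothing is lost in passing from `A` to its coreflection.

The same device gives limits (`FOp.hasLimitsOfShape`), because a pointwise limit of Ops is lax, and
free Ops (`FOp.eval_isRightAdjoint`), because the free lax functor is a left Kan extension which the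
coreflection shows to be strong. Sifted colimits are pointwise, since the tensor product of the
closed category `C` preserves colimits in each variable. This covers filtered colimits, hence
smallness, and reflexive coequalizers, from which all colimits follow by adjoint lifting
(`FOp.hasColimits`).

The path object argument ends in the homotopy category of `C`, through the fact that a map inverted
there is a weak equivalence (`weakEquivalence_of_isIso_map`). -/

set_option linter.unusedSectionVars false

/-! ## Tensor products of maps into the values of a lax monoidal functor -/

namespace CategoryTheory.Functor.LaxMonoidal

variable {E : Type u₁} [Category.{v₁} E] [MonoidalCategory E]
  {D : Type u₂} [Category.{v₂} D] [MonoidalCategory D] (N : E ⥤ D)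

section

variable [N.LaxMonoidal]

/-- The tensor product of maps into the values of a lax monoidal functor. -/
abbrev laxTensor {A B : D} {X Y : E} (a : A ⟶ N.obj X) (b : B ⟶ N.obj Y) : A ⊗ B ⟶ N.obj (X ⊗ Y) :=
  (a ⊗ₘ b) ≫ μ N X Y

variable {A A' A'' : D} {X Y Z : E}

lemma associator_laxTensor (a : A ⟶ N.obj X) (b : A' ⟶ N.obj Y) (c : A'' ⟶ N.obj Z) :
    (α_ A A' A'').hom ≫ laxTensor N a (laxTensor N b c) =
      laxTensor N (laxTensor N a b) c ≫ N.map (α_ X Y Z).hom := by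
  have h := associativity N X Y Z
  simp only [laxTensor, Category.assoc]
  calc _ = ((a ⊗ₘ b) ⊗ₘ c) ≫ (α_ (N.obj X) (N.obj Y) (N.obj Z)).hom ≫
        N.obj X ◁ μ N Y Z ≫ μ N X (Y ⊗ Z) := by
          rw [associator_naturality_assoc, ← id_tensorHom, tensorHom_comp_tensorHom_assoc,
            Category.comp_id]
    _ = _ := by
      rw [← h, ← tensorHom_id, tensorHom_comp_tensorHom_assoc, Category.comp_id]

lemma leftUnitor_laxTensor (a : A ⟶ N.obj X) :
    (λ_ A).hom ≫ a = laxTensor N (ε N) a ≫ N.map (λ_ X).hom := by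
  have h := left_unitality N X
  rw [← leftUnitor_naturality, h, laxTensor, tensorHom_def', Category.assoc, Category.assoc]

lemma rightUnitor_laxTensor (a : A ⟶ N.obj X) :
    (ρ_ A).hom ≫ a = laxTensor N a (ε N) ≫ N.map (ρ_ X).hom := by
  have h := right_unitality N X
  rw [← rightUnitor_naturality, h, laxTensor, MonoidalCategory.tensorHom_def a, Category.assoc, Category.assoc]

end

lemma braiding_laxTensor [BraidedCategory E] [BraidedCategory D] [N.LaxBraided] {A A' : D} {X Y : E}
    (a : A ⟶ N.obj X) (b : A' ⟶ N.obj Y) :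
    (β_ A A').hom ≫ laxTensor N b a = laxTensor N a b ≫ N.map (β_ X Y).hom := by
  rw [laxTensor, laxTensor, Category.assoc, LaxBraided.braided, BraidedCategory.braiding_naturality_assoc]

end CategoryTheory.Functor.LaxMonoidal

/-! ## Universal property of the free symmetric monoidal category -/

namespace FreeSymm

open Functor.LaxMonoidal Functor.OplaxMonoidal

variable {G : Type u₁} [Category.{v₁} G] {D : Type u₂} [Category.{v₂} D] [MonoidalCategory D]
  [SymmetricCategory D]

section LaxExtension

variable {Φ : G ⥤ D} {N : FreeSymm G ⥤ D} [N.LaxBraided] (t : Φ ⟶ incl G ⋙ N)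

/-- The components of the extension of `t` to tensor words. -/
def laxExtApp : ∀ X : FreeSymm G, (lift Φ).obj X ⟶ N.obj X
  | .of x => t.app x
  | .unit => ε N
  | .tensor X Y => laxTensor N (laxExtApp X) (laxExtApp Y)

lemma laxExtApp_naturality {X Y : FreeSymm G} (f : Hom X Y) :
    (lift Φ).map ⟦f⟧ ≫ laxExtApp t Y = laxExtApp t X ≫ N.map ⟦f⟧ := by
  induction f with
  | of f => exact t.naturality f
  | id X =>
    change 𝟙 _ ≫ laxExtApp t X = laxExtApp t X ≫ N.map (𝟙 X)
    rw [N.map_id, Category.comp_id, Category.id_comp]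
  | α_hom X Y Z => exact associator_laxTensor N _ _ _
  -- Naturality for an inverse structure map follows from that of the map itself by cancelling
  -- isomorphisms on both sides.
  | α_inv X Y Z =>
    exact ((α_ ((lift Φ).obj X) ((lift Φ).obj Y) ((lift Φ).obj Z)).inv_comp_eq.2
      (((N.mapIso (α_ X Y Z)).comp_inv_eq.2
        (associator_laxTensor N (laxExtApp t X) (laxExtApp t Y) (laxExtApp t Z))).symm.trans
          (Category.assoc _ _ _)))
  | l_hom X => exact leftUnitor_laxTensor N _
  | l_inv X =>
    exact ((λ_ ((lift Φ).obj X)).inv_comp_eq.2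
      (((N.mapIso (λ_ X)).comp_inv_eq.2
        (leftUnitor_laxTensor N (laxExtApp t X))).symm.trans (Category.assoc _ _ _)))
  | ρ_hom X => exact rightUnitor_laxTensor N _
  | ρ_inv X =>
    exact ((ρ_ ((lift Φ).obj X)).inv_comp_eq.2
      (((N.mapIso (ρ_ X)).comp_inv_eq.2
        (rightUnitor_laxTensor N (laxExtApp t X))).symm.trans (Category.assoc _ _ _)))
  | β X Y => exact braiding_laxTensor N (laxExtApp t X) (laxExtApp t Y)
  | @comp X Y Z f g hf hg =>
    change ((lift Φ).map ⟦f⟧ ≫ (lift Φ).map ⟦g⟧) ≫ laxExtApp t Z = _ ≫ N.map (⟦f⟧ ≫ ⟦g⟧)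
    rw [Category.assoc, hg, reassoc_of% hf, N.map_comp]
  | @whiskerLeft X Y₁ Y₂ f hf =>
    let f' : Y₁ ⟶ Y₂ := ⟦f⟧
    change (lift Φ).obj X ◁ (lift Φ).map f' ≫ laxTensor N (laxExtApp t X) (laxExtApp t Y₂) =
      laxTensor N (laxExtApp t X) (laxExtApp t Y₁) ≫ N.map (X ◁ f')
    rw [laxTensor, laxTensor, Category.assoc, ← μ_natural_right, ← id_tensorHom, ← id_tensorHom,
      tensorHom_comp_tensorHom_assoc, tensorHom_comp_tensorHom_assoc, hf, Category.comp_id,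
      Category.id_comp]
  | @whiskerRight X₁ X₂ f Y hf =>
    let f' : X₁ ⟶ X₂ := ⟦f⟧
    change (lift Φ).map f' ▷ (lift Φ).obj Y ≫ laxTensor N (laxExtApp t X₂) (laxExtApp t Y) =
      laxTensor N (laxExtApp t X₁) (laxExtApp t Y) ≫ N.map (f' ▷ Y)
    rw [laxTensor, laxTensor, Category.assoc, ← μ_natural_left, ← tensorHom_id, ← tensorHom_id,
      tensorHom_comp_tensorHom_assoc, tensorHom_comp_tensorHom_assoc, hf, Category.comp_id,
      Category.id_comp]
  | @tensor W X Y Z f g hf hg =>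
    let f' : W ⟶ Y := ⟦f⟧
    let g' : X ⟶ Z := ⟦g⟧
    change ((lift Φ).map f' ⊗ₘ (lift Φ).map g') ≫ laxTensor N (laxExtApp t Y) (laxExtApp t Z) =
      laxTensor N (laxExtApp t W) (laxExtApp t X) ≫ N.map (f' ⊗ₘ g')
    rw [laxTensor, laxTensor, Category.assoc, ← μ_natural,
      tensorHom_comp_tensorHom_assoc, tensorHom_comp_tensorHom_assoc, hf, hg]

/-- A natural transformation `Φ ⟶ incl G ⋙ N` with `N` lax symmetric monoidal extends to the
symmetric monoidal functor `lift Φ`. -/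
def laxExt : lift Φ ⟶ N where
  app := laxExtApp t
  naturality := by
    rintro X Y ⟨f⟩
    exact laxExtApp_naturality t f

instance laxExt_isMonoidal : NatTrans.IsMonoidal (laxExt t) where
  unit := Category.id_comp _
  tensor _ _ := Category.id_comp _

end LaxExtension

/-- Since `P` is strong, its unit and tensorators are epimorphisms, so monoidality forces the
components at the unit and at tensor words. The target may be merely lax. -/
lemma monoidal_ext {P N : FreeSymm G ⥤ D} [P.Monoidal] [N.LaxMonoidal] (σ τ : P ⟶ N)
    [NatTrans.IsMonoidal σ] [NatTrans.IsMonoidal τ]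
    (h : ∀ x, σ.app ((incl G).obj x) = τ.app ((incl G).obj x)) : σ = τ := by
  ext X
  induction X with
  | of x => exact h x
  | unit =>
    exact (cancel_epi (ε P)).1 ((NatTrans.IsMonoidal.unit (τ := σ)).trans
      (NatTrans.IsMonoidal.unit (τ := τ)).symm)
  | tensor X Y hX hY =>
    refine (cancel_epi (μ P X Y)).1 ((NatTrans.IsMonoidal.tensor (τ := σ) X Y).trans
      (Eq.trans ?_ (NatTrans.IsMonoidal.tensor (τ := τ) X Y).symm))
    rw [hX, hY]

/-- When `N` is strong, the components are assembled from isomorphisms only. Hence a strong functor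
on `FreeSymm G` is recovered from its restriction to `G`. -/
lemma isIso_laxExt {Φ : G ⥤ D} {N : FreeSymm G ⥤ D} [N.Braided] (t : Φ ⟶ incl G ⋙ N) [IsIso t] :
    IsIso (laxExt t) := by
  have (X : FreeSymm G) : IsIso ((laxExt t).app X) := by
    induction X with
    | of x => exact inferInstanceAs (IsIso (t.app x))
    | unit => exact inferInstanceAs (IsIso (ε N))
    | tensor X Y hX hY =>
      exact inferInstanceAs (IsIso (((laxExt t).app X ⊗ₘ (laxExt t).app Y) ≫ μ N X Y))
  exact NatIso.isIso_of_isIso_app _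

/-- Needed to keep strong coreflections inside the tensor products of fibrant objects, where the
path object functor is defined. -/
lemma liftObj_mem (Φ : G ⥤ D) (Q : ObjectProperty D) [Q.IsMonoidal] (h : ∀ x, Q (Φ.obj x))
    (X : FreeSymm G) : Q ((lift Φ).obj X) := by
  induction X with
  | of x => exact h x
  | unit => exact Q.prop_unit
  | tensor X Y hX hY => exact Q.prop_tensor hX hY

end FreeSymm

/-! ## Categories equivalent to a free symmetric monoidal category -/

namespace CategoryTheory

open Functor.LaxMonoidal Functor.OplaxMonoidal

section

variable {E : Type*} [Category* E] [MonoidalCategory E] {E' : Type*} [Category* E']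
  [MonoidalCategory E'] {D : Type*} [Category* D] [MonoidalCategory D]

/-- The unit and tensorators of `H` are invertible and every object is isomorphic to a value of `H`,
so the monoidality identities transport by naturality. -/
lemma NatTrans.IsMonoidal.of_whiskerLeft (H : E ⥤ E') [H.Monoidal] [H.EssSurj] {P Q : E' ⥤ D}
    [P.LaxMonoidal] [Q.LaxMonoidal] (σ : P ⟶ Q)
    [NatTrans.IsMonoidal (Functor.whiskerLeft H σ)] : NatTrans.IsMonoidal σ where
  unit := by
    have h := NatTrans.IsMonoidal.unit (τ := Functor.whiskerLeft H σ)
    simp only [comp_ε, Functor.whiskerLeft_app, Category.assoc, σ.naturality] at h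
    rwa [← Category.assoc, cancel_mono] at h
  tensor X Y := by
    let e := H.objObjPreimageIso X
    let e' := H.objObjPreimageIso Y
    have h := NatTrans.IsMonoidal.tensor (τ := Functor.whiskerLeft H σ) (H.objPreimage X)
      (H.objPreimage Y)
    simp only [comp_μ, Functor.whiskerLeft_app, Category.assoc, σ.naturality,
      Functor.comp_obj] at h
    rw [← Category.assoc, ← Category.assoc, cancel_mono] at h
    rw [← cancel_epi (P.map e.hom ⊗ₘ P.map e'.hom), μ_natural_assoc, tensorHom_comp_tensorHom_assoc,
      σ.naturality, σ.naturality, σ.naturality, ← tensorHom_comp_tensorHom_assoc, μ_natural,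
      reassoc_of% h]

/-- The inverse of a braided monoidal equivalence is braided. -/
@[reducible]
noncomputable def Equivalence.inverseBraided {E : Type*} [Category* E] [MonoidalCategory E]
    [BraidedCategory E] {E' : Type*} [Category* E'] [MonoidalCategory E'] [BraidedCategory E']
    (e : E ≌ E') [e.functor.Braided] : e.inverse.Braided :=
  letI := e.inverseMonoidal
  { braided X Y := by
      apply e.functor.map_injective
      -- The tensorator of the inverse is characterized by monoidality of the counit. After applying
      -- `e.functor`, compatibility with braidings becomes naturality of the braiding with respect
      -- to the counit.
      have h (X Y : E') : μ e.functor _ _ ≫ e.functor.map (μ e.inverse X Y) ≫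
          e.counit.app (X ⊗ Y) = e.counit.app X ⊗ₘ e.counit.app Y := by
        have : e.IsMonoidal :=
          { leftAdjoint_ε := rfl
            leftAdjoint_μ := fun _ _ ↦ rfl }
        have := NatTrans.IsMonoidal.tensor (τ := e.counit) X Y
        rwa [comp_μ, Category.assoc, id_μ, Category.comp_id] at this
      rw [← cancel_epi (μ e.functor _ _), ← cancel_mono (e.counit.app _)]
      simp only [Functor.map_comp, Category.assoc]
      have h' := e.counit.naturality (β_ X Y).hom
      dsimp at h'
      rw [h', reassoc_of% h X Y, Functor.LaxBraided.braided_assoc, h Y X,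
        BraidedCategory.braiding_naturality] }

end

section

variable {G : Type u₁} [Category.{v₁} G] {E : Type u₂} [Category.{v₂} E] [MonoidalCategory E]
  [SymmetricCategory E] {D : Type u} [Category.{v} D] [MonoidalCategory D] [SymmetricCategory D]
  (H : FreeSymm G ⥤ E)

/-- Monoidal transformations out of a strong monoidal functor on a category equivalent to
`FreeSymm G` are determined by their values on `G`. -/
lemma FreeSymm.monoidal_ext_of_essSurj [H.Monoidal] [H.EssSurj] {P Q : E ⥤ D} [P.Monoidal]
    [Q.LaxMonoidal] (σ τ : P ⟶ Q) [NatTrans.IsMonoidal σ] [NatTrans.IsMonoidal τ]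
    (h : ∀ x, σ.app (H.obj ((FreeSymm.incl G).obj x)) = τ.app (H.obj ((FreeSymm.incl G).obj x))) :
    σ = τ := by
  have h' := FreeSymm.monoidal_ext (Functor.whiskerLeft H σ) (Functor.whiskerLeft H τ) h
  ext X
  rw [← cancel_epi (P.map (H.objObjPreimageIso X).hom), σ.naturality, τ.naturality]
  exact congrArg (· ≫ _) (NatTrans.congr_app h' (H.objPreimage X))

/-- A natural transformation defined on `G` extends to a monoidal transformation on a category
equivalent to `FreeSymm G`. -/
lemma FreeSymm.exists_monoidal_extension [H.Braided] [H.IsEquivalence] (P Q : E ⥤ D) [P.Braided]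
    [Q.LaxBraided] (t : FreeSymm.incl G ⋙ H ⋙ P ⟶ FreeSymm.incl G ⋙ H ⋙ Q) :
    ∃ σ : P ⟶ Q, NatTrans.IsMonoidal σ ∧
      ∀ x, σ.app (H.obj ((FreeSymm.incl G).obj x)) = t.app x := by
  -- As `H ⋙ P` is strong, it is isomorphic to the functor freely generated by its restriction to
  -- `G`, so `t` extends to `H ⋙ P`. The result descends along `H` because whiskering with an
  -- equivalence is fully faithful.
  let i : FreeSymm.lift (FreeSymm.incl G ⋙ H ⋙ P) ⟶ H ⋙ P := FreeSymm.laxExt (𝟙 _)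
  have hi : IsIso i := FreeSymm.isIso_laxExt _
  let e := asIso i
  have : NatTrans.IsMonoidal e.hom := FreeSymm.laxExt_isMonoidal _
  let s : H ⋙ P ⟶ H ⋙ Q := e.inv ≫ FreeSymm.laxExt t
  have hs : NatTrans.IsMonoidal s := inferInstance
  let σ : P ⟶ Q := ((Functor.whiskeringLeft _ _ D).obj H).preimage s
  have hσ : Functor.whiskerLeft H σ = s := ((Functor.whiskeringLeft _ _ D).obj H).map_preimage s
  rw [← hσ] at hs
  refine ⟨σ, .of_whiskerLeft H σ, fun x ↦ ?_⟩
  have h₁ : σ.app (H.obj ((FreeSymm.incl G).obj x)) = s.app ((FreeSymm.incl G).obj x) :=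
    NatTrans.congr_app hσ ((FreeSymm.incl G).obj x)
  rw [h₁]
  refine (cancel_epi (e.hom.app ((FreeSymm.incl G).obj x))).1 ?_
  change _ ≫ e.inv.app _ ≫ (FreeSymm.laxExt t).app ((FreeSymm.incl G).obj x) = _
  rw [Iso.hom_inv_id_app_assoc]
  exact (Category.id_comp _).symm

/-- A functor on `G` extends to a strong symmetric monoidal functor on a category equivalent to
`FreeSymm G`. -/
lemma FreeSymm.exists_braided_extension [H.Braided] [H.IsEquivalence] (Φ : G ⥤ D) :
    ∃ (N : E ⥤ D) (_ : N.Braided) (_ : FreeSymm.incl G ⋙ H ⋙ N ≅ Φ),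
      ∀ Q : ObjectProperty D, Q.IsMonoidal → (∀ x, Q (Φ.obj x)) → ∀ X, Q (N.obj X) := by
  have : H.asEquivalence.functor.Braided := inferInstanceAs H.Braided
  let := H.asEquivalence.inverseBraided
  refine ⟨H.asEquivalence.inverse ⋙ FreeSymm.lift Φ, inferInstance,
    Functor.isoWhiskerLeft (FreeSymm.incl G)
      (Functor.isoWhiskerRight H.asEquivalence.unitIso.symm (FreeSymm.lift Φ)),
    fun Q _ h X ↦ FreeSymm.liftObj_mem Φ Q h _⟩

end

end CategoryTheory

/-! ## Monoidal structures on the functors relating `F`, `Core F` and `(F ↓ F)` -/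

section CoreFunctors

variable (F : Type u₂) [Category.{v₂} F] [MonoidalCategory F] [SymmetricCategory F]

variable {F} in
-- This and the next two are the coherence conditions for a functor whose unit and tensorators are
-- identities, as is the case for the inclusion, source and target functors.
lemma MonoidalCategory.strict_associativity (X Y Z : F) :
    𝟙 (X ⊗ Y) ▷ Z ≫ 𝟙 ((X ⊗ Y) ⊗ Z) ≫ (α_ X Y Z).hom =
      (α_ X Y Z).hom ≫ X ◁ 𝟙 (Y ⊗ Z) ≫ 𝟙 (X ⊗ Y ⊗ Z) := by simp

variable {F} in
lemma MonoidalCategory.strict_left_unitality (X : F) :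
    (λ_ X).hom = 𝟙 (𝟙_ F) ▷ X ≫ 𝟙 (𝟙_ F ⊗ X) ≫ (λ_ X).hom := by simp

variable {F} in
lemma MonoidalCategory.strict_right_unitality (X : F) :
    (ρ_ X).hom = X ◁ 𝟙 (𝟙_ F) ≫ 𝟙 (X ⊗ 𝟙_ F) ≫ (ρ_ X).hom := by simp

instance Core.inclusionMonoidal : (Core.inclusion F).Monoidal :=
  Functor.CoreMonoidal.toMonoidal
    { εIso := Iso.refl (𝟙_ F)
      μIso := fun X Y ↦ Iso.refl (X.of ⊗ Y.of)
      μIso_hom_natural_left := fun _ _ ↦ (Category.comp_id _).trans (Category.id_comp _).symm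
      μIso_hom_natural_right := fun _ _ ↦ (Category.comp_id _).trans (Category.id_comp _).symm
      associativity := fun X Y Z ↦ MonoidalCategory.strict_associativity X.of Y.of Z.of
      left_unitality := fun X ↦ MonoidalCategory.strict_left_unitality X.of
      right_unitality := fun X ↦ MonoidalCategory.strict_right_unitality X.of }

instance Core.inclusionBraided : (Core.inclusion F).Braided where
  braided _ _ := (Category.id_comp _).trans (Category.comp_id _).symm

/-- The source functor from the isomorphisms of `(F ↓ F)` to the isomorphisms of `F`. -/
abbrev ArrowComma.source : Core (ArrowComma F) ⥤ Core F := (Comma.fst (𝟭 F) (𝟭 F)).core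

/-- The target functor from the isomorphisms of `(F ↓ F)` to the isomorphisms of `F`. -/
abbrev ArrowComma.target : Core (ArrowComma F) ⥤ Core F := (Comma.snd (𝟭 F) (𝟭 F)).core

instance ArrowComma.sourceMonoidal : (ArrowComma.source F).Monoidal :=
  Functor.CoreMonoidal.toMonoidal
    { εIso := Iso.refl (𝟙_ (Core F))
      μIso := fun X Y ↦ Iso.refl (Core.mk X.of.left ⊗ Core.mk Y.of.left)
      μIso_hom_natural_left := fun _ _ ↦ (Category.comp_id _).trans (Category.id_comp _).symm
      μIso_hom_natural_right := fun _ _ ↦ (Category.comp_id _).trans (Category.id_comp _).symm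
      associativity := fun X Y Z ↦
        MonoidalCategory.strict_associativity (Core.mk X.of.left) (Core.mk Y.of.left) (Core.mk Z.of.left)
      left_unitality := fun X ↦ MonoidalCategory.strict_left_unitality (Core.mk X.of.left)
      right_unitality := fun X ↦ MonoidalCategory.strict_right_unitality (Core.mk X.of.left) }

instance ArrowComma.sourceBraided : (ArrowComma.source F).Braided where
  braided _ _ := (Category.id_comp _).trans (Category.comp_id _).symm

instance ArrowComma.targetMonoidal : (ArrowComma.target F).Monoidal :=
  Functor.CoreMonoidal.toMonoidal
    { εIso := Iso.refl (𝟙_ (Core F))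
      μIso := fun X Y ↦ Iso.refl (Core.mk X.of.right ⊗ Core.mk Y.of.right)
      μIso_hom_natural_left := fun _ _ ↦ (Category.comp_id _).trans (Category.id_comp _).symm
      μIso_hom_natural_right := fun _ _ ↦ (Category.comp_id _).trans (Category.id_comp _).symm
      associativity := fun X Y Z ↦
        MonoidalCategory.strict_associativity (Core.mk X.of.right) (Core.mk Y.of.right) (Core.mk Z.of.right)
      left_unitality := fun X ↦ MonoidalCategory.strict_left_unitality (Core.mk X.of.right)
      right_unitality := fun X ↦ MonoidalCategory.strict_right_unitality (Core.mk X.of.right) }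

instance ArrowComma.targetBraided : (ArrowComma.target F).Braided where
  braided _ _ := (Category.id_comp _).trans (Category.comp_id _).symm

end CoreFunctors

/-! ## Decompositions of morphisms in a Feynman category -/

namespace IsFeynmanCategory

variable {V : Type u₁} [Groupoid.{v₁} V] {F : Type u₂} [Category.{v₂} F] [MonoidalCategory F]
  [SymmetricCategory F] (ι : V ⥤ F)

/-- The object of `F` given by a word in the objects of `V`. -/
abbrev wordObj (U : FreeSymm V) : F := ((FreeSymm.lift (Core.functorToCore ι)).obj U).of

/-- A morphism to the object given by a word decomposes into a tensor product of morphisms to the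
letters of the word. -/
def IsDecomposable : ∀ (U : FreeSymm V) {X : F}, (X ⟶ wordObj ι U) → Prop
  | .of _, _, _ => True
  | .unit, _, f => IsIso f
  | .tensor U₁ U₂, X, f => ∃ (X₁ X₂ : F) (σ : X ≅ X₁ ⊗ X₂) (f₁ : X₁ ⟶ wordObj ι U₁)
      (f₂ : X₂ ⟶ wordObj ι U₂),
      f = σ.hom ≫ (f₁ ⊗ₘ f₂) ∧ IsDecomposable U₁ f₁ ∧ IsDecomposable U₂ f₂

variable {ι}

lemma IsDecomposable.precomp {U : FreeSymm V} {X Y : F} {f : X ⟶ wordObj ι U}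
    (h : IsDecomposable ι U f) (g : Y ⟶ X) [IsIso g] : IsDecomposable ι U (g ≫ f) := by
  cases U with
  | of v => trivial
  | unit =>
    have : IsIso f := h
    exact inferInstanceAs (IsIso (g ≫ f))
  | tensor U₁ U₂ =>
    obtain ⟨X₁, X₂, σ, f₁, f₂, rfl, h₁, h₂⟩ := h
    exact ⟨X₁, X₂, asIso g ≪≫ σ, f₁, f₂, (Category.assoc _ _ _).symm, h₁, h₂⟩

/-- Induction on the formal morphism: associators and braidings regroup or permute the factors,
unitors insert or absorb an invertible factor, and morphisms of `V` act on single letters. -/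
lemma IsDecomposable.postcomp {U U' : FreeSymm V} (s : FreeSymm.Hom U U') :
    ∀ {X : F} {f : X ⟶ wordObj ι U}, IsDecomposable ι U f →
      IsDecomposable ι U' (f ≫ ((FreeSymm.lift (Core.functorToCore ι)).map ⟦s⟧).iso.hom) := by
  induction s with
  | of f => intros; trivial
  | id X =>
    intro X f h
    exact (Category.comp_id f).symm ▸ h
  | α_hom U₁ U₂ U₃ =>
    rintro X _ ⟨X₁₂, X₃, σ, _, f₃, rfl, ⟨X₁, X₂, τ, f₁, f₂, rfl, h₁, h₂⟩, h₃⟩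
    refine ⟨X₁, X₂ ⊗ X₃, σ ≪≫ whiskerRightIso τ X₃ ≪≫ α_ _ _ _, f₁, f₂ ⊗ₘ f₃, ?_, h₁,
      ⟨X₂, X₃, Iso.refl _, f₂, f₃, (Category.id_comp _).symm, h₂, h₃⟩⟩
    have key {A₁ A₂ A₃ : F} (g₁ : X₁ ⟶ A₁) (g₂ : X₂ ⟶ A₂) (g₃ : X₃ ⟶ A₃) :
        (σ.hom ≫ ((τ.hom ≫ (g₁ ⊗ₘ g₂)) ⊗ₘ g₃)) ≫ (α_ A₁ A₂ A₃).hom =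
          (σ ≪≫ whiskerRightIso τ X₃ ≪≫ α_ _ _ _).hom ≫ (g₁ ⊗ₘ g₂ ⊗ₘ g₃) := by
      have h : (τ.hom ≫ (g₁ ⊗ₘ g₂)) ⊗ₘ g₃ = τ.hom ▷ X₃ ≫ ((g₁ ⊗ₘ g₂) ⊗ₘ g₃) := by
        rw [← tensorHom_id, tensorHom_comp_tensorHom, Category.id_comp]
      simp [h]
    exact key f₁ f₂ f₃
  | α_inv U₁ U₂ U₃ =>
    rintro X _ ⟨X₁, X₂₃, σ, f₁, _, rfl, h₁, ⟨X₂, X₃, τ, f₂, f₃, rfl, h₂, h₃⟩⟩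
    refine ⟨X₁ ⊗ X₂, X₃, σ ≪≫ whiskerLeftIso X₁ τ ≪≫ (α_ _ _ _).symm, f₁ ⊗ₘ f₂, f₃, ?_,
      ⟨X₁, X₂, Iso.refl _, f₁, f₂, (Category.id_comp _).symm, h₁, h₂⟩, h₃⟩
    have key {A₁ A₂ A₃ : F} (g₁ : X₁ ⟶ A₁) (g₂ : X₂ ⟶ A₂) (g₃ : X₃ ⟶ A₃) :
        (σ.hom ≫ (g₁ ⊗ₘ (τ.hom ≫ (g₂ ⊗ₘ g₃)))) ≫ (α_ A₁ A₂ A₃).inv =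
          (σ ≪≫ whiskerLeftIso X₁ τ ≪≫ (α_ _ _ _).symm).hom ≫ ((g₁ ⊗ₘ g₂) ⊗ₘ g₃) := by
      have h : g₁ ⊗ₘ (τ.hom ≫ (g₂ ⊗ₘ g₃)) = X₁ ◁ τ.hom ≫ (g₁ ⊗ₘ (g₂ ⊗ₘ g₃)) := by
        rw [← id_tensorHom, tensorHom_comp_tensorHom, Category.id_comp]
      simp [h]
    exact key f₁ f₂ f₃
  | l_hom U =>
    rintro X _ ⟨X₁, X₂, σ, f₁, f₂, rfl, h₁, h₂⟩
    -- The factor lying over the empty word is invertible, so it is absorbed into the isomorphism of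
    -- sources.
    let f₁' : X₁ ⟶ 𝟙_ F := f₁
    have : IsIso f₁' := h₁
    have key {A : F} (g : X₂ ⟶ A) : (σ.hom ≫ (f₁' ⊗ₘ g)) ≫ (λ_ A).hom =
        (σ.hom ≫ f₁' ▷ X₂ ≫ (λ_ _).hom) ≫ g := by simp [MonoidalCategory.tensorHom_def]
    exact (key f₂).symm ▸ h₂.precomp _
  | l_inv U =>
    intro X f h
    refine ⟨𝟙_ F, X, (λ_ X).symm, 𝟙 (𝟙_ F), f, ?_, inferInstanceAs (IsIso (𝟙 (𝟙_ F))), h⟩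
    have key {A : F} (g : X ⟶ A) : g ≫ (λ_ A).inv = (λ_ X).inv ≫ (𝟙 (𝟙_ F) ⊗ₘ g) := by simp
    exact key f
  | ρ_hom U =>
    rintro X _ ⟨X₁, X₂, σ, f₁, f₂, rfl, h₁, h₂⟩
    let f₂' : X₂ ⟶ 𝟙_ F := f₂
    have : IsIso f₂' := h₂
    have key {A : F} (g : X₁ ⟶ A) : (σ.hom ≫ (g ⊗ₘ f₂')) ≫ (ρ_ A).hom =
        (σ.hom ≫ X₁ ◁ f₂' ≫ (ρ_ _).hom) ≫ g := by simp [MonoidalCategory.tensorHom_def']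
    exact (key f₁).symm ▸ h₁.precomp _
  | ρ_inv U =>
    intro X f h
    refine ⟨X, 𝟙_ F, (ρ_ X).symm, f, 𝟙 (𝟙_ F), ?_, h, inferInstanceAs (IsIso (𝟙 (𝟙_ F)))⟩
    have key {A : F} (g : X ⟶ A) : g ≫ (ρ_ A).inv = (ρ_ X).inv ≫ (g ⊗ₘ 𝟙 (𝟙_ F)) := by simp
    exact key f
  | β U₁ U₂ =>
    rintro X _ ⟨X₁, X₂, σ, f₁, f₂, rfl, h₁, h₂⟩
    refine ⟨X₂, X₁, σ ≪≫ β_ _ _, f₂, f₁, ?_, h₂, h₁⟩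
    have key {A₁ A₂ : F} (g₁ : X₁ ⟶ A₁) (g₂ : X₂ ⟶ A₂) :
        (σ.hom ≫ (g₁ ⊗ₘ g₂)) ≫ (β_ A₁ A₂).hom = (σ ≪≫ β_ _ _).hom ≫ (g₂ ⊗ₘ g₁) := by simp
    exact key f₁ f₂
  | comp s t hs ht =>
    intro X f h
    have := ht (hs h)
    rw [Category.assoc] at this
    exact this
  | whiskerLeft U s hs =>
    rintro X _ ⟨X₁, X₂, σ, f₁, f₂, rfl, h₁, h₂⟩
    refine ⟨X₁, X₂, σ, f₁, _, ?_, h₁, hs h₂⟩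
    have key {A₁ A₂ B : F} (g₁ : X₁ ⟶ A₁) (g₂ : X₂ ⟶ A₂) (b : A₂ ⟶ B) :
        (σ.hom ≫ (g₁ ⊗ₘ g₂)) ≫ A₁ ◁ b = σ.hom ≫ (g₁ ⊗ₘ (g₂ ≫ b)) := by simp [← id_tensorHom]
    exact key f₁ f₂ _
  | whiskerRight s U hs =>
    rintro X _ ⟨X₁, X₂, σ, f₁, f₂, rfl, h₁, h₂⟩
    refine ⟨X₁, X₂, σ, _, f₂, ?_, hs h₁, h₂⟩
    have key {A₁ A₂ B : F} (g₁ : X₁ ⟶ A₁) (g₂ : X₂ ⟶ A₂) (b : A₁ ⟶ B) :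
        (σ.hom ≫ (g₁ ⊗ₘ g₂)) ≫ b ▷ A₂ = σ.hom ≫ ((g₁ ≫ b) ⊗ₘ g₂) := by simp [← tensorHom_id]
    exact key f₁ f₂ _
  | tensor s t hs ht =>
    rintro X _ ⟨X₁, X₂, σ, f₁, f₂, rfl, h₁, h₂⟩
    refine ⟨X₁, X₂, σ, _, _, ?_, hs h₁, ht h₂⟩
    have key {A₁ A₂ B₁ B₂ : F} (g₁ : X₁ ⟶ A₁) (g₂ : X₂ ⟶ A₂) (b₁ : A₁ ⟶ B₁) (b₂ : A₂ ⟶ B₂) :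
        (σ.hom ≫ (g₁ ⊗ₘ g₂)) ≫ (b₁ ⊗ₘ b₂) = σ.hom ≫ ((g₁ ≫ b₁) ⊗ₘ (g₂ ≫ b₂)) := by simp
    exact key f₁ f₂ _ _

/-- Fullness of `V^⊗ ⥤ Iso(F)` makes every isomorphism between words the image of a formal morphism.
Decomposability is therefore independent of the word chosen to represent the target. -/
lemma IsDecomposable.postcomp_iso {U U' : FreeSymm V}
    [(FreeSymm.lift (Core.functorToCore ι)).Full] {X : F} {f : X ⟶ wordObj ι U}
    (h : IsDecomposable ι U f) (s : wordObj ι U ≅ wordObj ι U') :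
    IsDecomposable ι U' (f ≫ s.hom) := by
  obtain ⟨⟨s'⟩, hs'⟩ := (FreeSymm.lift (Core.functorToCore ι)).map_surjective (X := U) (Y := U') ⟨s⟩
  have h₁ := h.postcomp s'
  have h₂ : ((FreeSymm.lift (Core.functorToCore ι)).map ⟦s'⟧).iso = s := congrArg CoreHom.iso hs'
  rwa [h₂] at h₁

/-- The letters of `W` are morphisms to vertices, so the word of their targets decomposes the
morphism by construction. -/
lemma exists_isDecomposable_of_word (W : FreeSymm (Core (Comma (𝟭 F) ι))) :
    ∃ (U : FreeSymm V) (b : ((FreeSymm.lift (commaInclusion ι).core).obj W).of.right ≅ wordObj ι U),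
      IsDecomposable ι U (((FreeSymm.lift (commaInclusion ι).core).obj W).of.hom ≫ b.hom) := by
  induction W with
  | of x => exact ⟨.of x.of.right, Iso.refl _, trivial⟩
  | unit =>
    exact ⟨.unit, Iso.refl _, inferInstanceAs (IsIso (𝟙 (𝟙_ F) ≫ 𝟙 (𝟙_ F)))⟩
  | tensor W₁ W₂ h₁ h₂ =>
    obtain ⟨U₁, b₁, h₁⟩ := h₁
    obtain ⟨U₂, b₂, h₂⟩ := h₂
    have key {X₁ X₂ A₁ A₂ B₁ B₂ : F} (g₁ : X₁ ⟶ A₁) (g₂ : X₂ ⟶ A₂) (b₁ : A₁ ⟶ B₁) (b₂ : A₂ ⟶ B₂) :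
        (g₁ ⊗ₘ g₂) ≫ (b₁ ⊗ₘ b₂) = (Iso.refl _).hom ≫ ((g₁ ≫ b₁) ⊗ₘ (g₂ ≫ b₂)) := by simp
    exact ⟨.tensor U₁ U₂, b₁ ⊗ᵢ b₂, _, _, Iso.refl _, _, _, key _ _ b₁.hom b₂.hom, h₁, h₂⟩

section

variable (hF : IsFeynmanCategory.{w} ι)

include hF

lemma exists_iso_wordObj (X : F) : ∃ U : FreeSymm V, Nonempty (wordObj ι U ≅ X) := by
  have := hF.isomorphism_condition
  exact ⟨(FreeSymm.lift (Core.functorToCore ι)).objPreimage ⟨X⟩,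
    ⟨((FreeSymm.lift (Core.functorToCore ι)).objObjPreimageIso ⟨X⟩).hom.iso⟩⟩

/-- Every object of a Feynman category is a tensor product of objects in the image of `ι`. -/
lemma object_induction {Q : F → Prop} (hiso : ∀ {X Y : F}, (X ≅ Y) → Q X → Q Y)
    (hι : ∀ v, Q (ι.obj v)) (hunit : Q (𝟙_ F)) (htensor : ∀ X Y, Q X → Q Y → Q (X ⊗ Y)) (X : F) :
    Q X := by
  obtain ⟨U, ⟨e⟩⟩ := hF.exists_iso_wordObj X
  refine hiso e ?_
  clear e
  induction U with
  | of v => exact hι v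
  | unit => exact hunit
  | tensor U₁ U₂ h₁ h₂ => exact htensor _ _ h₁ h₂

/-- Essential surjectivity in the hereditary condition writes `f`, up to an isomorphism of arrows,
as a tensor word of morphisms to vertices. The word this provides for the target is then exchanged
for `U`. -/
lemma isDecomposable {U : FreeSymm V} {X Y : F} (f : X ⟶ Y) (s : Y ≅ wordObj ι U) :
    IsDecomposable ι U (f ≫ s.hom) := by
  have := hF.isomorphism_condition
  have := hF.hereditary_condition
  let H := FreeSymm.lift (commaInclusion ι).core
  let e : (H.obj (H.objPreimage ⟨⟨X, Y, f⟩⟩)).of ≅ ⟨X, Y, f⟩ :=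
    (H.objObjPreimageIso (⟨⟨X, Y, f⟩⟩ : Core (ArrowComma F))).hom.iso
  obtain ⟨U', b, h⟩ := exists_isDecomposable_of_word (H.objPreimage ⟨⟨X, Y, f⟩⟩)
  let e₁ : (H.obj (H.objPreimage ⟨⟨X, Y, f⟩⟩)).of.left ≅ X := (Comma.fst _ _).mapIso e
  let e₂ : (H.obj (H.objPreimage ⟨⟨X, Y, f⟩⟩)).of.right ≅ Y := (Comma.snd _ _).mapIso e
  have w : e₁.hom ≫ f = (H.obj (H.objPreimage ⟨⟨X, Y, f⟩⟩)).of.hom ≫ e₂.hom := e.hom.w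
  have := (h.postcomp_iso (b.symm ≪≫ e₂ ≪≫ s)).precomp e₁.inv
  have w' : e₁.inv ≫ ((H.obj (H.objPreimage ⟨⟨X, Y, f⟩⟩)).of.hom ≫ b.hom) ≫
      (b.symm ≪≫ e₂ ≪≫ s).hom = f ≫ s.hom := by
    simp only [Iso.trans_hom, Iso.symm_hom, Category.assoc, Iso.hom_inv_id_assoc]
    rw [← reassoc_of% w, e₁.inv_hom_id_assoc]
  rwa [w'] at this

/-- The existence half of the hereditary condition in its working form, obtained from a word that is
a tensor of words for `Y₁` and `Y₂`. -/
lemma exists_decomposition {X Y₁ Y₂ : F} (f : X ⟶ Y₁ ⊗ Y₂) :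
    ∃ (X₁ X₂ : F) (σ : X ≅ X₁ ⊗ X₂) (f₁ : X₁ ⟶ Y₁) (f₂ : X₂ ⟶ Y₂), f = σ.hom ≫ (f₁ ⊗ₘ f₂) := by
  obtain ⟨U₁, ⟨e₁⟩⟩ := hF.exists_iso_wordObj Y₁
  obtain ⟨U₂, ⟨e₂⟩⟩ := hF.exists_iso_wordObj Y₂
  obtain ⟨X₁, X₂, σ, f₁, f₂, h, -, -⟩ :=
    hF.isDecomposable (U := U₁.tensor U₂) f (e₁.symm ⊗ᵢ e₂.symm)
  have key {B₁ B₂ : F} (g₁ : X₁ ⟶ B₁) (g₂ : X₂ ⟶ B₂) (a₁ : B₁ ≅ Y₁) (a₂ : B₂ ≅ Y₂)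
      (hg : f ≫ (a₁.inv ⊗ₘ a₂.inv) = σ.hom ≫ (g₁ ⊗ₘ g₂)) :
      f = σ.hom ≫ ((g₁ ≫ a₁.hom) ⊗ₘ (g₂ ≫ a₂.hom)) := by
    rw [← tensorHom_comp_tensorHom, reassoc_of% hg.symm]
    simp
  exact ⟨X₁, X₂, σ, f₁ ≫ e₁.hom, f₂ ≫ e₂.hom, key f₁ f₂ e₁ e₂ h⟩

/-- The case of the empty word in `isDecomposable`. -/
lemma isIso_of_unit {X : F} (f : X ⟶ 𝟙_ F) : IsIso f := by
  have h : IsIso (f ≫ 𝟙 (𝟙_ F)) := hF.isDecomposable (U := .unit) f (Iso.refl _)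
  rwa [Category.comp_id] at h

end

end IsFeynmanCategory

/-! ## Monoidal families indexed by the morphisms of `F` -/

open Functor.LaxMonoidal Functor.OplaxMonoidal

section ArrowFamily

variable {F : Type u₂} [Category.{v₂} F] [MonoidalCategory F] [SymmetricCategory F]
  {D : Type u} [Category.{v} D] [MonoidalCategory D] [SymmetricCategory D]

/-- A family of morphisms `P X ⟶ Q Y` indexed by the morphisms `X ⟶ Y` of `F`, natural with respect
to isomorphisms and compatible with tensor products. -/
@[ext]
structure ArrowFamily (P Q : Core F ⥤ D) [P.LaxMonoidal] [Q.LaxMonoidal] where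
  app {X Y : F} (f : X ⟶ Y) : P.obj ⟨X⟩ ⟶ Q.obj ⟨Y⟩
  natural {X Y X' Y' : F} (f : X ⟶ Y) (f' : X' ⟶ Y') (σ : X ≅ X') (τ : Y ≅ Y')
    (h : σ.hom ≫ f' = f ≫ τ.hom) :
    P.map (X := ⟨X⟩) (Y := ⟨X'⟩) ⟨σ⟩ ≫ app f' = app f ≫ Q.map (X := ⟨Y⟩) (Y := ⟨Y'⟩) ⟨τ⟩
  unit : ε P ≫ app (𝟙 (𝟙_ F)) = ε Q
  tensor {X Y X' Y' : F} (f : X ⟶ Y) (f' : X' ⟶ Y') :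
    μ P ⟨X⟩ ⟨X'⟩ ≫ app (f ⊗ₘ f') = (app f ⊗ₘ app f') ≫ μ Q ⟨Y⟩ ⟨Y'⟩

namespace ArrowFamily

variable {P Q : Core F ⥤ D}

section

variable [P.LaxMonoidal] [Q.LaxMonoidal]

/-- The natural transformation on the isomorphisms of `(F ↓ F)` given by a family. -/
def toNatTrans (m : ArrowFamily P Q) : ArrowComma.source F ⋙ P ⟶ ArrowComma.target F ⋙ Q where
  app x := m.app x.of.hom
  naturality _ _ f := m.natural _ _ ((Comma.fst _ _).mapIso f.iso) ((Comma.snd _ _).mapIso f.iso)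
    f.iso.hom.w

lemma source_ε : ε (ArrowComma.source F ⋙ P) = ε P :=
  (comp_ε _ _).trans ((congrArg _ (P.map_id _)).trans (Category.comp_id _))

lemma target_ε : ε (ArrowComma.target F ⋙ P) = ε P :=
  (comp_ε _ _).trans ((congrArg _ (P.map_id _)).trans (Category.comp_id _))

lemma source_μ (x y : Core (ArrowComma F)) :
    μ (ArrowComma.source F ⋙ P) x y = μ P ⟨x.of.left⟩ ⟨y.of.left⟩ :=
  (comp_μ _ _ _ _).trans ((congrArg _ (P.map_id _)).trans (Category.comp_id _))

lemma target_μ (x y : Core (ArrowComma F)) :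
    μ (ArrowComma.target F ⋙ P) x y = μ P ⟨x.of.right⟩ ⟨y.of.right⟩ :=
  (comp_μ _ _ _ _).trans ((congrArg _ (P.map_id _)).trans (Category.comp_id _))

instance (m : ArrowFamily P Q) : NatTrans.IsMonoidal m.toNatTrans where
  unit := by
    rw [source_ε, target_ε]
    exact m.unit
  tensor x y := by
    rw [source_μ, target_μ]
    exact m.tensor x.of.hom y.of.hom

/-- The family given by a monoidal natural transformation on the isomorphisms of `(F ↓ F)`. -/
def ofNatTrans (σ : ArrowComma.source F ⋙ P ⟶ ArrowComma.target F ⋙ Q) [NatTrans.IsMonoidal σ] :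
    ArrowFamily P Q where
  app {X Y} f := σ.app ⟨⟨X, Y, f⟩⟩
  natural {X Y X' Y'} f f' a b h :=
    σ.naturality (X := ⟨⟨X, Y, f⟩⟩) (Y := ⟨⟨X', Y', f'⟩⟩) ⟨Comma.isoMk a b h⟩
  unit := by
    have h := NatTrans.IsMonoidal.unit (τ := σ)
    rw [source_ε, target_ε] at h
    exact h
  tensor f f' := by
    have h := NatTrans.IsMonoidal.tensor (τ := σ) ⟨⟨_, _, f⟩⟩ ⟨⟨_, _, f'⟩⟩
    rw [source_μ, target_μ] at h
    exact h

/-- Composition of a family with a monoidal transformation of the targets. -/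
def postcomp (m : ArrowFamily P Q) {Q' : Core F ⥤ D} [Q'.LaxMonoidal] (σ : Q ⟶ Q')
    [NatTrans.IsMonoidal σ] : ArrowFamily P Q' where
  app {X Y} f := m.app f ≫ σ.app ⟨Y⟩
  natural f f' a b h := by
    rw [Category.assoc, ← σ.naturality, reassoc_of% m.natural f f' a b h]
  unit := by rw [reassoc_of% m.unit, ← NatTrans.IsMonoidal.unit (τ := σ)]; rfl
  tensor {X Y X' Y'} f f' := by
    have := NatTrans.IsMonoidal.tensor (τ := σ) ⟨Y⟩ ⟨Y'⟩
    rw [reassoc_of% m.tensor f f', ← tensorHom_comp_tensorHom_assoc, ← this]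
    rfl

/-- Composition of a family with a monoidal transformation of the sources. -/
def precomp (m : ArrowFamily P Q) {P' : Core F ⥤ D} [P'.LaxMonoidal] (σ : P' ⟶ P)
    [NatTrans.IsMonoidal σ] : ArrowFamily P' Q where
  app {X Y} f := σ.app ⟨X⟩ ≫ m.app f
  natural f f' a b h := by
    rw [σ.naturality_assoc, m.natural f f' a b h, Category.assoc]
  unit := by
    rw [← m.unit, ← NatTrans.IsMonoidal.unit (τ := σ), Category.assoc]; rfl
  tensor {X Y X' Y'} f f' := by
    have := NatTrans.IsMonoidal.tensor (τ := σ) ⟨X⟩ ⟨X'⟩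
    rw [← tensorHom_comp_tensorHom, Category.assoc, ← m.tensor f f', ← reassoc_of% this]
    rfl

end

lemma _root_.inclusion_ε {A : F ⥤ D} [A.LaxMonoidal] : ε (Core.inclusion F ⋙ A) = ε A :=
  (comp_ε _ _).trans ((congrArg _ (A.map_id _)).trans (Category.comp_id _))

lemma _root_.inclusion_μ {A : F ⥤ D} [A.LaxMonoidal] (X Y : Core F) :
    μ (Core.inclusion F ⋙ A) X Y = μ A X.of Y.of :=
  (comp_μ _ _ _ _).trans ((congrArg _ (A.map_id _)).trans (Category.comp_id _))

/-- The family given by a lax monoidal functor on `F`. -/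
def ofFunctor (A : F ⥤ D) [A.LaxMonoidal] :
    ArrowFamily (Core.inclusion F ⋙ A) (Core.inclusion F ⋙ A) where
  app f := A.map f
  natural f f' a b h := by
    change A.map a.hom ≫ A.map f' = A.map f ≫ A.map b.hom
    rw [← A.map_comp, ← A.map_comp, h]
  unit := (congrArg _ (A.map_id _)).trans (Category.comp_id _)
  tensor f f' := by
    rw [inclusion_μ, inclusion_μ]
    exact (μ_natural A f f').symm

variable {V : Type u₁} [Groupoid.{v₁} V] {ι : V ⥤ F} (hF : IsFeynmanCategory.{w} ι)

include hF

/-- A family is a monoidal transformation on `Iso(F ↓ F)`, which is freely generated by the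
morphisms to vertices. Identities between maps indexed by all morphisms of `F` thus reduce to vertex
targets. -/
lemma ext_of_isFeynmanCategory [P.Monoidal] [Q.LaxMonoidal] (m m' : ArrowFamily P Q)
    (h : ∀ {X : F} {v : V} (f : X ⟶ ι.obj v), m.app f = m'.app f) : m = m' := by
  have := hF.hereditary_condition
  have e := FreeSymm.monoidal_ext_of_essSurj (FreeSymm.lift (commaInclusion ι).core)
    m.toNatTrans m'.toNatTrans (fun x ↦ h x.of.hom)
  ext X Y f
  exact NatTrans.congr_app e ⟨⟨X, Y, f⟩⟩

/-- Freeness of `Iso(F ↓ F)` over `Iso(F ↓ V)`. Only naturality for isomorphisms is required of `t`;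
compatibility with composition in `F` is no part of the data and is proved separately. -/
lemma exists_extension [P.Braided] [Q.LaxBraided]
    (t : ∀ {X : F} {v : V} (_ : X ⟶ ι.obj v), P.obj ⟨X⟩ ⟶ Q.obj ⟨ι.obj v⟩)
    (ht : ∀ {X X' : F} {v v' : V} (f : X ⟶ ι.obj v) (f' : X' ⟶ ι.obj v') (σ : X ≅ X') (τ : v ≅ v'),
      σ.hom ≫ f' = f ≫ ι.map τ.hom →
        P.map (X := ⟨X⟩) (Y := ⟨X'⟩) ⟨σ⟩ ≫ t f' =
          t f ≫ Q.map (X := ⟨ι.obj v⟩) (Y := ⟨ι.obj v'⟩) ⟨ι.mapIso τ⟩) :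
    ∃ m : ArrowFamily P Q, ∀ {X : F} {v : V} (f : X ⟶ ι.obj v), m.app f = t f := by
  have := hF.hereditary_condition
  obtain ⟨σ, hσ, h⟩ := FreeSymm.exists_monoidal_extension (FreeSymm.lift (commaInclusion ι).core)
    (ArrowComma.source F ⋙ P) (ArrowComma.target F ⋙ Q)
    { app := fun x ↦ t x.of.hom
      naturality := fun x y f ↦ ht _ _ ((Comma.fst _ _).mapIso f.iso) ((Comma.snd _ _).mapIso f.iso)
        f.iso.hom.w }
  exact ⟨ofNatTrans σ, fun {X v} f ↦ h (⟨⟨X, v, f⟩⟩ : Core (Comma (𝟭 F) ι))⟩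

end ArrowFamily

end ArrowFamily

/-! ## The strong symmetric monoidal functor associated with a lax one -/

section Coreflection

variable {V : Type u₁} [Groupoid.{v₁} V] {F : Type u₂} [Category.{v₂} F] [MonoidalCategory F]
  [SymmetricCategory F] (ι : V ⥤ F) {C : Type u} [Category.{v} C] [MonoidalCategory C]
  [SymmetricCategory C]

/-- A coreflection of a lax symmetric monoidal functor on a Feynman category into the strong ones. -/
structure StrongCoreflection (A : F ⥤ C) [A.LaxBraided] where
  functor : F ⥤ C
  braided : functor.Braided
  counit : functor ⟶ A
  isMonoidal : NatTrans.IsMonoidal counit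
  isIso_counit (v : V) : IsIso (counit.app (ι.obj v))
  exists_lift (O : F ⥤ C) [O.Braided] (t : O ⟶ A) [NatTrans.IsMonoidal t] :
    ∃ s : O ⟶ functor, NatTrans.IsMonoidal s ∧ s ≫ counit = t
  mem (Q : ObjectProperty C) [Q.IsMonoidal] (h : ∀ v, Q (A.obj (ι.obj v))) (X : F) :
    Q (functor.obj X)

attribute [instance] StrongCoreflection.braided StrongCoreflection.isMonoidal
  StrongCoreflection.isIso_counit

namespace IsFeynmanCategory

variable {ι} (hF : IsFeynmanCategory.{w} ι)

include hF

lemma core_monoidal_ext {P Q : Core F ⥤ C} [P.Monoidal] [Q.LaxMonoidal] (σ τ : P ⟶ Q)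
    [NatTrans.IsMonoidal σ] [NatTrans.IsMonoidal τ]
    (h : ∀ v : V, σ.app ⟨ι.obj v⟩ = τ.app ⟨ι.obj v⟩) : σ = τ := by
  have := hF.isomorphism_condition
  exact FreeSymm.monoidal_ext_of_essSurj (FreeSymm.lift (Core.functorToCore ι)) σ τ h

/-- The restrictions to `Iso(F) ≃ V^⊗` already contain all components. -/
lemma monoidal_ext {P Q : F ⥤ C} [P.Monoidal] [Q.LaxMonoidal] (σ τ : P ⟶ Q)
    [NatTrans.IsMonoidal σ] [NatTrans.IsMonoidal τ]
    (h : ∀ v : V, σ.app (ι.obj v) = τ.app (ι.obj v)) : σ = τ := by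
  have e := hF.core_monoidal_ext (Functor.whiskerLeft (Core.inclusion F) σ)
    (Functor.whiskerLeft (Core.inclusion F) τ) h
  ext X
  exact NatTrans.congr_app e ⟨X⟩

/-- Objects are tensor products of vertices up to isomorphism, and invertibility passes through the
unit and tensor squares because both functors are strong. -/
lemma isIso_of_isMonoidal {P Q : F ⥤ C} [P.Monoidal] [Q.Monoidal] (σ : P ⟶ Q)
    [NatTrans.IsMonoidal σ] (h : ∀ v : V, IsIso (σ.app (ι.obj v))) : IsIso σ := by
  have (X : F) : IsIso (σ.app X) := by
    refine hF.object_induction (Q := fun X ↦ IsIso (σ.app X)) ?_ h ?_ ?_ X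
    · intro X Y e _
      have : σ.app Y = P.map e.inv ≫ σ.app X ≫ Q.map e.hom := by
        rw [σ.naturality_assoc, ← Q.map_comp, e.inv_hom_id, Q.map_id, Category.comp_id]
      rw [this]
      infer_instance
    · exact IsIso.of_isIso_fac_left (NatTrans.IsMonoidal.unit (τ := σ))
    · intro X Y _ _
      exact IsIso.of_isIso_fac_left (NatTrans.IsMonoidal.tensor (τ := σ) X Y)
  exact NatIso.isIso_of_isIso_app _

variable {N : Core F ⥤ C} [N.Braided]

section

variable (m : ArrowFamily N N) (hm : ∀ v : V, m.app (𝟙 (ι.obj v)) = 𝟙 _)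

include hm

/-- The values at identities form a monoidal endomorphism of `N` that is trivial at the vertices,
hence trivial. Naturality then determines the values at all isomorphisms. -/
lemma arrowFamily_app_iso {X Y : F} (e : X ≅ Y) :
    m.app e.hom = N.map (X := ⟨X⟩) (Y := ⟨Y⟩) ⟨e⟩ := by
  let τ : N ⟶ N :=
    { app := fun X ↦ m.app (𝟙 X.of)
      naturality := fun X Y f ↦ m.natural _ _ f.iso f.iso (by simp) }
  have : NatTrans.IsMonoidal τ :=
    { unit := m.unit
      tensor := fun X Y ↦ by
        have := m.tensor (𝟙 X.of) (𝟙 Y.of)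
        rw [id_tensorHom_id] at this
        exact this }
  have h := hF.core_monoidal_ext τ (𝟙 N) hm
  have h' (X : F) : m.app (𝟙 X) = 𝟙 _ := NatTrans.congr_app h ⟨X⟩
  have := m.natural (𝟙 X) e.hom (Iso.refl X) e (by simp)
  rw [h', Category.id_comp] at this
  rw [← this]
  exact ((congrArg (· ≫ m.app e.hom) (N.map_id ⟨X⟩)).trans (Category.id_comp _)).symm

/-- Induction on the final target `Z`. Vertices are the hypothesis, a morphism to the unit is
invertible, and over a tensor product both morphisms split. -/
lemma arrowFamily_app_comp
    (hm' : ∀ {X Y : F} {v : V} (f : X ⟶ Y) (g : Y ⟶ ι.obj v), m.app (f ≫ g) = m.app f ≫ m.app g)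
    {X Y Z : F} (f : X ⟶ Y) (g : Y ⟶ Z) : m.app (f ≫ g) = m.app f ≫ m.app g := by
  have hpre {X X' Y : F} (e : X ≅ X') (f : X' ⟶ Y) :
      m.app (e.hom ≫ f) = N.map (X := ⟨X⟩) (Y := ⟨X'⟩) ⟨e⟩ ≫ m.app f := by
    rw [m.natural (e.hom ≫ f) f e (Iso.refl Y) (by simp)]
    exact ((congrArg (m.app (e.hom ≫ f) ≫ ·) (N.map_id ⟨Y⟩)).trans (Category.comp_id _)).symm
  have hpost {X Y Y' : F} (f : X ⟶ Y) (e : Y ≅ Y') :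
      m.app (f ≫ e.hom) = m.app f ≫ N.map (X := ⟨Y⟩) (Y := ⟨Y'⟩) ⟨e⟩ := by
    rw [← m.natural f (f ≫ e.hom) (Iso.refl X) e (by simp)]
    exact ((congrArg (· ≫ m.app (f ≫ e.hom)) (N.map_id ⟨X⟩)).trans (Category.id_comp _)).symm
  have hmap {X Y Z : F} (e : X ≅ Y) (e' : Y ≅ Z) :
      N.map (X := ⟨X⟩) (Y := ⟨Y⟩) ⟨e⟩ ≫ N.map (X := ⟨Y⟩) (Y := ⟨Z⟩) ⟨e'⟩ =
        N.map (X := ⟨X⟩) (Y := ⟨Z⟩) ⟨e ≪≫ e'⟩ := (N.map_comp _ _).symm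
  revert X Y
  refine hF.object_induction (Q := fun Z ↦ ∀ {X Y : F} (f : X ⟶ Y) (g : Y ⟶ Z),
    m.app (f ≫ g) = m.app f ≫ m.app g) ?_ (fun v X Y f g ↦ hm' f g) ?_ ?_ Z
  · intro Z Z' e h X Y f g
    have := h f (g ≫ e.inv)
    have h₁ := hpost (f ≫ g ≫ e.inv) e
    have h₂ := hpost (g ≫ e.inv) e
    simp only [Category.assoc, e.inv_hom_id, Category.comp_id] at h₁ h₂
    rw [h₁, h₂, this, Category.assoc]
  · intro X Y f g
    have := hF.isIso_of_unit g
    exact (hpost f (asIso g)).trans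
      (congrArg (m.app f ≫ ·) (hF.arrowFamily_app_iso m hm (asIso g)).symm)
  · intro Z₁ Z₂ h₁ h₂ X Y f g
    -- First `g` is split, then `f` followed by the isomorphism `τ`. The composite becomes a tensor
    -- product of composites covered by the induction hypotheses.
    obtain ⟨Y₁, Y₂, τ, g₁, g₂, rfl⟩ := hF.exists_decomposition g
    obtain ⟨X₁, X₂, σ, f₁, f₂, h⟩ := hF.exists_decomposition (f ≫ τ.hom)
    have e₁ := hpost f τ
    rw [h, hpre] at e₁
    have e₂ : m.app ((f₁ ≫ g₁) ⊗ₘ (f₂ ≫ g₂)) = m.app (f₁ ⊗ₘ f₂) ≫ m.app (g₁ ⊗ₘ g₂) := by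
      rw [← cancel_epi (μ N ⟨X₁⟩ ⟨X₂⟩), m.tensor, h₁, h₂]
      have a := m.tensor f₁ f₂
      have b := m.tensor g₁ g₂
      rw [reassoc_of% a, b, tensorHom_comp_tensorHom_assoc]
    rw [reassoc_of% h, tensorHom_comp_tensorHom, hpre, hpre, e₂, reassoc_of% e₁]

end

/-- The functor `N` on `Iso(F)` is freely generated by the values of `A` at vertices and comes with
a comparison to `A`. It remains to let all morphisms of `F` act on `N`. Each identity to be verified
is tested on morphisms to vertices, where the comparison is invertible. -/
theorem nonempty_strongCoreflection (A : F ⥤ C) [A.LaxBraided] :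
    Nonempty (StrongCoreflection ι A) := by
  have := hF.isomorphism_condition
  obtain ⟨N, _, e, hN⟩ := FreeSymm.exists_braided_extension
    (FreeSymm.lift (Core.functorToCore ι)) (ι ⋙ A)
  obtain ⟨c, _, hc⟩ := FreeSymm.exists_monoidal_extension (FreeSymm.lift (Core.functorToCore ι))
    N (Core.inclusion F ⋙ A) e.hom
  -- The components of `c` again, with targets presented as values of `A` instead of values of its
  -- restriction to `Core F`.
  obtain ⟨c', hc'⟩ : ∃ c' : ∀ X : F, N.obj ⟨X⟩ ⟶ A.obj X, ∀ X, c' X = c.app ⟨X⟩ :=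
    ⟨fun X ↦ c.app ⟨X⟩, fun _ ↦ rfl⟩
  have cnat {X Y : F} (σ : X ≅ Y) :
      N.map (X := ⟨X⟩) (Y := ⟨Y⟩) ⟨σ⟩ ≫ c' Y = c' X ≫ A.map σ.hom := by
    rw [hc', hc']
    exact c.naturality (X := ⟨X⟩) (Y := ⟨Y⟩) ⟨σ⟩
  have _ (v : V) : IsIso (c' (ι.obj v)) := by
    have : c' (ι.obj v) = e.hom.app v := (hc' _).trans (hc v)
    rw [this]
    exact inferInstanceAs (IsIso (e.app v).hom)
  -- For a vertex target the action is forced: it must be `A.map f` transported along `c'`, which is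
  -- invertible there.
  obtain ⟨m, hm⟩ := ArrowFamily.exists_extension hF (P := N) (Q := N)
    (fun {X v} f ↦ c' X ≫ A.map f ≫ inv (c' (ι.obj v))) (by
      intro X X' v v' f f' σ τ h
      have h₂ := cnat (ι.mapIso τ)
      rw [Functor.mapIso_hom] at h₂
      rw [← cancel_mono (c' (ι.obj v'))]
      simp only [Category.assoc, IsIso.inv_hom_id, Category.comp_id, h₂, IsIso.inv_hom_id_assoc]
      rw [reassoc_of% cnat σ, ← A.map_comp, ← A.map_comp, h])
  -- Both sides are families from `N` to the restriction of `A`, and they agree at vertex targets by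
  -- the choice of `m`.
  have hmc {X Y : F} (f : X ⟶ Y) : m.app f ≫ c' Y = c' X ≫ A.map f := by
    have := ArrowFamily.ext_of_isFeynmanCategory hF (m.postcomp c)
      ((ArrowFamily.ofFunctor A).precomp c) (fun {X v} f ↦ by
        change m.app f ≫ c.app _ = c.app _ ≫ A.map f
        have : m.app f ≫ c' _ = c' _ ≫ A.map f := by simp [hm]
        rwa [hc', hc'] at this)
    rw [hc', hc']
    exact congrArg (fun m ↦ m.app f) this
  have hm₁ (v : V) : m.app (𝟙 (ι.obj v)) = 𝟙 _ := by simp [hm]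
  have hm₂ {X Y Z : F} (f : X ⟶ Y) (g : Y ⟶ Z) : m.app (f ≫ g) = m.app f ≫ m.app g :=
    hF.arrowFamily_app_comp m hm₁ (fun {X Y v} f g ↦ by
      rw [← cancel_mono (c' (ι.obj v)), hmc, Category.assoc, hmc, ← Category.assoc, hmc,
        Category.assoc, A.map_comp]) f g
  have hmi {X Y : F} (e : X ≅ Y) : m.app e.hom = N.map (X := ⟨X⟩) (Y := ⟨Y⟩) ⟨e⟩ :=
    hF.arrowFamily_app_iso m hm₁ e
  have hm₃ (X : F) : m.app (𝟙 X) = 𝟙 _ := (hmi (Iso.refl X)).trans (N.map_id _)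
  let S : F ⥤ C :=
    { obj := fun X ↦ N.obj ⟨X⟩
      map := fun f ↦ m.app f
      map_id := hm₃
      map_comp := hm₂ }
  let _ : S.Monoidal := Functor.CoreMonoidal.toMonoidal
    { εIso := Functor.Monoidal.εIso N
      μIso := fun X Y ↦ Functor.Monoidal.μIso N ⟨X⟩ ⟨Y⟩
      μIso_hom_natural_left := fun {X Y} f Z ↦ by
        have := m.tensor f (𝟙 Z)
        rw [hm₃, tensorHom_id, tensorHom_id] at this
        exact this.symm
      μIso_hom_natural_right := fun {X Y} Z f ↦ by
        have := m.tensor (𝟙 Z) f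
        rw [hm₃, id_tensorHom, id_tensorHom] at this
        exact this.symm
      associativity := fun X Y Z ↦ by
        have := Functor.LaxMonoidal.associativity N ⟨X⟩ ⟨Y⟩ ⟨Z⟩
        change _ ≫ _ ≫ m.app (α_ X Y Z).hom = _
        rw [hmi]
        exact this
      left_unitality := fun X ↦ by
        have := Functor.LaxMonoidal.left_unitality N ⟨X⟩
        change _ = _ ≫ _ ≫ m.app (λ_ X).hom
        rw [hmi]
        exact this
      right_unitality := fun X ↦ by
        have := Functor.LaxMonoidal.right_unitality N ⟨X⟩
        change _ = _ ≫ _ ≫ m.app (ρ_ X).hom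
        rw [hmi]
        exact this }
  let _ : S.Braided :=
    { braided := fun X Y ↦ by
        have := Functor.LaxBraided.braided (F := N) ⟨X⟩ ⟨Y⟩
        change _ ≫ m.app (β_ X Y).hom = _
        rw [hmi]
        exact this }
  let κ : S ⟶ A :=
    { app := fun X ↦ c' X
      naturality := fun X Y f ↦ hmc f }
  have hκ : NatTrans.IsMonoidal κ :=
    { unit := by
        have := (NatTrans.IsMonoidal.unit (τ := c)).trans inclusion_ε
        change ε N ≫ c' _ = _
        rw [hc']
        exact this
      tensor := fun X Y ↦ by
        have := (NatTrans.IsMonoidal.tensor (τ := c) ⟨X⟩ ⟨Y⟩).trans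
          (congrArg _ (inclusion_μ _ _))
        change μ N ⟨X⟩ ⟨Y⟩ ≫ c' _ = (c' X ⊗ₘ c' Y) ≫ _
        rw [hc', hc', hc']
        exact this }
  refine ⟨⟨S, inferInstance, κ, hκ, inferInstanceAs (∀ v, IsIso (c' (ι.obj v))), fun O _ t _ ↦ ?_,
    fun Q hQ h X ↦ hN Q hQ h ⟨X⟩⟩⟩
  -- The lift is forced at the vertices and extends monoidally over `Iso(F)`. Naturality for all of
  -- `F` is checked afterwards at vertex targets.
  obtain ⟨b, hb⟩ : ∃ b : ∀ v : V, O.obj (ι.obj v) ⟶ N.obj ⟨ι.obj v⟩,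
      ∀ v, b v ≫ c' (ι.obj v) = t.app (ι.obj v) :=
    ⟨fun v ↦ t.app (ι.obj v) ≫ inv (c' (ι.obj v)), fun v ↦ by simp⟩
  obtain ⟨s, _, hs⟩ := FreeSymm.exists_monoidal_extension
    (FreeSymm.lift (Core.functorToCore ι)) (Core.inclusion F ⋙ O) N
    { app := b
      naturality := fun v v' f ↦ by
        change O.map (ι.map f) ≫ b v' = b v ≫
          N.map (X := ⟨ι.obj v⟩) (Y := ⟨ι.obj v'⟩) ⟨ι.mapIso (Groupoid.isoEquivHom _ _ |>.symm f)⟩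
        rw [← cancel_mono (c' (ι.obj v')), Category.assoc, Category.assoc, cnat, hb,
          reassoc_of% hb v]
        exact t.naturality _ }
  obtain ⟨s₀, hs₀⟩ : ∃ s₀ : ∀ X : F, O.obj X ⟶ N.obj ⟨X⟩, ∀ X, s₀ X = s.app ⟨X⟩ :=
    ⟨fun X ↦ s.app ⟨X⟩, fun _ ↦ rfl⟩
  have hsc : s ≫ c = Functor.whiskerLeft (Core.inclusion F) t :=
    hF.core_monoidal_ext _ _ (fun v ↦ by
      have : s.app ⟨ι.obj v⟩ = b v := hs v
      change s.app ⟨ι.obj v⟩ ≫ c.app ⟨ι.obj v⟩ = t.app (ι.obj v)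
      rw [this, ← hc']
      exact hb v)
  have hsc' (X : F) : s₀ X ≫ c' X = t.app X := by
    rw [hs₀, hc']
    exact NatTrans.congr_app hsc ⟨X⟩
  have hsm {X Y : F} (f : X ⟶ Y) : O.map f ≫ s₀ Y = s₀ X ≫ m.app f := by
    have := ArrowFamily.ext_of_isFeynmanCategory hF ((ArrowFamily.ofFunctor O).postcomp s)
      (m.precomp s) (fun {X v} f ↦ by
        change O.map f ≫ s.app ⟨ι.obj v⟩ = s.app ⟨X⟩ ≫ m.app f
        have : O.map f ≫ s₀ (ι.obj v) = s₀ X ≫ m.app f := by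
          rw [← cancel_mono (c' (ι.obj v)), Category.assoc, Category.assoc, hsc', hmc,
            ← Category.assoc, hsc', t.naturality]
        rwa [hs₀, hs₀] at this)
    rw [hs₀, hs₀]
    exact congrArg (fun m ↦ m.app f) this
  let s' : O ⟶ S :=
    { app := fun X ↦ s₀ X
      naturality := fun X Y f ↦ hsm f }
  refine ⟨s', ?_, ?_⟩
  · exact
      { unit := by
          have := (congrArg (· ≫ s.app _) (inclusion_ε (A := O)).symm).trans (NatTrans.IsMonoidal.unit (τ := s))
          change ε O ≫ s₀ (𝟙_ F) = ε N
          rw [hs₀]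
          exact this
        tensor := fun X Y ↦ by
          have := (congrArg (· ≫ s.app _) (inclusion_μ (A := O) ⟨X⟩ ⟨Y⟩).symm).trans
            (NatTrans.IsMonoidal.tensor (τ := s) ⟨X⟩ ⟨Y⟩)
          change μ O X Y ≫ s₀ (X ⊗ Y) = (s₀ X ⊗ₘ s₀ Y) ≫ μ N _ _
          rw [hs₀, hs₀, hs₀]
          exact this }
  · ext X
    exact hsc' X

end IsFeynmanCategory

end Coreflection

/-! ## Sifted colimits are strong symmetric monoidal -/

-- Siftedness is connectedness of the categories of cospans out of pairs `(X, Y)`. It makes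
-- reflexive coequalizers of `F`-Ops pointwise.
open Limits.WalkingReflexivePair Limits.WalkingReflexivePair.Hom in
instance : IsSifted WalkingReflexivePair where
  out := by
    rintro ⟨X, Y⟩
    let z (f : X ⟶ zero) (g : Y ⟶ zero) :
        StructuredArrow (X, Y) (Functor.diag WalkingReflexivePair) :=
      StructuredArrow.mk (Y := zero) (Prod.mkHom f g)
    let o (f : X ⟶ one) (g : Y ⟶ one) :
        StructuredArrow (X, Y) (Functor.diag WalkingReflexivePair) :=
      StructuredArrow.mk (Y := one) (Prod.mkHom f g)
    let l (f : X ⟶ one) (g : Y ⟶ one) : o f g ⟶ z (f ≫ left) (g ≫ left) :=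
      StructuredArrow.homMk left rfl
    let r (f : X ⟶ one) (g : Y ⟶ one) : o f g ⟶ z (f ≫ right) (g ≫ right) :=
      StructuredArrow.homMk right rfl
    -- Every cospan with apex `one` maps to one with apex `zero`, so only the latter need linking;
    -- the two maps `l` and `r` out of an apex-`one` cospan provide the links.
    have key (f₀ : X ⟶ zero) (g₀ : Y ⟶ zero)
        (h : ∀ (p : Set (StructuredArrow (X, Y) (Functor.diag WalkingReflexivePair))),
          z f₀ g₀ ∈ p → (∀ f g, z (f ≫ left) (g ≫ left) ∈ p ↔ z (f ≫ right) (g ≫ right) ∈ p) →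
            ∀ f g, z f g ∈ p) :
        IsConnected (StructuredArrow (X, Y) (Functor.diag WalkingReflexivePair)) := by
      refine IsConnected.of_induct (j₀ := z f₀ g₀) fun p h₀ hp ↦ ?_
      have h₁ := h p h₀ fun f g ↦ (hp (l f g)).symm.trans (hp (r f g))
      rintro ⟨⟨⟨⟩⟩, (_ | _), ⟨f, g⟩⟩
      · exact h₁ f g
      · exact (hp (l f g)).2 (h₁ _ _)
    cases X <;> cases Y
    · refine key (𝟙 _) (𝟙 _) fun p h₀ hp ↦ ?_
      rintro ⟨⟩ ⟨⟩
      exact h₀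
    · refine key (𝟙 _) left fun p h₀ hp ↦ ?_
      rintro ⟨⟩ (_ | _)
      · exact h₀
      · exact (hp reflexion (𝟙 _)).1 h₀
    · refine key left (𝟙 _) fun p h₀ hp ↦ ?_
      rintro (_ | _) ⟨⟩
      · exact h₀
      · exact (hp (𝟙 _) reflexion).1 h₀
    -- The four cospans on `left` and `right` are linked using the endomorphisms of `one` that
    -- factor through `reflexion`, which have the same composite with `left` and with `right`.
    · refine key left left fun p h₀ hp ↦ ?_
      have h₁ := (hp (𝟙 _) (𝟙 _)).1 h₀
      have h₂ := (hp (𝟙 _) leftCompReflexion).1 h₀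
      have h₃ := (hp (𝟙 _) rightCompReflexion).2 h₁
      rintro (_ | _) (_ | _)
      exacts [h₀, h₃, h₂, h₁]

section SiftedColimit

open Functor.LaxMonoidal Functor.OplaxMonoidal

variable {K : Type u₁} [Category.{v₁} K] {C : Type u} [Category.{v} C] [MonoidalCategory C]
  [HasColimitsOfShape K C]

/-- The coprojection to a colimit. -/
noncomputable def colimι (A : K ⥤ C) (k : K) : A.obj k ⟶ colim.obj A := colimit.ι A k

/-- The coprojection from a tensor product. -/
noncomputable def colimι₂ (A B : K ⥤ C) (k : K) : A.obj k ⊗ B.obj k ⟶ colim.obj (A ⊗ B) :=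
  colimit.ι (A ⊗ B) k

lemma colimι_map {A B : K ⥤ C} (f : A ⟶ B) (k : K) :
    colimι A k ≫ colim.map f = f.app k ≫ colimι B k :=
  ι_colimMap f k

lemma colimι₂_map {A A' B B' : K ⥤ C} (f : A ⟶ A') (g : B ⟶ B') (k : K) :
    colimι₂ A B k ≫ colim.map (f ⊗ₘ g) = (f.app k ⊗ₘ g.app k) ≫ colimι₂ A' B' k :=
  ι_colimMap (f ⊗ₘ g) k

lemma colim_hom_ext {A : K ⥤ C} {X : C} {f g : colim.obj A ⟶ X}
    (h : ∀ k, colimι A k ≫ f = colimι A k ≫ g) : f = g := colimit.hom_ext h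

lemma colim_hom_ext₂ {A B : K ⥤ C} {X : C} {f g : colim.obj (A ⊗ B) ⟶ X}
    (h : ∀ k, colimι₂ A B k ≫ f = colimι₂ A B k ≫ g) : f = g := colimit.hom_ext h

/-- The comparison from the colimit of the constant diagram at the unit. -/
noncomputable def colimη : colim.obj (𝟙_ (K ⥤ C)) ⟶ 𝟙_ C :=
  colimit.desc (𝟙_ (K ⥤ C)) ⟨𝟙_ C, { app := fun _ ↦ 𝟙 _ }⟩

/-- The comparison from the colimit of a tensor product to the tensor product of the colimits. -/
noncomputable def colimδ (A B : K ⥤ C) : colim.obj (A ⊗ B) ⟶ colim.obj A ⊗ colim.obj B :=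
  colimit.desc (A ⊗ B) (Cocone.tensor (colimit.cocone A) (colimit.cocone B))

/-- The coprojection from the unit. -/
noncomputable def colimι₀ (k : K) : 𝟙_ C ⟶ colim.obj (𝟙_ (K ⥤ C)) := colimι (𝟙_ (K ⥤ C)) k

lemma colimι₀_η (k : K) : colimι₀ (C := C) k ≫ colimη = 𝟙 _ :=
  colimit.ι_desc _ _

lemma colimι₂_δ (A B : K ⥤ C) (k : K) :
    colimι₂ A B k ≫ colimδ A B = colimι A k ⊗ₘ colimι B k :=
  colimit.ι_desc _ _

lemma colimδ_natural {A A' B B' : K ⥤ C} (f : A ⟶ A') (g : B ⟶ B') :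
    colimδ A B ≫ (colim.map f ⊗ₘ colim.map g) = colim.map (f ⊗ₘ g) ≫ colimδ A' B' :=
  colim_hom_ext₂ fun k ↦ by
    rw [reassoc_of% @colimι₂_δ, reassoc_of% @colimι₂_map, colimι₂_δ, tensorHom_comp_tensorHom, colimι_map,
      colimι_map, tensorHom_comp_tensorHom]

noncomputable instance colimOplaxMonoidal : (colim (J := K) (C := C)).OplaxMonoidal where
  η := colimη
  δ := colimδ
  δ_natural_left f B := by
    rw [← tensorHom_id, ← tensorHom_id, ← colimδ_natural, colim.map_id]
  δ_natural_right B f := by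
    rw [← id_tensorHom, ← id_tensorHom, ← colimδ_natural, colim.map_id]
  oplax_associativity A B D := colim_hom_ext₂ fun k ↦ by
    obtain ⟨l, hl⟩ : ∃ l : (A.obj k ⊗ B.obj k) ⊗ D.obj k ⟶ colim.obj ((A ⊗ B) ⊗ D),
      l = colimι₂ (A ⊗ B) D k := ⟨_, rfl⟩
    obtain ⟨r, hr⟩ : ∃ r : A.obj k ⊗ B.obj k ⊗ D.obj k ⟶ colim.obj (A ⊗ B ⊗ D),
      r = colimι₂ A (B ⊗ D) k := ⟨_, rfl⟩
    have h₁ : l ≫ colimδ (A ⊗ B) D = colimι₂ A B k ⊗ₘ colimι D k := hl ▸ colimι₂_δ _ _ _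
    have h₂ : r ≫ colimδ A (B ⊗ D) = colimι A k ⊗ₘ colimι₂ B D k := hr ▸ colimι₂_δ _ _ _
    have h₃ : l ≫ colim.map (α_ A B D).hom = (α_ _ _ _).hom ≫ r := by
      rw [hl, hr]
      exact colimι_map (α_ A B D).hom k
    have : l ≫ colimδ (A ⊗ B) D ≫ colimδ A B ▷ colim.obj D ≫ (α_ _ _ _).hom =
        l ≫ colim.map (α_ A B D).hom ≫ colimδ A (B ⊗ D) ≫ colim.obj A ◁ colimδ B D := by
      rw [reassoc_of% h₁, reassoc_of% h₃, reassoc_of% h₂, ← tensorHom_id, ← id_tensorHom,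
        tensorHom_comp_tensorHom_assoc, tensorHom_comp_tensorHom, colimι₂_δ, colimι₂_δ,
        Category.comp_id, Category.comp_id, associator_naturality]
    rwa [hl] at this
  oplax_left_unitality A := colim_hom_ext fun k ↦ by
    have h : colimι A k ≫ colim.map (λ_ A).inv =
      (λ_ (A.obj k)).inv ≫ colimι₂ (𝟙_ (K ⥤ C)) A k := colimι_map (λ_ A).inv k
    have h' : colimι₂ (𝟙_ (K ⥤ C)) A k ≫ colimδ (𝟙_ _) A = colimι₀ k ⊗ₘ colimι A k :=
      colimι₂_δ _ _ k
    have h'' := congrArg (fun t ↦ (λ_ (A.obj k)).inv ≫ t ≫ (colimη ⊗ₘ 𝟙 (colim.obj A))) h'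
    rw [tensorHom_comp_tensorHom, colimι₀_η, Category.comp_id] at h''
    rw [reassoc_of% h, ← tensorHom_id, leftUnitor_inv_naturality, ← id_tensorHom, ← h'']
    exact congrArg _ (Category.assoc _ _ _)
  oplax_right_unitality A := colim_hom_ext fun k ↦ by
    have h : colimι A k ≫ colim.map (ρ_ A).inv =
      (ρ_ (A.obj k)).inv ≫ colimι₂ A (𝟙_ (K ⥤ C)) k := colimι_map (ρ_ A).inv k
    have h' : colimι₂ A (𝟙_ (K ⥤ C)) k ≫ colimδ A (𝟙_ _) = colimι A k ⊗ₘ colimι₀ k :=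
      colimι₂_δ _ _ k
    have h'' := congrArg (fun t ↦ (ρ_ (A.obj k)).inv ≫ t ≫ (𝟙 (colim.obj A) ⊗ₘ colimη)) h'
    rw [tensorHom_comp_tensorHom, colimι₀_η, Category.comp_id] at h''
    rw [reassoc_of% h, ← id_tensorHom, rightUnitor_inv_naturality, ← tensorHom_id, ← h'']
    exact congrArg _ (Category.assoc _ _ _)

variable [SymmetricCategory C] [MonoidalClosed C] [IsSifted K]

/-- A sifted category is connected, so a constant diagram has its value as colimit. -/
instance : IsIso (colimη (K := K) (C := C)) := by
  have h : IsColimit (⟨𝟙_ C, { app := fun _ ↦ 𝟙 _ }⟩ : Cocone (𝟙_ (K ⥤ C))) :=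
    isColimitConstCocone K (𝟙_ C)
  exact ((colimit.isColimit (𝟙_ (K ⥤ C))).coconePointUniqueUpToIso h).isIso_hom

/-- Closedness makes the tensor product of the colimits a colimit over `K × K`, and siftedness
restricts it to the diagonal. -/
instance (A B : K ⥤ C) : IsIso (colimδ A B) := by
  have h := IsColimit.tensor (colimit.isColimit A) (colimit.isColimit B)
  exact ((colimit.isColimit (A ⊗ B)).coconePointUniqueUpToIso h).isIso_hom

noncomputable instance colimMonoidal : (colim (J := K) (C := C)).Monoidal :=
  letI : IsIso (η (colim (J := K) (C := C))) := inferInstanceAs (IsIso colimη)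
  letI (A B : K ⥤ C) : IsIso (δ (colim (J := K) (C := C)) A B) :=
    inferInstanceAs (IsIso (colimδ A B))
  Functor.Monoidal.ofOplaxMonoidal colim

lemma colimδ_μ (A B : K ⥤ C) : colimδ A B ≫ μ colim A B = 𝟙 _ :=
  IsIso.hom_inv_id (colimδ A B)

lemma colimι_tensor_μ (A B : K ⥤ C) (k : K) :
    (colimι A k ⊗ₘ colimι B k) ≫ μ colim A B = colimι₂ A B k := by
  rw [← colimι₂_δ, Category.assoc, colimδ_μ, Category.comp_id]

lemma colimι₀_eq_ε (k : K) : colimι₀ k = ε (colim (J := K) (C := C)) := by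
  rw [← cancel_mono colimη, colimι₀_η]
  exact (IsIso.inv_hom_id colimη).symm

lemma colim_tensor_hom_ext (A B : K ⥤ C) {X : C} {f g : colim.obj A ⊗ colim.obj B ⟶ X}
    (h : ∀ k, (colimι A k ⊗ₘ colimι B k) ≫ f = (colimι A k ⊗ₘ colimι B k) ≫ g) :
    f = g := by
  rw [← cancel_epi (colimδ A B)]
  refine colim_hom_ext₂ fun k ↦ ?_
  rw [reassoc_of% @colimι₂_δ, reassoc_of% @colimι₂_δ, h]

noncomputable instance colimBraided : (colim (J := K) (C := C)).Braided where
  braided A B := by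
    refine colim_tensor_hom_ext A B fun k ↦ ?_
    rw [reassoc_of% @colimι_tensor_μ, BraidedCategory.braiding_naturality_assoc, colimι_tensor_μ]
    exact colimι_map (β_ A B).hom k

end SiftedColimit

/-! ## Limits and sifted colimits of `F`-Ops -/

namespace FOp

open Functor.LaxMonoidal Functor.OplaxMonoidal

variable {F : Type u₂} [Category.{v₂} F] [MonoidalCategory F] [SymmetricCategory F]
  {C : Type u} [Category.{v} C] [MonoidalCategory C] [SymmetricCategory C]

@[simp] lemma id_natTrans (O : FOp F C) : Hom.natTrans (𝟙 O) = 𝟙 O.functor := rfl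

@[simp] lemma comp_natTrans {O Q R : FOp F C} (f : O ⟶ Q) (g : Q ⟶ R) :
    (f ≫ g).natTrans = f.natTrans ≫ g.natTrans := rfl

@[ext]
lemma hom_ext {O Q : FOp F C} {f g : O ⟶ Q} (h : f.natTrans = g.natTrans) : f = g := Hom.ext h

attribute [instance] Hom.isMonoidal

variable (F C) in
/-- The functor underlying an `F`-Op. -/
@[simps]
def forget : FOp F C ⥤ F ⥤ C where
  obj O := O.functor
  map f := f.natTrans

/-- An isomorphism of `F`-Ops from a monoidal natural isomorphism. -/
@[simps]
def isoMk {O Q : FOp F C} (e : O.functor ≅ Q.functor) [NatTrans.IsMonoidal e.hom] : O ≅ Q where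
  hom := ⟨e.hom, inferInstance⟩
  inv := ⟨e.inv, inferInstance⟩
  hom_inv_id := hom_ext e.hom_inv_id
  inv_hom_id := hom_ext e.inv_hom_id

instance : (forget F C).ReflectsIsomorphisms where
  reflects f h := by
    have : IsIso f.natTrans := h
    have : NatTrans.IsMonoidal (asIso f.natTrans).hom := f.isMonoidal
    exact (isoMk (asIso f.natTrans)).isIso_hom

section Diagram

variable {K : Type u₁} [Category.{v₁} K] (D : K ⥤ FOp F C)

/-- A diagram of `F`-Ops as a functor with values in diagrams. -/
abbrev diagram : F ⥤ K ⥤ C := (D ⋙ forget F C).flip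

/-- The structure is that of the individual Ops; its naturality along the diagram is monoidality of
the transition maps. -/
instance : (diagram D).Monoidal :=
  Functor.CoreMonoidal.toMonoidal
    { εIso := NatIso.ofComponents (fun k ↦ Functor.Monoidal.εIso (D.obj k).functor)
        (fun f ↦ (Category.id_comp _).trans (NatTrans.IsMonoidal.unit (τ := (D.map f).natTrans)).symm)
      μIso := fun X Y ↦ NatIso.ofComponents (fun k ↦ Functor.Monoidal.μIso (D.obj k).functor X Y)
        (fun f ↦ (NatTrans.IsMonoidal.tensor (τ := (D.map f).natTrans) X Y).symm)
      μIso_hom_natural_left := fun f Y ↦ by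
        ext k; exact μ_natural_left (D.obj k).functor f Y
      μIso_hom_natural_right := fun X f ↦ by
        ext k; exact μ_natural_right (D.obj k).functor X f
      associativity := fun X Y Z ↦ by
        ext k; exact Functor.LaxMonoidal.associativity (D.obj k).functor X Y Z
      left_unitality := fun X ↦ by
        ext k; exact Functor.LaxMonoidal.left_unitality (D.obj k).functor X
      right_unitality := fun X ↦ by
        ext k; exact Functor.LaxMonoidal.right_unitality (D.obj k).functor X }

instance : (diagram D).Braided where
  braided X Y := by
    ext k; exact Functor.LaxBraided.braided (F := (D.obj k).functor) X Y

section

variable [HasColimitsOfShape K C] [MonoidalClosed C] [IsSifted K]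

/-- The pointwise colimit of a sifted diagram of `F`-Ops. -/
noncomputable def siftedColimit : FOp F C := ⟨diagram D ⋙ colim, inferInstance⟩

/-- The coprojections to the pointwise colimit of a sifted diagram of `F`-Ops. -/
noncomputable def siftedι (k : K) : (D.obj k).functor ⟶ (siftedColimit D).functor where
  app X := colimι ((diagram D).obj X) k
  naturality _ _ f := (colimι_map ((diagram D).map f) k).symm

instance (k : K) : NatTrans.IsMonoidal (siftedι D k) where
  unit := by
    change ε (D.obj k).functor ≫ _ = ε (diagram D ⋙ colim)
    rw [comp_ε, ← colimι₀_eq_ε k]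
    exact (colimι_map (ε (diagram D)) k).symm
  tensor X Y := by
    change μ (D.obj k).functor X Y ≫ _ = _ ≫ μ (diagram D ⋙ colim) X Y
    rw [comp_μ]
    change _ = (colimι ((diagram D).obj X) k ⊗ₘ colimι ((diagram D).obj Y) k) ≫ _
    rw [reassoc_of% @colimι_tensor_μ]
    exact (colimι_map (μ (diagram D) X Y) k).symm

lemma siftedColimit_tensor_hom_ext {X Y : F} {Z : C}
    {f g : (siftedColimit D).functor.obj X ⊗ (siftedColimit D).functor.obj Y ⟶ Z}
    (h : ∀ k, ((siftedι D k).app X ⊗ₘ (siftedι D k).app Y) ≫ f =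
      ((siftedι D k).app X ⊗ₘ (siftedι D k).app Y) ≫ g) : f = g :=
  colim_tensor_hom_ext ((diagram D).obj X) ((diagram D).obj Y) h

/-- The pointwise colimit cocone of a sifted diagram of `F`-Ops. -/
noncomputable def siftedCocone : Cocone D where
  pt := siftedColimit D
  ι :=
    { app := fun k ↦ ⟨siftedι D k, inferInstance⟩
      naturality := fun k k' f ↦ by
        ext X
        exact (colimit.w ((diagram D).obj X) f).trans (Category.comp_id _).symm }

/-- The pointwise colimit of a sifted diagram of `F`-Ops is a colimit of functors. -/
noncomputable def isColimitForgetSiftedCocone :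
    IsColimit ((forget F C).mapCocone (siftedCocone D)) :=
  evaluationJointlyReflectsColimits _ fun X ↦ colimit.isColimit ((diagram D).obj X)

lemma isMonoidal_of_siftedι {O : F ⥤ C} [O.LaxMonoidal] (d : (siftedColimit D).functor ⟶ O)
    (h : ∀ k, NatTrans.IsMonoidal (siftedι D k ≫ d)) : NatTrans.IsMonoidal d where
  unit := by
    -- The unit condition can be tested through any one coprojection, so an index must exist.
    obtain ⟨k⟩ := IsSifted.nonempty (C := K)
    rw [← NatTrans.IsMonoidal.unit (τ := siftedι D k), Category.assoc, ← NatTrans.comp_app,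
      NatTrans.IsMonoidal.unit (τ := siftedι D k ≫ d)]
  tensor X Y := siftedColimit_tensor_hom_ext D fun k ↦ by
    have h₁ := NatTrans.IsMonoidal.tensor (τ := siftedι D k) X Y
    have h₂ := NatTrans.IsMonoidal.tensor (τ := siftedι D k ≫ d) X Y
    rw [NatTrans.comp_app, NatTrans.comp_app, NatTrans.comp_app] at h₂
    rw [← reassoc_of% h₁, h₂, tensorHom_comp_tensorHom_assoc]

/-- The pointwise colimit of a sifted diagram of `F`-Ops is a colimit. -/
noncomputable def isColimitSiftedCocone : IsColimit (siftedCocone D) := by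
  let d (s : Cocone D) : (siftedColimit D).functor ⟶ s.pt.functor :=
    (isColimitForgetSiftedCocone D).desc ((forget F C).mapCocone s)
  have hd (s : Cocone D) (k : K) : siftedι D k ≫ d s = (s.ι.app k).natTrans :=
    (isColimitForgetSiftedCocone D).fac ((forget F C).mapCocone s) k
  have hdm (s : Cocone D) : NatTrans.IsMonoidal (d s) :=
    isMonoidal_of_siftedι D _ fun k ↦ by
      rw [hd]
      exact (s.ι.app k).isMonoidal
  exact
    { desc := fun s ↦ ⟨d s, hdm s⟩
      fac := fun s k ↦ by
        ext1
        exact hd s k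
      uniq := fun s m hm ↦ hom_ext ((isColimitForgetSiftedCocone D).uniq ((forget F C).mapCocone s)
        m.natTrans fun k ↦ congrArg Hom.natTrans (hm k)) }

end

end Diagram

section

variable (K : Type u₁) [Category.{v₁} K] [HasColimitsOfShape K C] [MonoidalClosed C] [IsSifted K]

instance hasSiftedColimits : HasColimitsOfShape K (FOp F C) where
  has_colimit D := ⟨⟨_, isColimitSiftedCocone D⟩⟩

instance forget_preservesSiftedColimits : PreservesColimitsOfShape K (forget F C) where
  preservesColimit {D} := preservesColimit_of_preserves_colimit_cocone (isColimitSiftedCocone D)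
    (isColimitForgetSiftedCocone D)

end

end FOp

/-! ### Limits, which are only lax symmetric monoidal -/

section Limit

open Functor.LaxMonoidal Functor.OplaxMonoidal

noncomputable instance limLaxBraided {K : Type w} [SmallCategory K] {C : Type u} [Category.{v} C]
    [MonoidalCategory C] [BraidedCategory C] [HasLimitsOfShape K C] :
    (lim (J := K) (C := C)).LaxBraided where
  braided A B := limit.hom_ext fun k ↦ by
    obtain ⟨p, hp⟩ : ∃ p : ∀ A : K ⥤ C, lim.obj A ⟶ A.obj k, ∀ A, p A = limit.π A k :=
      ⟨fun A ↦ limit.π A k, fun _ ↦ rfl⟩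
    have hμ (A B : K ⥤ C) : μ lim A B ≫ p (A ⊗ B) = p A ⊗ₘ p B := by
      rw [hp, hp, hp]
      exact lim_μ_π A B k
    have hβ : lim.map (β_ A B).hom ≫ p (B ⊗ A) = p (A ⊗ B) ≫ (β_ (A.obj k) (B.obj k)).hom := by
      rw [hp, hp]
      exact limMap_π (β_ A B).hom k
    have h : (μ lim A B ≫ lim.map (β_ A B).hom) ≫ p (B ⊗ A) =
        ((β_ _ _).hom ≫ μ lim B A) ≫ p (B ⊗ A) := by
      have h' : (μ lim A B ≫ p (A ⊗ B)) ≫ (β_ (A.obj k) (B.obj k)).hom =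
          (β_ _ _).hom ≫ μ lim B A ≫ p (B ⊗ A) :=
        (congrArg (· ≫ _) (hμ A B)).trans ((BraidedCategory.braiding_naturality _ _).trans
          (congrArg _ (hμ B A).symm))
      rw [Category.assoc, Category.assoc, hβ, ← h']
      exact (Category.assoc _ _ _).symm
    rwa [hp] at h

end Limit

namespace FOp

open Functor.LaxMonoidal Functor.OplaxMonoidal

variable {F : Type u₂} [Category.{v₂} F] [MonoidalCategory F] [SymmetricCategory F]
  {C : Type u} [Category.{v} C] [MonoidalCategory C] [SymmetricCategory C]

section

variable {K : Type w} [SmallCategory K] (D : K ⥤ FOp F C) [HasLimitsOfShape K C]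

/-- The projections of the pointwise limit of a diagram of `F`-Ops. -/
noncomputable def laxLimitπ (k : K) : diagram D ⋙ lim ⟶ (D.obj k).functor where
  app X := limit.π ((diagram D).obj X) k
  naturality _ _ f := limMap_π ((diagram D).map f) k

instance (k : K) : NatTrans.IsMonoidal (laxLimitπ D k) where
  unit := by
    rw [comp_ε]
    have h : lim.map (ε (diagram D)) ≫ limit.π ((diagram D).obj (𝟙_ F)) k =
      limit.π (𝟙_ (K ⥤ C)) k ≫ ε (D.obj k).functor := limMap_π (ε (diagram D)) k
    have h' := congrArg (· ≫ ε (D.obj k).functor) (lim_ε_π (C := C) k)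
    exact (Category.assoc _ _ _).trans ((congrArg _ h).trans ((Category.assoc _ _ _).symm.trans
      (h'.trans (Category.id_comp _))))
  tensor X Y := by
    rw [comp_μ]
    have h : lim.map (μ (diagram D) X Y) ≫ limit.π ((diagram D).obj (X ⊗ Y)) k =
      limit.π ((diagram D).obj X ⊗ (diagram D).obj Y) k ≫ μ (D.obj k).functor X Y :=
        limMap_π (μ (diagram D) X Y) k
    have h' := congrArg (· ≫ μ (D.obj k).functor X Y)
      (lim_μ_π ((diagram D).obj X) ((diagram D).obj Y) k)
    exact (Category.assoc _ _ _).trans ((congrArg _ h).trans ((Category.assoc _ _ _).symm.trans h'))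

lemma laxLimit_hom_ext {P : F ⥤ C} {σ τ : P ⟶ diagram D ⋙ lim}
    (h : ∀ k, σ ≫ laxLimitπ D k = τ ≫ laxLimitπ D k) : σ = τ := by
  ext X
  exact limit.hom_ext fun k ↦ NatTrans.congr_app (h k) X

lemma isMonoidal_of_laxLimitπ {P : F ⥤ C} [P.LaxMonoidal] (σ : P ⟶ diagram D ⋙ lim)
    (h : ∀ k, NatTrans.IsMonoidal (σ ≫ laxLimitπ D k)) : NatTrans.IsMonoidal σ where
  unit := limit.hom_ext fun k ↦ by
    have h₁ := NatTrans.IsMonoidal.unit (τ := σ ≫ laxLimitπ D k)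
    rw [← NatTrans.IsMonoidal.unit (τ := laxLimitπ D k), NatTrans.comp_app,
      ← Category.assoc] at h₁
    exact h₁
  tensor X Y := limit.hom_ext fun k ↦ by
    have h₁ := NatTrans.IsMonoidal.tensor (τ := σ ≫ laxLimitπ D k) X Y
    have h₂ := NatTrans.IsMonoidal.tensor (τ := laxLimitπ D k) X Y
    rw [NatTrans.comp_app, NatTrans.comp_app, NatTrans.comp_app, ← tensorHom_comp_tensorHom,
      Category.assoc, ← h₂, ← Category.assoc, ← Category.assoc] at h₁
    exact h₁

/-- The pointwise cone given by a cone of functors. -/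
abbrev laxLimitCone {P : F ⥤ C} (σ : ∀ k, P ⟶ (D.obj k).functor)
    (h : ∀ {k k'} (f : k ⟶ k'), σ k ≫ (D.map f).natTrans = σ k') (X : F) :
    Cone ((diagram D).obj X) where
  pt := P.obj X
  π :=
    { app := fun k ↦ (σ k).app X
      naturality := fun _ _ f ↦ (Category.id_comp _).trans (NatTrans.congr_app (h f) X).symm }

/-- The transformation to the pointwise limit induced by a cone of functors. -/
noncomputable def laxLimitLift {P : F ⥤ C} (σ : ∀ k, P ⟶ (D.obj k).functor)
    (h : ∀ {k k'} (f : k ⟶ k'), σ k ≫ (D.map f).natTrans = σ k') : P ⟶ diagram D ⋙ lim where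
  app X := limit.lift ((diagram D).obj X) (laxLimitCone D σ h X)
  naturality X Y f := limit.hom_ext fun k ↦ by
    have h₁ : lim.map ((diagram D).map f) ≫ limit.π ((diagram D).obj Y) k =
      limit.π ((diagram D).obj X) k ≫ (D.obj k).functor.map f := limMap_π _ k
    have h₂ := (σ k).naturality f
    have h₃ (X : F) : limit.lift ((diagram D).obj X) (laxLimitCone D σ h X) ≫ limit.π _ k =
      (σ k).app X := limit.lift_π _ _
    refine (Category.assoc _ _ _).trans ((congrArg _ (h₃ Y)).trans (h₂.trans ?_))
    refine Eq.trans ?_ (Category.assoc _ _ _).symm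
    refine Eq.trans ?_ (congrArg _ h₁).symm
    refine Eq.trans ?_ (Category.assoc _ _ _)
    exact congrArg (· ≫ (D.obj k).functor.map f) (h₃ X).symm

lemma laxLimitLift_π {P : F ⥤ C} (σ : ∀ k, P ⟶ (D.obj k).functor)
    (h : ∀ {k k'} (f : k ⟶ k'), σ k ≫ (D.map f).natTrans = σ k') (k : K) :
    laxLimitLift D σ h ≫ laxLimitπ D k = σ k := by
  ext X
  exact limit.lift_π _ _

end

variable {V : Type u₁} [Groupoid.{v₁} V] {ι : V ⥤ F} (hF : IsFeynmanCategory.{w} ι)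

include hF

lemma hom_ext_of_isFeynmanCategory {O Q : FOp F C} {f g : O ⟶ Q}
    (h : ∀ v, f.natTrans.app (ι.obj v) = g.natTrans.app (ι.obj v)) : f = g :=
  hom_ext (hF.monoidal_ext _ _ h)

lemma isIso_of_isFeynmanCategory {O Q : FOp F C} (f : O ⟶ Q)
    (h : ∀ v, IsIso (f.natTrans.app (ι.obj v))) : IsIso f := by
  have : IsIso ((forget F C).map f) := hF.isIso_of_isMonoidal f.natTrans h
  exact isIso_of_reflects_iso f (forget F C)

/-- The pointwise limit is a lax functor, and its strong coreflection is the limit: a cone from an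
Op induces a monoidal map to the lax limit, which lifts. Uniqueness is tested at the vertices, where
the counit is invertible. -/
theorem hasLimitsOfShape (K : Type w) [SmallCategory K] [HasLimitsOfShape K C] :
    HasLimitsOfShape K (FOp F C) where
  has_limit D := by
    obtain ⟨S⟩ := hF.nonempty_strongCoreflection (diagram D ⋙ lim)
    have hlift (s : Cone D) : ∃ m : s.pt ⟶ ⟨S.functor, S.braided⟩,
        ∀ k, m.natTrans ≫ S.counit ≫ laxLimitπ D k = (s.π.app k).natTrans := by
      let t := laxLimitLift D (P := s.pt.functor) (fun k ↦ (s.π.app k).natTrans)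
        (fun f ↦ congrArg Hom.natTrans (s.w f))
      have ht (k : K) : t ≫ laxLimitπ D k = (s.π.app k).natTrans := laxLimitLift_π D _ _ k
      have : NatTrans.IsMonoidal t := isMonoidal_of_laxLimitπ D t fun k ↦ by
        rw [ht]
        exact (s.π.app k).isMonoidal
      obtain ⟨m, hm, h⟩ := S.exists_lift s.pt.functor t
      exact ⟨⟨m, hm⟩, fun k ↦ by rw [← Category.assoc, h, ht]⟩
    choose l hl using hlift
    exact ⟨⟨
      { cone :=
          { pt := ⟨S.functor, S.braided⟩
            π :=
              { app := fun k ↦ ⟨S.counit ≫ laxLimitπ D k, inferInstance⟩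
                naturality := fun k k' f ↦ by
                  ext X
                  have := limit.w ((diagram D).obj X) f
                  refine (Category.id_comp _).trans ?_
                  refine Eq.trans ?_ (Category.assoc _ _ _).symm
                  exact congrArg _ this.symm } }
        isLimit :=
          { lift := l
            fac := fun s k ↦ hom_ext (hl s k)
            uniq := fun s m hm ↦ hom_ext_of_isFeynmanCategory hF fun v ↦ by
              rw [← cancel_mono (S.counit.app (ι.obj v)), ← NatTrans.comp_app,
                ← NatTrans.comp_app]
              refine NatTrans.congr_app (laxLimit_hom_ext D fun k ↦ ?_) _
              rw [Category.assoc, Category.assoc, hl]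
              exact congrArg Hom.natTrans (hm k) } }⟩⟩

end FOp

/-! ## Smallness of the morphisms of a Feynman category -/

namespace FreeSymm

section

variable {G : Type u₁} [Category.{v₁} G] {G' : Type u₂} [Category.{v₂} G']

/-- The functor induced on free symmetric monoidal categories. -/
abbrev mapFunctor (Φ : G ⥤ G') : FreeSymm G ⥤ FreeSymm G' := lift (Φ ⋙ incl G')

/-- A retraction induces a retraction on free symmetric monoidal categories. -/
noncomputable def mapFunctorRetract (Φ : G ⥤ G') (Ψ : G' ⥤ G) (e : 𝟭 G ≅ Φ ⋙ Ψ) :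
    mapFunctor Φ ⋙ mapFunctor Ψ ≅ 𝟭 (FreeSymm G) :=
  let t₁ : incl G ⟶ incl G ⋙ 𝟭 (FreeSymm G) := 𝟙 _
  let t₂ : incl G ⟶ incl G ⋙ mapFunctor Φ ⋙ mapFunctor Ψ := Functor.whiskerRight e.hom (incl G)
  haveI : IsIso t₁ := inferInstanceAs (IsIso (𝟙 _))
  haveI : IsIso t₂ := inferInstanceAs (IsIso (Functor.whiskerRight e.hom (incl G)))
  haveI := isIso_laxExt t₁
  haveI := isIso_laxExt t₂
  (asIso (laxExt t₂)).symm ≪≫ asIso (laxExt t₁)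

lemma faithful_mapFunctor (Φ : G ⥤ G') (Ψ : G' ⥤ G) (e : 𝟭 G ≅ Φ ⋙ Ψ) :
    (mapFunctor Φ).Faithful := by
  have := Functor.Faithful.of_iso (mapFunctorRetract Φ Ψ e).symm
  exact Functor.Faithful.of_comp _ (mapFunctor Ψ)

lemma essSurj_mapFunctor (Φ : G ⥤ G') (Ψ : G' ⥤ G) (e : 𝟭 G ≅ Φ ⋙ Ψ) :
    (mapFunctor Ψ).EssSurj where
  mem_essImage X := ⟨_, ⟨(mapFunctorRetract Φ Ψ e).app X⟩⟩

end

variable (G : Type u₁) [Category.{v₁} G] [EssentiallySmall.{w} G]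

/-- Passage to a small model is faithful on free symmetric monoidal categories, because an
equivalence induces a functor with a retraction up to isomorphism. -/
instance : LocallySmall.{w} (FreeSymm G) :=
  have := faithful_mapFunctor (equivSmallModel.{w} G).functor (equivSmallModel.{w} G).inverse
    (equivSmallModel.{w} G).unitIso
  locallySmall_of_faithful (mapFunctor (equivSmallModel.{w} G).functor)

end FreeSymm

namespace IsFeynmanCategory

variable {V : Type u₁} [Groupoid.{v₁} V] [EssentiallySmall.{w} V] {F : Type u₂} [Category.{v₂} F]
  [MonoidalCategory F] [SymmetricCategory F] {ι : V ⥤ F} (hF : IsFeynmanCategory.{w} ι)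

include hF

lemma small_iso (X Y : F) : Small.{w} (X ≅ Y) := by
  have := hF.isomorphism_condition
  have : LocallySmall.{w} (Core F) :=
    locallySmall_of_faithful (FreeSymm.lift (Core.functorToCore ι)).asEquivalence.inverse
  exact small_of_injective (β := (⟨X⟩ : Core F) ⟶ ⟨Y⟩) (f := fun e ↦ ⟨e⟩)
    (fun e e' h ↦ congrArg CoreHom.iso h)

lemma exists_small_representatives :
    ∃ (S : Type w) (r : S → F), ∀ X : F, ∃ s, Nonempty (X ≅ r s) := by
  have := hF.isomorphism_condition
  have := FreeSymm.essSurj_mapFunctor (equivSmallModel.{w} V).functor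
    (equivSmallModel.{w} V).inverse (equivSmallModel.{w} V).unitIso
  refine ⟨FreeSymm (SmallModel.{w} V),
    fun U ↦ wordObj ι ((FreeSymm.mapFunctor (equivSmallModel.{w} V).inverse).obj U), fun X ↦ ?_⟩
  obtain ⟨U, ⟨e⟩⟩ := hF.exists_iso_wordObj X
  exact ⟨(FreeSymm.mapFunctor (equivSmallModel.{w} V).inverse).objPreimage U,
    ⟨e.symm ≪≫ (Core.inclusion F).mapIso ((FreeSymm.lift (Core.functorToCore ι)).mapIso
      ((FreeSymm.mapFunctor (equivSmallModel.{w} V).inverse).objObjPreimageIso U).symm)⟩⟩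

/-- The size condition bounds the isomorphism classes in the slice. Morphisms from `X` in one class
differ by an automorphism of `X`, and these form a small set. -/
lemma small_hom_obj (X : F) (v : V) : Small.{w} (X ⟶ ι.obj v) := by
  have := hF.size_condition v
  have := hF.small_iso X X
  let q (f : X ⟶ ι.obj v) : Shrink.{w} (Skeleton (Over (ι.obj v))) :=
    equivShrink _ (toSkeleton (Over.mk f))
  let φ (p : Set.range q × (X ≅ X)) : X ⟶ ι.obj v := p.2.hom ≫ p.1.2.choose
  refine small_of_surjective (f := φ) fun f ↦ ?_
  have h : q _ = q f := (⟨q f, f, rfl⟩ : Set.range q).2.choose_spec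
  obtain ⟨e⟩ := toSkeleton_eq_toSkeleton_iff.1 ((equivShrink _).injective h)
  exact ⟨⟨⟨q f, f, rfl⟩, (Over.forget _).mapIso e.symm⟩, Over.w e.inv⟩

/-- Induction on the target. Over a tensor product, a morphism is encoded by a decomposition whose
sources are taken from a small set of representatives. -/
lemma locallySmall : LocallySmall.{w} F where
  hom_small X Y := by
    revert X
    refine hF.object_induction (Q := fun Y ↦ ∀ X, Small.{w} (X ⟶ Y)) ?_ ?_ ?_ ?_ Y
    · intro Y Y' e h X
      have := h X
      exact small_of_injective (f := fun f : X ⟶ Y' ↦ f ≫ e.inv)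
        (fun f f' h ↦ (cancel_mono e.inv).1 h)
    · exact fun v X ↦ hF.small_hom_obj X v
    · intro X
      have := hF.small_iso X (𝟙_ F)
      exact small_of_surjective (f := fun e : X ≅ 𝟙_ F ↦ e.hom)
        (fun f ↦ have := hF.isIso_of_unit f; ⟨asIso f, rfl⟩)
    · intro Y₁ Y₂ h₁ h₂ X
      obtain ⟨S, r, hr⟩ := hF.exists_small_representatives
      have (s s' : S) := hF.small_iso X (r s ⊗ r s')
      let φ (p : Σ s : S, Σ s' : S, (X ≅ r s ⊗ r s') × (r s ⟶ Y₁) × (r s' ⟶ Y₂)) : X ⟶ Y₁ ⊗ Y₂ :=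
        p.2.2.1.hom ≫ (p.2.2.2.1 ⊗ₘ p.2.2.2.2)
      refine small_of_surjective (f := φ) fun f ↦ ?_
      obtain ⟨X₁, X₂, σ, f₁, f₂, rfl⟩ := hF.exists_decomposition f
      obtain ⟨s₁, ⟨e₁⟩⟩ := hr X₁
      obtain ⟨s₂, ⟨e₂⟩⟩ := hr X₂
      exact ⟨⟨s₁, s₂, σ ≪≫ (e₁ ⊗ᵢ e₂), e₁.inv ≫ f₁, e₂.inv ≫ f₂⟩, by simp [φ]⟩

end IsFeynmanCategory

/-! ## Left Kan extensions of lax monoidal functors -/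

namespace LaxKan

open Functor.LaxMonoidal Functor.OplaxMonoidal

section Hom

variable {K : Type u₁} [Category.{v₁} K] {F : Type u₂} [Category.{v₂} F]
  {C : Type u} [Category.{v} C]
  {H : K ⥤ F} {B : K ⥤ C} {L : F ⥤ C} (i : B ⟶ H ⋙ L)

/-- The map to the Kan extension indexed by an object over `X`. -/
def ι {k : K} {X : F} (f : H.obj k ⟶ X) : B.obj k ⟶ L.obj X := i.app k ≫ L.map f

lemma ι_map {k : K} {X Y : F} (f : H.obj k ⟶ X) (g : X ⟶ Y) :
    ι i f ≫ L.map g = ι i (f ≫ g) := by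
  simp [ι]

lemma map_ι {k l : K} {X : F} (s : k ⟶ l) (f : H.obj l ⟶ X) :
    B.map s ≫ ι i f = ι i (H.map s ≫ f) := by
  simp [ι]

lemma ι_id (k : K) : ι i (𝟙 (H.obj k)) = i.app k := by simp [ι]

variable (hL : (Functor.LeftExtension.mk L i).IsPointwiseLeftKanExtension)

include hL

variable [MonoidalCategory C] [SymmetricCategory C] [MonoidalClosed C]

/-- Tensoring preserves colimits in each variable, so the pointwise colimit formulas exhibit `L.obj
X ⊗ L.obj Y` as a colimit over pairs of objects over `X` and `Y`. -/
lemma tensor_hom_ext {X Y : F} {Z : C} {f g : L.obj X ⊗ L.obj Y ⟶ Z}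
    (h : ∀ (k l : K) (a : H.obj k ⟶ X) (b : H.obj l ⟶ Y),
      (ι i a ⊗ₘ ι i b) ≫ f = (ι i a ⊗ₘ ι i b) ≫ g) : f = g := by
  refine (IsColimit.tensor₂ (hL X) (hL Y)).hom_ext fun ⟨a, b⟩ ↦ ?_
  have := h _ _ a.hom b.hom
  rw [MonoidalCategory.tensorHom_def] at this
  exact this

lemma tensor_hom_ext₃ {X Y Z : F} {W : C} {f g : (L.obj X ⊗ L.obj Y) ⊗ L.obj Z ⟶ W}
    (h : ∀ (k l m : K) (a : H.obj k ⟶ X) (b : H.obj l ⟶ Y) (c : H.obj m ⟶ Z),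
      ((ι i a ⊗ₘ ι i b) ⊗ₘ ι i c) ≫ f = ((ι i a ⊗ₘ ι i b) ⊗ₘ ι i c) ≫ g) : f = g := by
  refine (IsColimit.tensor₂ (IsColimit.tensor₂ (hL X) (hL Y)) (hL Z)).hom_ext
    fun ⟨⟨a, b⟩, c⟩ ↦ ?_
  have := h _ _ _ a.hom b.hom c.hom
  rw [MonoidalCategory.tensorHom_def, MonoidalCategory.tensorHom_def] at this
  exact this

lemma exists_tensor_desc {X Y : F} {Z : C}
    (m : ∀ (k l : K) (_ : H.obj k ⟶ X) (_ : H.obj l ⟶ Y), B.obj k ⊗ B.obj l ⟶ Z)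
    (hm : ∀ {k k' l l' : K} (s : k ⟶ k') (t : l ⟶ l') (a : H.obj k' ⟶ X) (b : H.obj l' ⟶ Y),
      (B.map s ⊗ₘ B.map t) ≫ m k' l' a b = m k l (H.map s ≫ a) (H.map t ≫ b)) :
    ∃ f : L.obj X ⊗ L.obj Y ⟶ Z, ∀ (k l : K) (a : H.obj k ⟶ X) (b : H.obj l ⟶ Y),
      (ι i a ⊗ₘ ι i b) ≫ f = m k l a b := by
  let c : Cocone (externalProduct (CostructuredArrow.proj H X ⋙ B)
      (CostructuredArrow.proj H Y ⋙ B)) := ⟨Z,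
    { app := fun a ↦ m a.1.left a.2.left a.1.hom a.2.hom
      naturality := fun a b f ↦ by
        have := hm f.1.left f.2.left b.1.hom b.2.hom
        rw [CostructuredArrow.w f.1, CostructuredArrow.w f.2,
          MonoidalCategory.tensorHom_def] at this
        exact this.trans (Category.comp_id _).symm }⟩
  refine ⟨(IsColimit.tensor₂ (hL X) (hL Y)).desc c, fun k l a b ↦ ?_⟩
  have := (IsColimit.tensor₂ (hL X) (hL Y)).fac c (CostructuredArrow.mk a, CostructuredArrow.mk b)
  rw [MonoidalCategory.tensorHom_def]
  exact this

end Hom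

section Monoidal

variable {K : Type u₁} [Category.{v₁} K] [MonoidalCategory K] {F : Type u₂} [Category.{v₂} F]
  [MonoidalCategory F] {C : Type u} [Category.{v} C] [MonoidalCategory C]
  [SymmetricCategory C] [MonoidalClosed C]
  {H : K ⥤ F} {B : K ⥤ C} {L : F ⥤ C} (i : B ⟶ H ⋙ L)
  (hL : (Functor.LeftExtension.mk L i).IsPointwiseLeftKanExtension)

include hL

section

variable [H.OplaxMonoidal] [B.LaxMonoidal]

lemma exists_μ (X Y : F) : ∃ f : L.obj X ⊗ L.obj Y ⟶ L.obj (X ⊗ Y),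
    ∀ (k l : K) (a : H.obj k ⟶ X) (b : H.obj l ⟶ Y),
      (ι i a ⊗ₘ ι i b) ≫ f = μ B k l ≫ ι i (δ H k l ≫ (a ⊗ₘ b)) :=
  exists_tensor_desc i hL _ fun s t a b ↦ by
    rw [← tensorHom_comp_tensorHom, Functor.OplaxMonoidal.δ_natural_assoc, ← map_ι, μ_natural_assoc]

/-- The tensorator of a Kan extension. -/
noncomputable def tensorator (X Y : F) : L.obj X ⊗ L.obj Y ⟶ L.obj (X ⊗ Y) :=
  (exists_μ i hL X Y).choose

lemma ι_tensorator {X Y : F} {k l : K} (a : H.obj k ⟶ X) (b : H.obj l ⟶ Y) :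
    (ι i a ⊗ₘ ι i b) ≫ tensorator i hL X Y = μ B k l ≫ ι i (δ H k l ≫ (a ⊗ₘ b)) :=
  (exists_μ i hL X Y).choose_spec k l a b

lemma comp_ι_tensorator {X Y : F} {k l : K} {A : C} (p : A ⟶ B.obj k) (a : H.obj k ⟶ X)
    (b : H.obj l ⟶ Y) :
    ((p ≫ ι i a) ⊗ₘ ι i b) ≫ tensorator i hL X Y =
      p ▷ B.obj l ≫ μ B k l ≫ ι i (δ H k l ≫ (a ⊗ₘ b)) := by
  rw [← Category.id_comp (ι i b), ← tensorHom_comp_tensorHom, Category.assoc, ι_tensorator,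
    tensorHom_id]

lemma ι_comp_tensorator {X Y : F} {k l : K} {A : C} (p : A ⟶ B.obj l) (a : H.obj k ⟶ X)
    (b : H.obj l ⟶ Y) :
    (ι i a ⊗ₘ (p ≫ ι i b)) ≫ tensorator i hL X Y =
      B.obj k ◁ p ≫ μ B k l ≫ ι i (δ H k l ≫ (a ⊗ₘ b)) := by
  rw [← Category.id_comp (ι i a), ← tensorHom_comp_tensorHom, Category.assoc, ι_tensorator,
    id_tensorHom]

/-- The lax monoidal structure of a Kan extension. -/
@[reducible]
noncomputable def laxMonoidal : L.LaxMonoidal :=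
  .ofTensorHom
    (ε := ε B ≫ ι i (η H))
    (μ := tensorator i hL)
    (μ_natural := fun f g ↦ tensor_hom_ext i hL fun k l a b ↦ by
      rw [tensorHom_comp_tensorHom_assoc, ι_map, ι_map, ι_tensorator, reassoc_of% @ι_tensorator, ι_map,
        Category.assoc, tensorHom_comp_tensorHom])
    (associativity := fun X Y Z ↦ tensor_hom_ext₃ i hL fun k l m a b c ↦ by
      rw [tensorHom_comp_tensorHom_assoc, ι_tensorator, Category.comp_id,
        associator_naturality_assoc, tensorHom_comp_tensorHom_assoc, ι_tensorator,
        Category.comp_id, reassoc_of% @comp_ι_tensorator, ι_comp_tensorator,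
        ← Functor.LaxMonoidal.associativity_assoc, ι_map, map_ι]
      -- Associativity of `B` has been used; what remains is an equality of morphisms in `F`,
      -- supplied by oplax associativity of `H`.
      congr 3
      have := Functor.OplaxMonoidal.associativity H k l m
      rw [← Category.id_comp c, ← tensorHom_comp_tensorHom, Category.id_comp, Category.assoc,
        Category.assoc, associator_naturality, tensorHom_id, reassoc_of% this,
        ← Category.id_comp a, ← tensorHom_comp_tensorHom, Category.id_comp, id_tensorHom])
    (left_unitality := fun X ↦ by
      have h (k : K) (a : H.obj k ⟶ X) : 𝟙_ C ◁ ι i a ≫ (λ_ (L.obj X)).hom =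
          𝟙_ C ◁ ι i a ≫ ((ε B ≫ ι i (η H)) ⊗ₘ 𝟙 (L.obj X)) ≫ tensorator i hL (𝟙_ F) X ≫
            L.map (λ_ X).hom := by
        rw [leftUnitor_naturality, Functor.LaxMonoidal.left_unitality B, ← id_tensorHom,
          tensorHom_comp_tensorHom_assoc, Category.id_comp, Category.comp_id,
          reassoc_of% @comp_ι_tensorator, Category.assoc, Category.assoc, ι_map, map_ι]
        congr 3
        have := Functor.OplaxMonoidal.left_unitality_hom H k
        rw [MonoidalCategory.tensorHom_def, Category.assoc, Category.assoc, leftUnitor_naturality,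
          reassoc_of% this]
      have hL' := isColimitOfPreserves (tensorLeft (𝟙_ C)) (hL X)
      exact hL'.hom_ext fun a ↦ h a.left a.hom)
    (right_unitality := fun X ↦ by
      have h (k : K) (a : H.obj k ⟶ X) : ι i a ▷ 𝟙_ C ≫ (ρ_ (L.obj X)).hom =
          ι i a ▷ 𝟙_ C ≫ (𝟙 (L.obj X) ⊗ₘ (ε B ≫ ι i (η H))) ≫ tensorator i hL X (𝟙_ F) ≫
            L.map (ρ_ X).hom := by
        rw [rightUnitor_naturality, Functor.LaxMonoidal.right_unitality B, ← tensorHom_id,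
          tensorHom_comp_tensorHom_assoc, Category.id_comp, Category.comp_id,
          reassoc_of% @ι_comp_tensorator, Category.assoc, Category.assoc, ι_map, map_ι]
        congr 3
        have := Functor.OplaxMonoidal.right_unitality_hom H k
        rw [MonoidalCategory.tensorHom_def', Category.assoc, Category.assoc, rightUnitor_naturality,
          reassoc_of% this]
      have hL' := isColimitOfPreserves (tensorRight (𝟙_ C)) (hL X)
      exact hL'.hom_ext fun a ↦ h a.left a.hom)

end

section

variable [H.Monoidal] [B.LaxMonoidal]

/-- The unit of a Kan extension is monoidal. -/
lemma isMonoidal_unit :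
    letI := laxMonoidal i hL
    NatTrans.IsMonoidal i :=
  letI := laxMonoidal i hL
  { unit := by
      rw [comp_ε]
      change _ = (ε B ≫ ι i (η H)) ≫ L.map (ε H)
      rw [Category.assoc, ι_map, Functor.Monoidal.η_ε, ι_id]
    tensor := fun k l ↦ by
      rw [comp_μ]
      change _ = _ ≫ tensorator i hL _ _ ≫ L.map (μ H k l)
      rw [← ι_id, ← ι_id, ← ι_id, reassoc_of% @ι_tensorator, ι_map, id_tensorHom_id, Category.comp_id,
        Functor.Monoidal.δ_μ] }

lemma isMonoidal_of_unit {O : F ⥤ C} [O.LaxMonoidal] (σ : L ⟶ O)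
    (hσ : NatTrans.IsMonoidal (i ≫ Functor.whiskerLeft H σ)) :
    letI := laxMonoidal i hL
    NatTrans.IsMonoidal σ :=
  letI := laxMonoidal i hL
  { unit := by
      change (ε B ≫ ι i (η H)) ≫ _ = _
      have := NatTrans.IsMonoidal.unit (τ := i ≫ Functor.whiskerLeft H σ)
      rw [comp_ε, NatTrans.comp_app, Functor.whiskerLeft_app] at this
      rw [ι, Category.assoc, Category.assoc, σ.naturality, reassoc_of% this, ← O.map_comp,
        Functor.Monoidal.ε_η, O.map_id, Category.comp_id]
    tensor := fun X Y ↦ tensor_hom_ext i hL fun k l a b ↦ by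
      change _ ≫ tensorator i hL _ _ ≫ _ = _
      have := NatTrans.IsMonoidal.tensor (τ := i ≫ Functor.whiskerLeft H σ) k l
      rw [comp_μ, NatTrans.comp_app, NatTrans.comp_app, NatTrans.comp_app,
        Functor.whiskerLeft_app, Functor.whiskerLeft_app, Functor.whiskerLeft_app] at this
      have hι {k : K} {X : F} (a : H.obj k ⟶ X) :
          ι i a ≫ σ.app X = (i.app k ≫ σ.app (H.obj k)) ≫ O.map a := by
        rw [ι, Category.assoc, σ.naturality, Category.assoc]
      rw [reassoc_of% @ι_tensorator, hι, Category.assoc (i.app (k ⊗ l)), reassoc_of% this, tensorHom_comp_tensorHom_assoc, hι, hι,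
        ← tensorHom_comp_tensorHom_assoc (i.app k ≫ σ.app (H.obj k)) (i.app l ≫ σ.app (H.obj l)),
        μ_natural, ← O.map_comp,
        Functor.Monoidal.μ_δ_assoc] }

end

/-- The lax symmetric monoidal structure of a Kan extension. -/
@[reducible]
noncomputable def laxBraided [SymmetricCategory K] [SymmetricCategory F] [H.Braided]
    [B.LaxBraided] : L.LaxBraided :=
  letI := laxMonoidal i hL
  { braided := fun X Y ↦ tensor_hom_ext i hL fun k l a b ↦ by
      change _ ≫ tensorator i hL X Y ≫ _ = _ ≫ _ ≫ tensorator i hL Y X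
      rw [reassoc_of% @ι_tensorator, BraidedCategory.braiding_naturality_assoc, ι_tensorator,
        ← Functor.LaxBraided.braided_assoc, ι_map, map_ι]
      congr 2
      rw [Category.assoc, BraidedCategory.braiding_naturality, Functor.map_braiding,
        Category.assoc, Category.assoc, Functor.Monoidal.μ_δ_assoc] }

end Monoidal

end LaxKan

/-! ## Free `F`-Ops -/

section FreeOp

open Functor.LaxMonoidal Functor.OplaxMonoidal

variable {V : Type u₁} [Groupoid.{v₁} V] {F : Type u₂} [Category.{v₂} F]
  [MonoidalCategory F] [SymmetricCategory F] {ι : V ⥤ F}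
  {C : Type u} [Category.{v} C] [MonoidalCategory C] [SymmetricCategory C]

/-- A family of objects of `F` with the same isomorphism classes as the image of `ι`. -/
structure IsGeneratingFamily (ι : V ⥤ F) {T : Type w} (J : Discrete T ⥤ F) : Prop where
  exists_iso (v : V) : ∃ t, Nonempty (J.obj t ≅ ι.obj v)
  exists_iso' (t : Discrete T) : ∃ v, Nonempty (ι.obj v ≅ J.obj t)

namespace FOp

/-- The evaluation of `F`-Ops at a family of objects. -/
abbrev eval {T : Type w} (J : Discrete T ⥤ F) : FOp F C ⥤ VSeq T C :=
  forget F C ⋙ (Functor.whiskeringLeft _ _ C).obj J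

end FOp

/-- A transformation to a lax functor on the free symmetric monoidal category. -/
lemma FreeSymm.exists_lax_extension {G : Type u₁} [Category.{v₁} G] {Φ : G ⥤ C} (J : G ⥤ F)
    (O : F ⥤ C) [O.LaxBraided] (t : Φ ⟶ J ⋙ O) :
    ∃ σ : FreeSymm.lift Φ ⟶ FreeSymm.lift J ⋙ O, NatTrans.IsMonoidal σ ∧
      ∀ x, σ.app ((FreeSymm.incl G).obj x) = t.app x :=
  ⟨FreeSymm.laxExt (N := FreeSymm.lift J ⋙ O) { app := fun x ↦ t.app x
                                                naturality := fun _ _ f ↦ t.naturality f },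
    inferInstance, fun _ ↦ rfl⟩

variable [MonoidalClosed C] [HasColimits C] [LocallySmall.{v} F] {T : Type v} (J : Discrete T ⥤ F)

/-- The lax symmetric monoidal functor freely generated by a family of objects. -/
lemma exists_free_lax (A : Discrete T ⥤ C) :
    ∃ (L : F ⥤ C) (_ : L.LaxBraided) (j : A ⟶ J ⋙ L),
      ∀ (O : F ⥤ C) [O.LaxBraided] (t : A ⟶ J ⋙ O),
        (∃ σ : L ⟶ O, NatTrans.IsMonoidal σ ∧ j ≫ Functor.whiskerLeft J σ = t) ∧
        ∀ σ τ : L ⟶ O, NatTrans.IsMonoidal σ → NatTrans.IsMonoidal τ →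
          j ≫ Functor.whiskerLeft J σ = t → j ≫ Functor.whiskerLeft J τ = t → σ = τ := by
  -- The free lax functor is the left Kan extension along `H` of the strong functor generated by
  -- `A`: monoidal maps out of it are monoidal maps out of `B`, that is, families indexed by `T`.
  let H := FreeSymm.lift J
  let B := FreeSymm.lift A
  have (X : F) : HasColimitsOfShape (CostructuredArrow H X) C :=
    hasColimitsOfShape_of_essentiallySmall.{v} _ _
  let L := H.pointwiseLeftKanExtension B
  let i : B ⟶ H ⋙ L := H.pointwiseLeftKanExtensionUnit B
  have hL : (Functor.LeftExtension.mk L i).IsPointwiseLeftKanExtension :=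
    H.pointwiseLeftKanExtensionIsPointwiseLeftKanExtension B
  have : L.IsLeftKanExtension i := hL.isLeftKanExtension
  let _ : L.LaxBraided := LaxKan.laxBraided i hL
  have hi : NatTrans.IsMonoidal i := LaxKan.isMonoidal_unit i hL
  refine ⟨L, inferInstance, { app := fun t ↦ i.app ((FreeSymm.incl _).obj t)
                              naturality := fun _ _ f ↦ i.naturality ((FreeSymm.incl _).map f) },
    fun O _ t ↦ ⟨?_, fun σ τ _ _ h h' ↦ ?_⟩⟩
  · obtain ⟨p, hp, h⟩ := FreeSymm.exists_lax_extension J O t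
    let σ := L.descOfIsLeftKanExtension i O p
    have hσ : i ≫ Functor.whiskerLeft H σ = p := L.descOfIsLeftKanExtension_fac i O p
    refine ⟨σ, LaxKan.isMonoidal_of_unit i hL σ (hσ ▸ hp), ?_⟩
    ext x
    exact (NatTrans.congr_app hσ _).trans (h x)
  · refine L.hom_ext_of_isLeftKanExtension i _ _ (FreeSymm.monoidal_ext _ _ fun x ↦ ?_)
    exact (NatTrans.congr_app h x).trans (NatTrans.congr_app h' x).symm

variable (hF : IsFeynmanCategory.{w} ι) (hJ : IsGeneratingFamily ι J)

include hF hJ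

/-- The free lax functor `L` turns out to be strong. The generators factor through its strong
coreflection, freeness turns this into a section of the counit, and the two maps are mutually
inverse; the coreflection thus inherits the universal property. -/
theorem FOp.eval_isRightAdjoint : (FOp.eval (C := C) J).IsRightAdjoint := by
  have (A : VSeq T C) : HasInitial (StructuredArrow A (FOp.eval (C := C) J)) := by
    obtain ⟨L, _, j, hj⟩ := exists_free_lax J A
    obtain ⟨S⟩ := hF.nonempty_strongCoreflection L
    have hε (t : Discrete T) : IsIso (S.counit.app (J.obj t)) := by
      obtain ⟨v, ⟨e⟩⟩ := hJ.exists_iso' t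
      have : S.counit.app (J.obj t) =
          S.functor.map e.inv ≫ S.counit.app (ι.obj v) ≫ L.map e.hom := by
        rw [S.counit.naturality_assoc, ← L.map_comp, e.inv_hom_id, L.map_id, Category.comp_id]
      rw [this]
      infer_instance
    let u : A ⟶ J ⋙ S.functor := Discrete.natTrans fun t ↦ j.app t ≫ inv (S.counit.app (J.obj t))
    have hu : u ≫ Functor.whiskerLeft J S.counit = j := by
      ext t
      simp [u]
    obtain ⟨⟨s, _, hs⟩, -⟩ := hj S.functor u
    have h₁ : s ≫ S.counit = 𝟙 L := (hj L j).2 _ _ inferInstance inferInstance (by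
      rw [Functor.whiskerLeft_comp, reassoc_of% hs, hu]) (by simp)
    -- This composite becomes the identity after the counit, which can be cancelled at the vertices.
    have h₂ : S.counit ≫ s = 𝟙 S.functor := hF.monoidal_ext _ _ fun v ↦ by
      rw [← cancel_mono (S.counit.app (ι.obj v)), ← NatTrans.comp_app, ← NatTrans.comp_app,
        Category.assoc, h₁, Category.comp_id, Category.id_comp]
    let O : FOp F C := ⟨S.functor, S.braided⟩
    let X : StructuredArrow A (FOp.eval (C := C) J) := StructuredArrow.mk (Y := O) u
    have hX : IsInitial X := by
      have hex (Y : StructuredArrow A (FOp.eval (C := C) J)) :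
          ∃ f : O ⟶ Y.right, u ≫ (FOp.eval J).map f = Y.hom := by
        obtain ⟨⟨p, _, hp⟩, -⟩ := hj Y.right.functor Y.hom
        refine ⟨⟨S.counit ≫ p, inferInstance⟩, ?_⟩
        change u ≫ Functor.whiskerLeft J (S.counit ≫ p) = _
        rw [Functor.whiskerLeft_comp, reassoc_of% hu, hp]
      choose f hf using hex
      refine IsInitial.ofUniqueHom (fun Y ↦ StructuredArrow.homMk (f Y) (hf Y)) fun Y m ↦ ?_
      ext1
      refine FOp.hom_ext ?_
      have hm : u ≫ (FOp.eval J).map m.right = Y.hom := StructuredArrow.w m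
      have key (g : O ⟶ Y.right) (hg : u ≫ (FOp.eval J).map g = Y.hom) :
          j ≫ Functor.whiskerLeft J (s ≫ g.natTrans) = Y.hom := by
        rw [Functor.whiskerLeft_comp, reassoc_of% hs]
        exact hg
      have h₃ : s ≫ m.right.natTrans = s ≫ (f Y).natTrans :=
        (hj Y.right.functor Y.hom).2 _ _ inferInstance inferInstance (key _ hm) (key _ (hf Y))
      have h₄ := congrArg (S.counit ≫ ·) h₃
      rwa [← Category.assoc, ← Category.assoc, h₂, Category.id_comp, Category.id_comp] at h₄
    exact hX.hasInitial
  exact isRightAdjointOfStructuredArrowInitials _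

end FreeOp

/-! ## Colimits of `F`-Ops -/

section

variable {A : Type u₁} [Category.{v₁} A] {B : Type u₂} [Category.{v₂} B]

/-- The components of the counit are regular epimorphisms if the right adjoint preserves reflexive
coequalizers and reflects isomorphisms. -/
noncomputable def regularEpiCounit {L : B ⥤ A} {G : A ⥤ B} (adj : L ⊣ G)
    [G.ReflectsIsomorphisms] [HasColimitsOfShape WalkingReflexivePair A]
    [PreservesColimitsOfShape WalkingReflexivePair G] (X : A) : RegularEpi (adj.counit.app X) :=
  let f := L.map (G.map (adj.counit.app X))
  let g := adj.counit.app (L.obj (G.obj X))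
  have w : f ≫ adj.counit.app X = g ≫ adj.counit.app X := adj.counit_naturality _
  { W := _
    left := f
    right := g
    w := w
    isColimit := by
      have : HasReflexiveCoequalizers A := hasReflexiveCoequalizers_iff.1 inferInstance
      have : HasCoequalizer f g := inferInstance
      have : PreservesColimit (parallelPair f g) G := preservesColimit_of_iso_diagram G
        (inclusionWalkingReflexivePairOfIsReflexivePairIso f g)
      have := reflectsColimit_of_reflectsIsomorphisms (parallelPair f g) G
      -- As in Beck's theorem, the image under `G` of the canonical fork is split by the unit; `G`
      -- reflects this coequalizer because it preserves it and is conservative.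
      have s : IsSplitCoequalizer (G.map f) (G.map g) (G.map (adj.counit.app X)) :=
        { rightSection := adj.unit.app _
          leftSection := adj.unit.app _
          condition := by rw [← G.map_comp, w, G.map_comp]
          rightSection_π := adj.right_triangle_components _
          leftSection_bottom := adj.right_triangle_components _
          leftSection_top := (adj.unit_naturality _) }
      exact isColimitOfIsColimitCoforkMap G w s.isCoequalizer }

/-- A category over which reflexive coequalizers are created by a monadic functor to a cocomplete
category is cocomplete. -/
lemma hasColimitsOfShape_of_rightAdjoint (G : A ⥤ B) [G.IsRightAdjoint] [G.ReflectsIsomorphisms]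
    [HasColimitsOfShape WalkingReflexivePair A] [PreservesColimitsOfShape WalkingReflexivePair G]
    (K : Type w) [Category.{v} K] [HasColimitsOfShape K B] : HasColimitsOfShape K A := by
  let U := (Functor.whiskeringRight K A B).obj G
  have : HasReflexiveCoequalizers A := hasReflexiveCoequalizers_iff.1 inferInstance
  let adj : _ ⊣ U := (Adjunction.ofIsRightAdjoint G).whiskerRight K
  have : (Functor.const K ⋙ U : A ⥤ _).IsRightAdjoint := by
    have : (G ⋙ Functor.const K).IsRightAdjoint :=
      have := (colimConstAdj (J := K) (C := B)).isRightAdjoint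
      inferInstance
    exact Functor.isRightAdjoint_of_iso (NatIso.ofComponents (fun X ↦ NatIso.ofComponents
      (fun _ ↦ Iso.refl _)) : G ⋙ Functor.const K ≅ Functor.const K ⋙ U)
  -- Adjoint triangle theorem: the composite with `U` has a left adjoint, and the counit of `U`
  -- consists of regular epimorphisms.
  have : (Functor.const K : A ⥤ _).IsRightAdjoint := 
    isRightAdjoint_triangle_lift (Functor.const K) adj (regularEpiCounit adj)
  exact hasColimitsOfShape_iff_isRightAdjoint_const.2 this

end

namespace FOp

variable {V : Type u₁} [Groupoid.{v₁} V] {F : Type u₂} [Category.{v₂} F]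
  [MonoidalCategory F] [SymmetricCategory F] {ι : V ⥤ F}
  {C : Type u} [Category.{v} C] [MonoidalCategory C] [SymmetricCategory C]
  {T : Type w} (J : Discrete T ⥤ F)

section

variable (hF : IsFeynmanCategory.{v} ι) (hJ : IsGeneratingFamily ι J)

include hF hJ

lemma hom_ext_of_isGeneratingFamily {O Q : FOp F C} {f g : O ⟶ Q}
    (h : ∀ t, f.natTrans.app (J.obj t) = g.natTrans.app (J.obj t)) : f = g :=
  hom_ext_of_isFeynmanCategory hF fun v ↦ by
    obtain ⟨t, ⟨e⟩⟩ := hJ.exists_iso v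
    rw [← cancel_epi (O.functor.map e.hom), f.natTrans.naturality, g.natTrans.naturality, h]

lemma eval_faithful : (eval (C := C) J).Faithful where
  map_injective h := hom_ext_of_isGeneratingFamily J hF hJ fun t ↦ NatTrans.congr_app h t

lemma eval_reflectsIsomorphisms : (eval (C := C) J).ReflectsIsomorphisms where
  reflects {O Q} f h := isIso_of_isFeynmanCategory hF f fun v ↦ by
    obtain ⟨t, ⟨e⟩⟩ := hJ.exists_iso v
    have : IsIso (f.natTrans.app (J.obj t)) := inferInstanceAs (IsIso (((eval J).map f).app t))
    have h' : f.natTrans.app (ι.obj v) =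
        O.functor.map e.inv ≫ f.natTrans.app (J.obj t) ≫ Q.functor.map e.hom := by
      rw [f.natTrans.naturality_assoc, ← Q.functor.map_comp, e.inv_hom_id, Q.functor.map_id,
        Category.comp_id]
    rw [h']
    infer_instance

end

lemma eval_preservesSiftedColimits (K : Type u₁) [Category.{v₁} K] [HasColimitsOfShape K C]
    [MonoidalClosed C] [IsSifted K] : PreservesColimitsOfShape K (eval (C := C) J) := by
  have := forget_preservesSiftedColimits (F := F) (C := C) K
  infer_instance

end FOp

namespace FOp

variable {V : Type u₁} [Groupoid.{v₁} V] [EssentiallySmall.{v} V] {F : Type u₂} [Category.{v₂} F]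
  [MonoidalCategory F] [SymmetricCategory F] {ι : V ⥤ F}
  {C : Type u} [Category.{v} C] [MonoidalCategory C] [SymmetricCategory C]
  [MonoidalClosed C] [HasColimits C] {T : Type v} (J : Discrete T ⥤ F)
  (hF : IsFeynmanCategory.{v} ι) (hJ : IsGeneratingFamily ι J)

include hF hJ

theorem hasColimits : HasColimitsOfSize.{v, v} (FOp F C) := by
  have := hF.locallySmall
  have := eval_isRightAdjoint (C := C) J hF hJ
  have := eval_reflectsIsomorphisms (C := C) J hF hJ
  have : HasColimitsOfShape WalkingReflexivePair C :=
    hasColimitsOfShape_of_essentiallySmall.{v} _ _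
  have := eval_preservesSiftedColimits (C := C) J WalkingReflexivePair
  exact ⟨fun K _ ↦ hasColimitsOfShape_of_rightAdjoint (eval J) K⟩

end FOp

/-! ## Small objects and the small object argument -/

section

variable {D : Type u₁} [Category.{v₁} D] {E : Type u₂} [Category.{v₂} E]
  {K : Type w} [SmallCategory K] [IsFiltered K]

/-- `Hom(X, -)` preserves the colimit of `Φ`, in elementary terms. -/
structure IsSmallFor (X : D) (Φ : K ⥤ D) : Prop where
  exists_fac (c : Cocone Φ) (hc : IsColimit c) (f : X ⟶ c.pt) : ∃ (k : K) (g : X ⟶ Φ.obj k),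
    g ≫ c.ι.app k = f
  exists_eq (c : Cocone Φ) (hc : IsColimit c) {k : K} (f g : X ⟶ Φ.obj k)
    (h : f ≫ c.ι.app k = g ≫ c.ι.app k) : ∃ (l : K) (a : k ⟶ l), f ≫ Φ.map a = g ≫ Φ.map a

lemma isSmallFor_of_preservesColimit (X : D) (Φ : K ⥤ D)
    [PreservesColimit Φ (coyoneda.obj (Opposite.op X))] : IsSmallFor X Φ where
  exists_fac c hc f := by
    obtain ⟨k, g, hg⟩ := Types.jointly_surjective_of_isColimit
      (isColimitOfPreserves (coyoneda.obj (Opposite.op X)) hc) f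
    exact ⟨k, g, hg⟩
  exists_eq c hc k f g h :=
    (Types.FilteredColimit.isColimit_eq_iff'
      (isColimitOfPreserves (coyoneda.obj (Opposite.op X)) hc) f g).1 h

lemma IsSmallFor.preservesColimit {X : D} {Φ : K ⥤ D} (h : IsSmallFor X Φ) :
    PreservesColimit Φ (coyoneda.obj (Opposite.op X)) where
  preserves {c} hc := ⟨Types.FilteredColimit.isColimitOf' _ _
    (fun f ↦ by
      obtain ⟨k, g, hg⟩ := h.exists_fac c hc f
      exact ⟨k, g, hg.symm⟩)
    (fun k f g hfg ↦ h.exists_eq c hc f g hfg)⟩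

lemma IsSmallFor.leftAdjoint_obj {L : D ⥤ E} {G : E ⥤ D} (adj : L ⊣ G) {X : D} {Φ : K ⥤ E}
    [PreservesColimit Φ G] (h : IsSmallFor X (Φ ⋙ G)) : IsSmallFor (L.obj X) Φ where
  exists_fac c hc f := by
    obtain ⟨k, g, hg⟩ := h.exists_fac _ (isColimitOfPreserves G hc) (adj.homEquiv _ _ f)
    refine ⟨k, (adj.homEquiv _ _).symm g, ?_⟩
    apply (adj.homEquiv _ _).injective
    rw [adj.homEquiv_naturality_right, Equiv.apply_symm_apply]
    exact hg
  exists_eq c hc k f g hfg := by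
    obtain ⟨l, a, ha⟩ := h.exists_eq _ (isColimitOfPreserves G hc) (adj.homEquiv _ _ f)
      (adj.homEquiv _ _ g) (by
        change _ ≫ G.map _ = _ ≫ G.map _
        rw [← adj.homEquiv_naturality_right, ← adj.homEquiv_naturality_right, hfg])
    refine ⟨l, a, (adj.homEquiv _ _).injective ?_⟩
    rw [adj.homEquiv_naturality_right, adj.homEquiv_naturality_right]
    exact ha

end

/-- There are fewer than `lam` coordinates, so the stages at which they factor have a common upper
bound. -/
lemma exists_fac_of_discrete {C : Type u} [Category.{v} C] {T : Type u₁} {lam : Cardinal.{w}}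
    [Fact lam.IsRegular] (hT : HasCardinalLT T lam) {K : Type w} [SmallCategory K]
    [IsCardinalFiltered K lam] [IsFiltered K] [HasColimitsOfShape K C] (A : VSeq T C)
    (Φ : K ⥤ VSeq T C)
    (h : ∀ t, IsSmallFor (A.obj t) (Φ ⋙ (evaluation _ _).obj t)) (c : Cocone Φ) (hc : IsColimit c)
    (f : A ⟶ c.pt) : ∃ (k : K) (g : A ⟶ Φ.obj k), g ≫ c.ι.app k = f := by
  have h' (t : T) : ∃ (k : K) (g : A.obj ⟨t⟩ ⟶ (Φ.obj k).obj ⟨t⟩),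
      g ≫ (c.ι.app k).app ⟨t⟩ = f.app ⟨t⟩ := (h ⟨t⟩).exists_fac _
    (isColimitOfPreserves ((evaluation _ _).obj _) hc) (f.app ⟨t⟩)
  choose k g hg using h'
  refine ⟨IsCardinalFiltered.max k hT, Discrete.natTrans fun ⟨t⟩ ↦ g t ≫
    (Φ.map (IsCardinalFiltered.toMax k hT t)).app ⟨t⟩, ?_⟩
  ext ⟨t⟩
  have := NatTrans.congr_app (c.w (IsCardinalFiltered.toMax k hT t)) ⟨t⟩
  rw [← hg]
  dsimp at this ⊢
  rw [Category.assoc, this]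
lemma exists_eq_of_discrete {C : Type u} [Category.{v} C] {T : Type u₁} {lam : Cardinal.{w}}
    [Fact lam.IsRegular] (hT : HasCardinalLT T lam) {K : Type w} [SmallCategory K]
    [IsCardinalFiltered K lam] [IsFiltered K] [HasColimitsOfShape K C] (A : VSeq T C)
    (Φ : K ⥤ VSeq T C)
    (h : ∀ t, IsSmallFor (A.obj t) (Φ ⋙ (evaluation _ _).obj t)) (c : Cocone Φ) (hc : IsColimit c)
    {k : K} (f g : A ⟶ Φ.obj k) (hfg : f ≫ c.ι.app k = g ≫ c.ι.app k) :
    ∃ (l : K) (a : k ⟶ l), f ≫ Φ.map a = g ≫ Φ.map a := by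
  have h' (t : T) : ∃ (l : K) (a : k ⟶ l),
      f.app ⟨t⟩ ≫ (Φ.map a).app ⟨t⟩ = g.app ⟨t⟩ ≫ (Φ.map a).app ⟨t⟩ := (h ⟨t⟩).exists_eq _
    (isColimitOfPreserves ((evaluation _ _).obj _) hc) (f.app ⟨t⟩) (g.app ⟨t⟩)
    (NatTrans.congr_app hfg ⟨t⟩)
  choose l a ha using h'
  obtain ⟨m, d, b, hb⟩ := IsCardinalFiltered.wideSpan a hT
  have h₁ (t : T) : f.app ⟨t⟩ ≫ (Φ.map b).app ⟨t⟩ = g.app ⟨t⟩ ≫ (Φ.map b).app ⟨t⟩ := by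
    rw [← hb t, Φ.map_comp, NatTrans.comp_app, reassoc_of% (ha t)]
  exact ⟨m, b, NatTrans.ext (funext fun ⟨t⟩ ↦ h₁ t)⟩

lemma isSmallFor_of_discrete {C : Type u} [Category.{v} C] {T : Type u₁} {lam : Cardinal.{w}}
    [Fact lam.IsRegular] (hT : HasCardinalLT T lam) {K : Type w} [SmallCategory K]
    [IsCardinalFiltered K lam] [IsFiltered K] [HasColimitsOfShape K C] (A : VSeq T C)
    (Φ : K ⥤ VSeq T C)
    (h : ∀ t, IsSmallFor (A.obj t) (Φ ⋙ (evaluation _ _).obj t)) : IsSmallFor A Φ :=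
  ⟨exists_fac_of_discrete hT A Φ h, exists_eq_of_discrete hT A Φ h⟩

lemma isSmallObject_of_discrete {C : Type u} [Category.{v} C] [HasColimitsOfSize.{w, w} C]
    (hC : ∀ X : C, IsSmallObject.{w} X) {T : Type u₁} [Small.{w} T] (A : VSeq T C) :
    IsSmallObject.{w} A := by
  choose κ hκ using hC
  -- The bound must dominate those of all coordinates; passing to its successor makes the
  -- cardinality of `T` strictly less than `lam`.
  let κ' : Cardinal.{w} := max (Cardinal.mk (Shrink.{w} T))
    (iSup fun t : Shrink.{w} T ↦ κ (A.obj ⟨(equivShrink T).symm t⟩))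
  refine ⟨Order.succ κ', fun lam hlam h Φ _ ↦ ?_⟩
  have : Fact lam.IsRegular := ⟨hlam⟩
  have h' : κ' < lam := lt_of_lt_of_le (Order.lt_succ _) h
  have := isFiltered_of_isCardinalFiltered lam.ord.ToType lam
  have hT : HasCardinalLT T lam := by
    rw [hasCardinalLT_iff_of_equiv (equivShrink.{w} T), hasCardinalLT_iff_cardinal_mk_lt]
    exact lt_of_le_of_lt (le_max_left _ _) h'
  refine (isSmallFor_of_discrete hT A Φ fun ⟨t⟩ ↦ ?_).preservesColimit
  have hle : κ (A.obj ⟨t⟩) ≤ lam := by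
    refine le_trans ?_ h'.le
    refine le_trans ?_ (le_max_right _ _)
    have := le_ciSup (f := fun t : Shrink.{w} T ↦ κ (A.obj ⟨(equivShrink T).symm t⟩))
      Cardinal.bddAbove_of_small (equivShrink T t)
    simpa using this
  have := hκ (A.obj ⟨t⟩) lam hlam hle (Φ ⋙ (evaluation _ _).obj ⟨t⟩) inferInstance
  exact isSmallFor_of_preservesColimit _ _

lemma isSmallObject_leftAdjoint_obj {D : Type u₁} [Category.{v₁} D] {E : Type u₂} [Category.{v₂} E]
    {L : D ⥤ E} {G : E ⥤ D} (adj : L ⊣ G)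
    (hG : ∀ (K : Type w) [SmallCategory K] [IsFiltered K], PreservesColimitsOfShape K G)
    {X : D} (hX : IsSmallObject.{w} X) : IsSmallObject.{w} (L.obj X) := by
  obtain ⟨κ, hκ⟩ := hX
  refine ⟨κ, fun lam hlam h Φ _ ↦ ?_⟩
  have : Fact lam.IsRegular := ⟨hlam⟩
  have := isFiltered_of_isCardinalFiltered lam.ord.ToType lam
  -- An initial segment below a limit element is nonempty and totally ordered, hence filtered, so
  -- `G` preserves its colimit and `Φ ⋙ G` is again a continuous sequence.
  have : PreservesWellOrderContinuousOfShape lam.ord.ToType G :=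
    { preservesColimitsOfShape j hj := by
        have : Nonempty (Set.Iio j) := by
          by_contra h
          rw [not_nonempty_iff, Set.isEmpty_coe_sort, Set.Iio_eq_empty_iff] at h
          exact hj.not_isMin h
        exact hG _ }
  have := hG lam.ord.ToType
  have := hκ lam hlam h (Φ ⋙ G) inferInstance
  exact (IsSmallFor.leftAdjoint_obj adj (isSmallFor_of_preservesColimit X (Φ ⋙ G))).preservesColimit

lemma hasSmallObjectArgument_of_isSmallObject {D : Type u} [Category.{v} D] [LocallySmall.{w} D]
    [HasColimitsOfSize.{w, w} D] (I : MorphismProperty D) [MorphismProperty.IsSmall.{w} I]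
    (hI : ∀ ⦃A B : D⦄ (i : A ⟶ B), I i → IsSmallObject.{w} A) :
    MorphismProperty.HasSmallObjectArgument.{w} I := by
  have hI' (i : I.toSet) : IsSmallObject.{w} i.1.left := hI i.1.hom i.2
  choose κ hκ using hI'
  -- One cardinal serves all sources of maps in `I`; the maximum with `aleph0` makes its successor
  -- regular.
  let κ' : Cardinal.{w} := max Cardinal.aleph0
    (iSup fun i : Shrink.{w} I.toSet ↦ κ ((equivShrink _).symm i))
  have : Fact (Order.succ κ').IsRegular := ⟨Cardinal.isRegular_succ (le_max_left _ _)⟩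
  have : Nonempty (Order.succ κ').ord.ToType := by simp
  refine ⟨Order.succ κ', inferInstance, WellFoundedLT.toOrderBot _, ?_⟩
  let := WellFoundedLT.toOrderBot (Order.succ κ').ord.ToType
  have : HasPushouts D := hasColimitsOfShape_of_essentiallySmall.{w} _ _
  have : HasCoproducts.{w} D := fun _ ↦ inferInstance
  exact
    { preservesColimit i hi f hf := by
        refine hκ ⟨Arrow.mk i, hi⟩ _ Fact.out ?_ _ inferInstance
        refine le_trans ?_ (Order.le_succ _)
        refine le_trans ?_ (le_max_right _ _)
        have := le_ciSup (f := fun i : Shrink.{w} I.toSet ↦ κ ((equivShrink _).symm i))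
          Cardinal.bddAbove_of_small (equivShrink _ ⟨Arrow.mk i, hi⟩)
        simpa using this }

namespace CategoryTheory

variable {D : Type u₁} [Category.{v₁} D] {E : Type u₂} [Category.{v₂} E]

instance MorphismProperty.isSmall_strictMap (I : MorphismProperty D)
    [MorphismProperty.IsSmall.{w} I] (L : D ⥤ E) : MorphismProperty.IsSmall.{w} (I.strictMap L) := by
  obtain ⟨α, A, B, f, rfl⟩ := (MorphismProperty.isSmall_iff_eq_ofHoms.{w} I).1 inferInstance
  rw [MorphismProperty.isSmall_iff_eq_ofHoms]
  refine ⟨α, _, _, fun a ↦ L.map (f a), le_antisymm ?_ ?_⟩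
  · rintro _ _ _ ⟨⟨a⟩⟩
    exact ⟨a⟩
  · rintro _ _ _ ⟨a⟩
    exact .map ⟨a⟩

lemma MorphismProperty.rlp_strictMap_iff (I : MorphismProperty D) {L : D ⥤ E} {G : E ⥤ D}
    (adj : L ⊣ G) {X Y : E} (p : X ⟶ Y) : (I.strictMap L).rlp p ↔ I.rlp (G.map p) := by
  constructor
  · intro h A B i hi
    exact (adj.hasLiftingProperty_iff i p).1 (h _ (.map hi))
  · rintro h _ _ _ ⟨hi⟩
    exact (adj.hasLiftingProperty_iff _ p).2 (h _ hi)

end CategoryTheory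

/-! ## Transfer of model structures -/

section

variable {D : Type u₁} [Category.{v₁} D]

lemma isWeakFactorizationSystem_of_hasSmallObjectArgument (I : MorphismProperty D)
    [MorphismProperty.HasSmallObjectArgument.{w} I] :
    MorphismProperty.IsWeakFactorizationSystem I.rlp.llp I.rlp where
  rlp := MorphismProperty.rlp_llp_rlp I
  llp := rfl

namespace IsCofibrantlyGeneratedBy

variable [ModelCategory D] {I J : MorphismProperty D} (h : IsCofibrantlyGeneratedBy.{w} D I J)

include h

lemma hasFunctorialFactorization_cofibrations :
    (cofibrations D).HasFunctorialFactorization (trivialFibrations D) := by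
  have := h.smallObjectArgument_I
  rw [← MorphismProperty.llp_eq_of_wfs (cofibrations D) (trivialFibrations D), ← h.rlp_I]
  infer_instance

lemma hasFunctorialFactorization_trivialCofibrations :
    (trivialCofibrations D).HasFunctorialFactorization (fibrations D) := by
  have := h.smallObjectArgument_J
  rw [← MorphismProperty.llp_eq_of_wfs (trivialCofibrations D) (fibrations D), ← h.rlp_J]
  infer_instance

end IsCofibrantlyGeneratedBy

end

section

variable {D : Type u₁} [Category.{v₁} D] {E : Type u₂} [Category.{v₂} E] [ModelCategory E]
  {L : E ⥤ D} {G : D ⥤ E} (adj : L ⊣ G)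

section

variable [HasColimitsOfSize.{w, w} D] [LocallySmall.{w} D]
  (hG : ∀ (K : Type w) [SmallCategory K] [IsFiltered K], PreservesColimitsOfShape K G)
  (hE : ∀ X : E, IsSmallObject.{w} X)

include adj hG hE

lemma hasSmallObjectArgument_strictMap (I : MorphismProperty E) [MorphismProperty.IsSmall.{w} I] :
    (I.strictMap L).HasSmallObjectArgument.{w} :=
  hasSmallObjectArgument_of_isSmallObject _ (by
    rintro _ _ _ ⟨_⟩
    exact isSmallObject_leftAdjoint_obj adj hG (hE _))

lemma IsCofibrantlyGeneratedBy.strictMap [ModelCategory D]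
    (hweq : ∀ {X Y : D} (f : X ⟶ Y), WeakEquivalence f ↔ WeakEquivalence (G.map f))
    (hfib : ∀ {X Y : D} (f : X ⟶ Y), Fibration f ↔ Fibration (G.map f))
    {I J : MorphismProperty E} (h : IsCofibrantlyGeneratedBy.{w} E I J) :
    IsCofibrantlyGeneratedBy.{w} D (I.strictMap L) (J.strictMap L) := by
  have := h.isSmall_I
  have := h.isSmall_J
  exact
    { isSmall_I := inferInstance
      isSmall_J := inferInstance
      smallObjectArgument_I := hasSmallObjectArgument_strictMap adj hG hE I
      smallObjectArgument_J := hasSmallObjectArgument_strictMap adj hG hE J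
      rlp_I := by
        ext X Y f
        rw [MorphismProperty.rlp_strictMap_iff _ adj, h.rlp_I, mem_trivialFibrations_iff,
          mem_trivialFibrations_iff, hweq, hfib]
      rlp_J := by
        ext X Y f
        rw [MorphismProperty.rlp_strictMap_iff _ adj, h.rlp_J, ← fibration_iff, ← fibration_iff,
          hfib] }

/-- Transfer of a cofibrantly generated model structure along a right adjoint: it suffices that
the maps with the left lifting property with respect to the fibrations are weak equivalences. -/
theorem exists_modelCategory_of_adjunction [HasFiniteLimits D]
    {I J : MorphismProperty E} (h : IsCofibrantlyGeneratedBy.{w} E I J)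
    (hacyclic : ∀ {X Y : D} (f : X ⟶ Y), ((fibrations E).inverseImage G).llp f →
      WeakEquivalence (G.map f)) :
    ∃ _ : ModelCategory D,
      (∀ {X Y : D} (f : X ⟶ Y), WeakEquivalence f ↔ WeakEquivalence (G.map f)) ∧
      (∀ {X Y : D} (f : X ⟶ Y), Fibration f ↔ Fibration (G.map f)) := by
  have := h.isSmall_I
  have := h.isSmall_J
  have := hasSmallObjectArgument_strictMap adj hG hE I
  have := hasSmallObjectArgument_strictMap adj hG hE J
  let _ : CategoryWithFibrations D := ⟨(fibrations E).inverseImage G⟩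
  let _ : CategoryWithWeakEquivalences D := ⟨(weakEquivalences E).inverseImage G⟩
  let _ : CategoryWithCofibrations D := ⟨(trivialFibrations D).llp⟩
  have hI : (I.strictMap L).rlp = trivialFibrations D := by
    ext X Y f
    rw [MorphismProperty.rlp_strictMap_iff _ adj, h.rlp_I]
    rfl
  have hJ : (J.strictMap L).rlp = fibrations D := by
    ext X Y f
    rw [MorphismProperty.rlp_strictMap_iff _ adj, h.rlp_J]
    rfl
  have : (weakEquivalences D).HasTwoOutOfThreeProperty :=
    inferInstanceAs ((weakEquivalences E).inverseImage G).HasTwoOutOfThreeProperty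
  have : HasFiniteColimits D := hasFiniteColimits_of_hasColimitsOfSize.{w, w} D
  have wI := isWeakFactorizationSystem_of_hasSmallObjectArgument.{w} (I.strictMap L)
  have wJ := isWeakFactorizationSystem_of_hasSmallObjectArgument.{w} (J.strictMap L)
  rw [hI] at wI
  rw [hJ] at wJ
  have : MorphismProperty.IsWeakFactorizationSystem (cofibrations D) (trivialFibrations D) := wI
  have htriv : (fibrations D).llp = trivialCofibrations D := by
    ext X Y f
    constructor
    · intro hf
      exact ⟨fun _ _ p hp ↦ hf p hp.1, (hacyclic f hf).mem⟩
    · rintro ⟨hf, hf'⟩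
      -- Retract argument: by two-out-of-three the second factor is a trivial fibration, so `f`
      -- lifts against it and is a retract of the first factor.
      let d := MorphismProperty.factorizationData (fibrations D).llp (fibrations D) f
      have hi : weakEquivalences D d.i := (hacyclic d.i d.hi).mem
      have hp : trivialFibrations D d.p := by
        refine ⟨d.hp, (weakEquivalences D).of_precomp d.i d.p hi ?_⟩
        rwa [d.fac]
      have : HasLiftingProperty f d.p := hf _ hp
      exact MorphismProperty.of_retract (RetractArrow.ofLeftLiftingProperty d.fac) d.hi
  rw [htriv] at wJ
  exact ⟨ModelCategory.mk' D,
    fun f ↦ ⟨fun hf ↦ ⟨hf.mem⟩, fun hf ↦ ⟨hf.mem⟩⟩, fun f ↦ ⟨fun hf ↦ ⟨hf.mem⟩, fun hf ↦ ⟨hf.mem⟩⟩⟩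

end

end

/-! ## Cofibrant generation of the category of sequences -/

namespace VSeq

variable {C : Type u} [Category.{v} C] {T : Type u₁}

instance locallySmall [Small.{w} T] [LocallySmall.{w} C] : LocallySmall.{w} (VSeq T C) where
  hom_small A B := small_of_injective
    (f := fun (f : A ⟶ B) (t : T) ↦ (f.app ⟨t⟩ : A.obj ⟨t⟩ ⟶ B.obj ⟨t⟩))
    fun _ _ h ↦ NatTrans.ext (funext fun ⟨t⟩ ↦ congrFun h t)

lemma hasCoproductsOfShape_hom [HasColimitsOfSize.{w, w} C] (a b : Discrete T) :
    HasCoproductsOfShape (a ⟶ b) C :=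
  hasColimitsOfShape_of_equivalence (Discrete.equivalence (equivShrink.{w} (a ⟶ b))).symm

lemma rlp_iSup_strictMap_iff [∀ a b : Discrete T, HasCoproductsOfShape (a ⟶ b) C]
    (K : MorphismProperty C) {X Y : VSeq T C} (f : X ⟶ Y) :
    (⨆ t, K.strictMap (evaluationLeftAdjoint C t) : MorphismProperty (VSeq T C)).rlp f ↔
      ∀ t, K.rlp (f.app t) := by
  have h (t) := K.rlp_strictMap_iff (evaluationAdjunctionRight C t) f
  constructor
  · intro hf t
    exact (h t).1 fun _ _ i hi ↦ hf i ((MorphismProperty.iSup_iff _ _).2 ⟨t, hi⟩)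
  · intro hf _ _ i hi
    obtain ⟨t, hi⟩ := (MorphismProperty.iSup_iff _ _).1 hi
    exact (h t).2 (hf t) i hi

/-- The generators are those of `C` pushed forward by the left adjoints of the evaluations, so that
lifting against them is a coordinatewise condition. -/
theorem isCofibrantlyGenerated [Small.{w} T] [ModelCategory C] [HasColimitsOfSize.{w, w} C]
    [LocallySmall.{w} C] (hC : IsCofibrantlyGenerated.{w} C)
    (hsmall : ∀ X : C, IsSmallObject.{w} X) : IsCofibrantlyGenerated.{w} (VSeq T C) := by
  obtain ⟨I, J, h⟩ := hC
  have := h.isSmall_I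
  have := h.isSmall_J
  have (a b : Discrete T) : HasCoproductsOfShape (a ⟶ b) C := hasCoproductsOfShape_hom.{w} a b
  have hsmall' (X : VSeq T C) : IsSmallObject.{w} X := isSmallObject_of_discrete hsmall X
  refine ⟨⨆ t, I.strictMap (evaluationLeftAdjoint C t),
    ⨆ t, J.strictMap (evaluationLeftAdjoint C t), inferInstance, inferInstance,
    hasSmallObjectArgument_of_isSmallObject _ fun A _ _ _ ↦ hsmall' A,
    hasSmallObjectArgument_of_isSmallObject _ fun A _ _ _ ↦ hsmall' A, ?_, ?_⟩
  · ext X Y f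
    rw [rlp_iSup_strictMap_iff, h.rlp_I]
    exact forall_and
  · ext X Y f
    rw [rlp_iSup_strictMap_iff, h.rlp_J]
    rfl

end VSeq

/-! ## Weak equivalences are the maps which become invertible in the homotopy category -/

section

variable {C : Type u} [Category.{v} C] [ModelCategory C] {H : Type u₁} [Category.{v₁} H] (L : C ⥤ H)
  [L.IsLocalization (weakEquivalences C)]

lemma isIso_map_of_weakEquivalence {X Y : C} (f : X ⟶ Y) [WeakEquivalence f] : IsIso (L.map f) :=
  Localization.inverts L (weakEquivalences C) f (mem_weakEquivalences f)

/-- Between bifibrant objects the inverse is represented by a map. Homotopy lifting along `p`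
corrects it to a strict section `g'`; then `p ≫ g'` is homotopic to the identity, and `p` is a
retract of it. -/
lemma weakEquivalence_of_isIso_map_of_fibration {X Y : C} [IsCofibrant X] [IsFibrant X]
    [IsCofibrant Y] [IsFibrant Y] (p : X ⟶ Y) [Fibration p] [IsIso (L.map p)] :
    WeakEquivalence p := by
  obtain ⟨g, hg⟩ := map_surjective_of_isLocalization L Y X (inv (L.map p))
  have h₁ : LeftHomotopyRel (g ≫ p) (𝟙 Y) := by
    rw [LeftHomotopyRel.iff_map_eq L, L.map_comp, hg, IsIso.inv_hom_id, L.map_id]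
  obtain ⟨Q, _, ⟨h⟩⟩ := h₁.exists_good_cylinder
  -- The end `i₀` of a good cylinder on a cofibrant object is a trivial cofibration, so the homotopy
  -- lifts starting at `g`; its other end is a strict section.
  have sq : CommSq g Q.i₀ p h.h := ⟨h.h₀.symm⟩
  let g' := Q.i₁ ≫ sq.lift
  have hg' : g' ≫ p = 𝟙 Y := by
    rw [Category.assoc, sq.fac_right, h.h₁]
  have h₂ : RightHomotopyRel (p ≫ g') (𝟙 X) := by
    rw [RightHomotopyRel.iff_map_eq L, ← cancel_mono (L.map p), ← L.map_comp, Category.assoc, hg',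
      Category.comp_id, L.map_id, Category.id_comp]
  obtain ⟨P, ⟨h'⟩⟩ := h₂
  have h₃ : WeakEquivalence (p ≫ g') := h'.weakEquivalence_iff.2 inferInstance
  have r : RetractArrow p (p ≫ g') :=
    { i := Arrow.homMk (𝟙 _) g'
      r := Arrow.homMk (𝟙 _) p (by simp [hg'])
      retract := by
        ext
        · simp
        · simpa using hg' }
  rw [weakEquivalence_iff] at h₃ ⊢
  exact MorphismProperty.of_retract r h₃

/-- Fibrant and cofibrant replacement, followed by splitting off a trivial cofibration, reduces to a
fibration between bifibrant objects. -/
theorem weakEquivalence_of_isIso_map {X Y : C} (f : X ⟶ Y) [IsIso (L.map f)] :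
    WeakEquivalence f := by
  obtain ⟨X', _, q, _, _⟩ := CofibrantObject.HoCat.exists_resolution X
  obtain ⟨Y₁, _, j, _, _⟩ := FibrantObject.HoCat.exists_resolution Y
  obtain ⟨Y₂, _, r, _, _⟩ := CofibrantObject.HoCat.exists_resolution Y₁
  have : IsFibrant Y₂ := isFibrant_of_fibration r
  have sq : CommSq (initial.to Y₂) (initial.to X') r (q ≫ f ≫ j) := ⟨by simp⟩
  let d := MorphismProperty.factorizationData (trivialCofibrations C) (fibrations C) sq.lift
  have hd : (d.i ≫ d.p) ≫ r = (q ≫ f) ≫ j := by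
    rw [d.fac, sq.fac_right, Category.assoc]
  have : IsCofibrant d.Z := isCofibrant_of_cofibration d.i
  have : IsFibrant d.Z := isFibrant_of_fibration d.p
  have hX := isIso_map_of_weakEquivalence L q
  have hY := isIso_map_of_weakEquivalence L j
  have hi := isIso_map_of_weakEquivalence L d.i
  have hr := isIso_map_of_weakEquivalence L r
  have hp : IsIso (L.map d.p) := by
    have h := congrArg L.map hd
    simp only [L.map_comp, Category.assoc] at h
    have h' : IsIso (L.map d.i ≫ L.map d.p ≫ L.map r) := by
      rw [h]
      infer_instance
    rwa [isIso_comp_left_iff, isIso_comp_right_iff] at h'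
  have := weakEquivalence_of_isIso_map_of_fibration L d.p
  have : WeakEquivalence ((q ≫ f) ≫ j) := hd ▸ inferInstance
  rwa [weakEquivalence_postcomp_iff, weakEquivalence_precomp_iff] at this

/-- If `f ≫ g` is a weak equivalence and `g ≫ h` is connected to a weak equivalence by a path,
then `f` is a weak equivalence. -/
lemma weakEquivalence_of_path {A B A' B' P : C} {f : A ⟶ B} {g : B ⟶ A'} {h : A' ⟶ B'}
    {k : B ⟶ B'} (hfg : WeakEquivalence (f ≫ g)) (hk : WeakEquivalence k) (i : B' ⟶ P)
    [WeakEquivalence i] {p₀ p₁ : P ⟶ B'} (h₀ : i ≫ p₀ = 𝟙 _) (h₁ : i ≫ p₁ = 𝟙 _) (l : B ⟶ P)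
    (hl₀ : l ≫ p₀ = g ≫ h) (hl₁ : l ≫ p₁ = k) : WeakEquivalence f := by
  let L := (weakEquivalences C).Q
  have hi := isIso_map_of_weakEquivalence L i
  have h₂ : L.map p₀ = L.map p₁ := by
    rw [← cancel_epi (L.map i), ← L.map_comp, ← L.map_comp, h₀, h₁]
  have h₃ : IsIso (L.map g ≫ L.map h) := by
    rw [← L.map_comp, ← hl₀, L.map_comp, h₂, ← L.map_comp, hl₁]
    exact isIso_map_of_weakEquivalence L k
  have h₄ : IsIso (L.map f ≫ L.map g) := by
    rw [← L.map_comp]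
    exact isIso_map_of_weakEquivalence L _
  -- Two-out-of-six in the homotopy category: `g` has inverses on both sides, so `f` becomes
  -- invertible as well.
  have : IsSplitMono (L.map g) := ⟨⟨L.map h ≫ inv (L.map g ≫ L.map h), by
    rw [← Category.assoc, IsIso.hom_inv_id]⟩⟩
  have : IsSplitEpi (L.map g) := ⟨⟨inv (L.map f ≫ L.map g) ≫ L.map f, by
    rw [Category.assoc, IsIso.inv_hom_id]⟩⟩
  have : IsIso (L.map g) := isIso_of_mono_of_isSplitEpi _
  have : IsIso (L.map f) := (isIso_comp_right_iff _ (L.map g)).1 h₄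
  exact weakEquivalence_of_isIso_map L f

end

/-! ## The path object argument -/

section

variable {D : Type u₁} [Category.{v₁} D] {C : Type u} [Category.{v} C] [ModelCategory C]

/-- Suppose that `f` has the left lifting property with respect to the maps which become fibrations
under all functors `E v`. If the source and the target of `f` have functorial fibrant replacements
and the fibrant replacement of the target has a path object, then `f` becomes a weak equivalence
under all functors `E v`. -/
theorem weakEquivalence_map_of_pathObject [HasTerminal D] [HasBinaryProducts D] {V : Type w}
    (E : V → D ⥤ C) [∀ v, PreservesLimit (Functor.empty.{0} D) (E v)]
    [∀ v, PreservesLimitsOfShape (Discrete WalkingPair) (E v)] {O Q : D} (f : O ⟶ Q)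
    (hf : ∀ {A B : D} (p : A ⟶ B), (∀ v, Fibration ((E v).map p)) → HasLiftingProperty f p)
    {RO RQ PQ : D} (rO : O ⟶ RO) (rQ : Q ⟶ RQ) (Rf : RO ⟶ RQ) (hRf : f ≫ rQ = rO ≫ Rf)
    (hrO : ∀ v, WeakEquivalence ((E v).map rO)) (hrQ : ∀ v, WeakEquivalence ((E v).map rQ))
    (hRO : ∀ v, IsFibrant ((E v).obj RO)) (i : RQ ⟶ PQ) (p₀ p₁ : PQ ⟶ RQ) (h₀ : i ≫ p₀ = 𝟙 _)
    (h₁ : i ≫ p₁ = 𝟙 _) (hi : ∀ v, WeakEquivalence ((E v).map i))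
    (hp : ∀ v, Fibration (prod.lift ((E v).map p₀) ((E v).map p₁))) (v : V) :
    WeakEquivalence ((E v).map f) := by
  have hRO' (v : V) : Fibration ((E v).map (terminal.from RO)) :=
    (isFibrant_iff_of_isTerminal _ (IsTerminal.isTerminalObj (E v) _ terminalIsTerminal)).1 (hRO v)
  have hp' (v : V) : Fibration ((E v).map (prod.lift p₀ p₁)) := by
    have h : (E v).map (prod.lift p₀ p₁) ≫ prodComparison (E v) RQ RQ =
        prod.lift ((E v).map p₀) ((E v).map p₁) := by
      apply prod.hom_ext
      · rw [Category.assoc, prodComparison_fst, ← (E v).map_comp, prod.lift_fst, prod.lift_fst]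
      · rw [Category.assoc, prodComparison_snd, ← (E v).map_comp, prod.lift_snd, prod.lift_snd]
    have h' := hp v
    rw [← h] at h'
    rw [fibration_iff] at h' ⊢
    exact ((fibrations C).cancel_right_of_respectsIso _ _).1 h'
  have := hf _ hRO'
  have := hf _ hp'
  -- As `RO` is fibrant, `rO` extends along `f` to a candidate homotopy inverse from `Q` to `RO`.
  have sq : CommSq rO f (terminal.from RO) (terminal.from Q) := ⟨by simp⟩
  -- Lifting against the path fibration extends the constant homotopy on `O` to a homotopy between
  -- `sq.lift ≫ Rf` and `rQ`.
  have sq' : CommSq (rO ≫ Rf ≫ i) f (prod.lift p₀ p₁) (prod.lift (sq.lift ≫ Rf) rQ) :=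
    ⟨by
      apply prod.hom_ext
      · simp only [Category.assoc, prod.lift_fst, h₀, Category.comp_id, sq.fac_left_assoc]
      · simp only [Category.assoc, prod.lift_snd, h₁, Category.comp_id, hRf]⟩
  have hl₀ : sq'.lift ≫ p₀ = sq.lift ≫ Rf := by
    have := sq'.fac_right =≫ prod.fst
    rwa [Category.assoc, prod.lift_fst, prod.lift_fst] at this
  have hl₁ : sq'.lift ≫ p₁ = rQ := by
    have := sq'.fac_right =≫ prod.snd
    rwa [Category.assoc, prod.lift_snd, prod.lift_snd] at this
  have := hi v
  refine weakEquivalence_of_path (f := (E v).map f) (g := (E v).map sq.lift) (h := (E v).map Rf)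
    (k := (E v).map rQ) ?_ (hrQ v) ((E v).map i) (p₀ := (E v).map p₀) (p₁ := (E v).map p₁)
    ?_ ?_ ((E v).map sq'.lift) ?_ ?_
  · rw [← Functor.map_comp, sq.fac_left]
    exact hrO v
  · rw [← Functor.map_comp, h₀, (E v).map_id]
  · rw [← Functor.map_comp, h₁, (E v).map_id]
  · rw [← Functor.map_comp, hl₀, Functor.map_comp]
  · rw [← Functor.map_comp, hl₁]

end

/-! ### Fibrant replacements and path objects of `F`-Ops -/

section

variable {F : Type u₂} [Category.{v₂} F] [MonoidalCategory F] [SymmetricCategory F]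
  {C : Type u} [Category.{v} C] [MonoidalCategory C] [SymmetricCategory C]

section

variable (P : ObjectProperty C) [P.IsMonoidal] (A : F ⥤ C) [A.LaxBraided] (hA : ∀ X, P (A.obj X))

open Functor.LaxMonoidal in
instance liftLaxBraided : (P.lift A hA).LaxBraided where
  ε := P.homMk (ε A)
  μ X Y := P.homMk (μ A X Y)
  μ_natural_left f X := P.hom_ext (μ_natural_left A f X)
  μ_natural_right X f := P.hom_ext (μ_natural_right A X f)
  associativity X Y Z := P.hom_ext (Functor.LaxMonoidal.associativity A X Y Z)
  left_unitality X := P.hom_ext (Functor.LaxMonoidal.left_unitality A X)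
  right_unitality X := P.hom_ext (Functor.LaxMonoidal.right_unitality A X)
  braided X Y := P.hom_ext (Functor.LaxBraided.braided X Y)

-- A restriction of `φ` along the corestriction of `A`, with source written as `A` itself; the proof
-- discards the identities in the monoidal structure of the composite.
open Functor.LaxMonoidal in
lemma exists_liftTransformation {B : P.FullSubcategory ⥤ C} [B.LaxBraided] (φ : P.ι ⟶ B)
    [NatTrans.IsMonoidal φ] : ∃ t : A ⟶ P.lift A hA ⋙ B, NatTrans.IsMonoidal t ∧
      ∀ X, t.app X = φ.app ⟨A.obj X, hA X⟩ := by
  refine ⟨{ app X := φ.app ⟨A.obj X, hA X⟩, naturality _ _ f := φ.naturality ((P.lift A hA).map f) },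
    { unit := ?_, tensor X Y := ?_ }, fun _ ↦ rfl⟩
  · have h := φ.naturality (ε (P.lift A hA))
    have h' := NatTrans.IsMonoidal.unit (τ := φ)
    change P.ι.map (ε (P.lift A hA)) ≫ φ.app _ = ε B ≫ B.map (ε (P.lift A hA))
    rw [h, ← h']
    exact congrArg (· ≫ _) (Category.id_comp _).symm
  · have h := φ.naturality (μ (P.lift A hA) X Y)
    have h' := NatTrans.IsMonoidal.tensor (τ := φ) ((P.lift A hA).obj X) ((P.lift A hA).obj Y)
    change P.ι.map (μ (P.lift A hA) X Y) ≫ φ.app _ =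
      (φ.app ((P.lift A hA).obj X) ⊗ₘ φ.app ((P.lift A hA).obj Y)) ≫ μ B _ _ ≫
        B.map (μ (P.lift A hA) X Y)
    rw [h, ← Category.assoc, ← h']
    exact congrArg (· ≫ _) (Category.id_comp _).symm

open Functor.LaxMonoidal in
lemma exists_liftTransformation' {B : P.FullSubcategory ⥤ C} [B.LaxBraided] (ψ : B ⟶ P.ι)
    [NatTrans.IsMonoidal ψ] : ∃ t : P.lift A hA ⋙ B ⟶ A, NatTrans.IsMonoidal t ∧
      ∀ X, t.app X = ψ.app ⟨A.obj X, hA X⟩ := by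
  refine ⟨{ app X := ψ.app ⟨A.obj X, hA X⟩, naturality _ _ f := ψ.naturality ((P.lift A hA).map f) },
    { unit := ?_, tensor X Y := ?_ }, fun _ ↦ rfl⟩
  · have h := ψ.naturality (ε (P.lift A hA))
    have h' := NatTrans.IsMonoidal.unit (τ := ψ)
    change (ε B ≫ B.map (ε (P.lift A hA))) ≫ ψ.app _ = P.ι.map (ε (P.lift A hA))
    rw [Category.assoc, h, ← Category.assoc, h']
    exact Category.id_comp _
  · have h := ψ.naturality (μ (P.lift A hA) X Y)
    have h' := NatTrans.IsMonoidal.tensor (τ := ψ) ((P.lift A hA).obj X) ((P.lift A hA).obj Y)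
    change (μ B _ _ ≫ B.map (μ (P.lift A hA) X Y)) ≫ ψ.app _ =
      (ψ.app ((P.lift A hA).obj X) ⊗ₘ ψ.app ((P.lift A hA).obj Y)) ≫ P.ι.map (μ (P.lift A hA) X Y)
    rw [Category.assoc, h, ← Category.assoc, h', Category.assoc]
    exact congrArg (_ ≫ ·) (Category.id_comp _)

end

open Functor.LaxMonoidal in
lemma exists_whiskerTransformation (A : F ⥤ C) [A.LaxBraided] {R : C ⥤ C} [R.LaxBraided]
    (j : 𝟭 C ⟶ R) [NatTrans.IsMonoidal j] : ∃ t : A ⟶ A ⋙ R, NatTrans.IsMonoidal t ∧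
      ∀ X, t.app X = j.app (A.obj X) := by
  refine ⟨{ app X := j.app (A.obj X), naturality _ _ f := j.naturality (A.map f) },
    { unit := ?_, tensor X Y := ?_ }, fun _ ↦ rfl⟩
  · have h' := NatTrans.IsMonoidal.unit (τ := j)
    change ε A ≫ j.app _ = ε R ≫ R.map (ε A)
    rw [← h']
    exact (j.naturality (ε A)).trans (congrArg (· ≫ _) (Category.id_comp _).symm)
  · have h' := NatTrans.IsMonoidal.tensor (τ := j) (A.obj X) (A.obj Y)
    change μ A X Y ≫ j.app _ = (j.app _ ⊗ₘ j.app _) ≫ μ R _ _ ≫ R.map (μ A X Y)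
    rw [← Category.assoc, ← h']
    exact (j.naturality (μ A X Y)).trans (congrArg (· ≫ _) (Category.id_comp _).symm)

/-- The projections from `squareFunctor C`. -/
noncomputable def squareFst [HasBinaryProducts C] : squareFunctor C ⟶ 𝟭 C where
  app _ := prod.fst
  naturality _ _ _ := prod.map_fst _ _

/-- The projections from `squareFunctor C`. -/
noncomputable def squareSnd [HasBinaryProducts C] : squareFunctor C ⟶ 𝟭 C where
  app _ := prod.snd
  naturality _ _ _ := prod.map_snd _ _

instance [HasBinaryProducts C] : NatTrans.IsMonoidal (squareFst (C := C)) where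
  unit := prod.lift_fst _ _
  tensor _ _ := (prod.lift_fst _ _).trans (Category.comp_id _).symm

instance [HasBinaryProducts C] : NatTrans.IsMonoidal (squareSnd (C := C)) where
  unit := prod.lift_snd _ _
  tensor _ _ := (prod.lift_snd _ _).trans (Category.comp_id _).symm

namespace StrongCoreflection

variable {V : Type u₁} [Groupoid.{v₁} V] {ι : V ⥤ F} {A : F ⥤ C} [A.LaxBraided]
  (S : StrongCoreflection ι A)

/-- The strong coreflection as an `F`-Op. -/
abbrev toFOp : FOp F C := ⟨S.functor, S.braided⟩

lemma exists_hom (O : FOp F C) (t : O.functor ⟶ A) [NatTrans.IsMonoidal t] :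
    ∃ s : O ⟶ S.toFOp, s.natTrans ≫ S.counit = t := by
  obtain ⟨s, hs, h⟩ := S.exists_lift O.functor t
  exact ⟨⟨s, hs⟩, h⟩

lemma hom_ext (hF : IsFeynmanCategory.{w} ι) {O : FOp F C} {s t : O ⟶ S.toFOp}
    (h : s.natTrans ≫ S.counit = t.natTrans ≫ S.counit) : s = t :=
  FOp.hom_ext_of_isFeynmanCategory hF fun v ↦ by
    rw [← cancel_mono (S.counit.app (ι.obj v))]
    exact NatTrans.congr_app h _

end StrongCoreflection

attribute [instance] MonoidalFibrantReplacement.laxBraided MonoidalFibrantReplacement.isMonoidal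
  CoherentPathObjects.laxBraided CoherentPathObjects.isMonoidal_φ CoherentPathObjects.isMonoidal_ψ

namespace FOp

variable {V : Type u₁} [Groupoid.{v₁} V] {ι : V ⥤ F} (hF : IsFeynmanCategory.{w} ι)
  [ModelCategory C]

include hF

/-- The replacements are the strong coreflections of `O ⋙ R` and `Q ⋙ R`, whose values at vertices
are unchanged up to isomorphism. The last clause allows `P` to be applied to `RQ`. -/
lemma exists_fibrantReplacement (R : MonoidalFibrantReplacement C) {O Q : FOp F C} (f : O ⟶ Q) :
    ∃ (RO RQ : FOp F C) (rO : O ⟶ RO) (rQ : Q ⟶ RQ) (Rf : RO ⟶ RQ), f ≫ rQ = rO ≫ Rf ∧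
      (∀ v, WeakEquivalence (rO.natTrans.app (ι.obj v))) ∧
      (∀ v, WeakEquivalence (rQ.natTrans.app (ι.obj v))) ∧
      (∀ v, IsFibrant (RO.functor.obj (ι.obj v))) ∧
      (∀ v, IsFibrant (RQ.functor.obj (ι.obj v))) ∧
      ∀ X, fibrantTensors C (RQ.functor.obj X) := by
  obtain ⟨S⟩ := hF.nonempty_strongCoreflection (O.functor ⋙ R.R)
  obtain ⟨S'⟩ := hF.nonempty_strongCoreflection (Q.functor ⋙ R.R)
  have ht (A : FOp F C) := exists_whiskerTransformation A.functor R.j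
  choose t ht' ht using ht
  obtain ⟨rO, hrO⟩ := S.exists_hom O (t O)
  obtain ⟨rQ, hrQ⟩ := S'.exists_hom Q (t Q)
  obtain ⟨Rf, hRf⟩ := S'.exists_hom S.toFOp (S.counit ≫ Functor.whiskerRight f.natTrans R.R)
  have hfib (A : FOp F C) (S : StrongCoreflection ι (A.functor ⋙ R.R)) (v : V) :
      IsFibrant (S.functor.obj (ι.obj v)) := by
    have : IsFibrant ((A.functor ⋙ R.R).obj (ι.obj v)) := R.isFibrant (A.functor.obj (ι.obj v))
    exact isFibrant_of_fibration (S.counit.app (ι.obj v))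
  have hweq (A : FOp F C) (S : StrongCoreflection ι (A.functor ⋙ R.R)) (r : A ⟶ S.toFOp)
      (hr : r.natTrans ≫ S.counit = t A) (v : V) : WeakEquivalence (r.natTrans.app (ι.obj v)) := by
    have h := R.weakEquivalence (A.functor.obj (ι.obj v))
    rw [← ht, ← hr, NatTrans.comp_app] at h
    exact weakEquivalence_of_postcomp _ (S.counit.app (ι.obj v))
  refine ⟨S.toFOp, S'.toFOp, rO, rQ, Rf, S'.hom_ext hF ?_, hweq O S rO hrO, hweq Q S' rQ hrQ,
    hfib O S, hfib Q S', fun X ↦ S'.mem _ (fun v ↦ .of _ (R.isFibrant _)) X⟩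
  change (f.natTrans ≫ rQ.natTrans) ≫ S'.counit = (rO.natTrans ≫ Rf.natTrans) ≫ S'.counit
  rw [Category.assoc, hrQ, Category.assoc, hRf, reassoc_of% hrO]
  ext X
  rw [NatTrans.comp_app, NatTrans.comp_app, ht, ht, Functor.whiskerRight_app]
  exact (R.j.naturality _)

/-- The path object is the strong coreflection of `A` followed by `P`. At a vertex the counit
identifies its two structure maps with those of the path object in `C`. -/
lemma exists_pathObject (P : CoherentPathObjects C) (A : FOp F C)
    (hA : ∀ v, IsFibrant (A.functor.obj (ι.obj v)))
    (hA' : ∀ X, fibrantTensors C (A.functor.obj X)) :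
    ∃ (PA : FOp F C) (i : A ⟶ PA) (p₀ p₁ : PA ⟶ A), i ≫ p₀ = 𝟙 _ ∧ i ≫ p₁ = 𝟙 _ ∧
      (∀ v, WeakEquivalence (i.natTrans.app (ι.obj v))) ∧
      ∀ v, Fibration (prod.lift (p₀.natTrans.app (ι.obj v)) (p₁.natTrans.app (ι.obj v))) := by
  let A' := (fibrantTensors C).lift A.functor hA'
  obtain ⟨S⟩ := hF.nonempty_strongCoreflection (A' ⋙ P.P)
  obtain ⟨t, _, ht⟩ := exists_liftTransformation _ A.functor hA' P.φ
  obtain ⟨i, hi⟩ := S.exists_hom A t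
  obtain ⟨q₀, _, hq₀⟩ : ∃ q : P.P ⟶ (fibrantTensors C).ι, NatTrans.IsMonoidal q ∧
      ∀ X, q.app X = P.ψ.app X ≫ prod.fst :=
    ⟨P.ψ ≫ Functor.whiskerLeft _ squareFst ≫ (Functor.rightUnitor _).hom, inferInstance,
      fun X ↦ congrArg (P.ψ.app X ≫ ·) (Category.comp_id _)⟩
  obtain ⟨q₁, _, hq₁⟩ : ∃ q : P.P ⟶ (fibrantTensors C).ι, NatTrans.IsMonoidal q ∧
      ∀ X, q.app X = P.ψ.app X ≫ prod.snd :=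
    ⟨P.ψ ≫ Functor.whiskerLeft _ squareSnd ≫ (Functor.rightUnitor _).hom, inferInstance,
      fun X ↦ congrArg (P.ψ.app X ≫ ·) (Category.comp_id _)⟩
  obtain ⟨t₀, _, ht₀⟩ := exists_liftTransformation' _ A.functor hA' q₀
  obtain ⟨t₁, _, ht₁⟩ := exists_liftTransformation' _ A.functor hA' q₁
  have hfac (X) : P.φ.app X ≫ P.ψ.app X = diag X.obj := NatTrans.congr_app P.fac X
  have hfac₀ (X) : P.φ.app X ≫ q₀.app X = 𝟙 _ := (congrArg (P.φ.app X ≫ ·) (hq₀ X)).trans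
    ((Category.assoc _ _ _).symm.trans ((congrArg (· ≫ prod.fst) (hfac X)).trans
      (prod.lift_fst _ _)))
  have hfac₁ (X) : P.φ.app X ≫ q₁.app X = 𝟙 _ := (congrArg (P.φ.app X ≫ ·) (hq₁ X)).trans
    ((Category.assoc _ _ _).symm.trans ((congrArg (· ≫ prod.snd) (hfac X)).trans
      (prod.lift_snd _ _)))
  refine ⟨S.toFOp, i, ⟨S.counit ≫ t₀, inferInstance⟩, ⟨S.counit ≫ t₁, inferInstance⟩, ?_, ?_,
    fun v ↦ ?_, fun v ↦ ?_⟩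
  · ext X
    change i.natTrans.app X ≫ S.counit.app X ≫ t₀.app X = 𝟙 _
    rw [← Category.assoc, ← NatTrans.comp_app, hi, ht, ht₀]
    exact hfac₀ _
  · ext X
    change i.natTrans.app X ≫ S.counit.app X ≫ t₁.app X = 𝟙 _
    rw [← Category.assoc, ← NatTrans.comp_app, hi, ht, ht₁]
    exact hfac₁ _
  · have h := P.weakEquivalence_φ ⟨_, hA' (ι.obj v)⟩ (hA v)
    rw [← ht, ← hi, NatTrans.comp_app] at h
    exact weakEquivalence_of_postcomp _ (S.counit.app (ι.obj v))
  · have h := P.fibration_ψ ⟨_, hA' (ι.obj v)⟩ (hA v)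
    have h' : prod.lift ((S.counit ≫ t₀).app (ι.obj v)) ((S.counit ≫ t₁).app (ι.obj v)) =
        S.counit.app (ι.obj v) ≫ P.ψ.app ⟨_, hA' (ι.obj v)⟩ := by
      apply prod.hom_ext
      · rw [prod.lift_fst, NatTrans.comp_app, ht₀, hq₀]
        exact (Category.assoc _ _ _).symm
      · rw [prod.lift_snd, NatTrans.comp_app, ht₁, hq₁]
        exact (Category.assoc _ _ _).symm
    change Fibration (prod.lift ((S.counit ≫ t₀).app (ι.obj v)) ((S.counit ≫ t₁).app (ι.obj v)))
    rw [h']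
    exact inferInstanceAs (Fibration (S.counit.app (ι.obj v) ≫ P.ψ.app ⟨_, hA' (ι.obj v)⟩))

end FOp

end

/-! ## The model structure on `F`-Ops -/

section

variable {V : Type u₁} [Groupoid.{v₁} V] {F : Type u₂} [Category.{v₂} F]
  [MonoidalCategory F] [SymmetricCategory F] {ι : V ⥤ F}
  {C : Type u} [Category.{v} C] [MonoidalCategory C] [SymmetricCategory C]
  {T : Type w} (J : Discrete T ⥤ F)

lemma IsGeneratingFamily.forall_iff (hJ : IsGeneratingFamily ι J) (W : MorphismProperty C)
    [W.RespectsIso] {O Q : FOp F C} (f : O ⟶ Q) :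
    (∀ t, W (f.natTrans.app (J.obj t))) ↔ ∀ v, W (f.natTrans.app (ι.obj v)) := by
  have h {X Y : F} (e : X ≅ Y) (hf : W (f.natTrans.app X)) : W (f.natTrans.app Y) :=
    (W.arrow_mk_iso_iff (Arrow.isoMk (O.functor.mapIso e) (Q.functor.mapIso e)
      (f.natTrans.naturality _))).1 hf
  constructor
  · intro hf v
    obtain ⟨t, ⟨e⟩⟩ := hJ.exists_iso v
    exact h e (hf t)
  · intro hf t
    obtain ⟨v, ⟨e⟩⟩ := hJ.exists_iso' t
    exact h e (hf v)

lemma IsGeneratingFamily.weakEquivalence_eval_iff [ModelCategory C] (hJ : IsGeneratingFamily ι J)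
    {O Q : FOp F C} (f : O ⟶ Q) :
    WeakEquivalence ((FOp.eval J).map f) ↔ ∀ v, WeakEquivalence (f.natTrans.app (ι.obj v)) := by
  rw [VSeq.weakEquivalence_iff_levelwise]
  simp only [weakEquivalence_iff]
  exact hJ.forall_iff J (weakEquivalences C) f

lemma IsGeneratingFamily.fibration_eval_iff [ModelCategory C] (hJ : IsGeneratingFamily ι J)
    {O Q : FOp F C} (f : O ⟶ Q) :
    Fibration ((FOp.eval J).map f) ↔ ∀ v, Fibration (f.natTrans.app (ι.obj v)) := by
  rw [VSeq.fibration_iff_levelwise]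
  simp only [fibration_iff]
  exact hJ.forall_iff J (fibrations C) f

variable (ι) in
lemma isGeneratingFamily_discrete : IsGeneratingFamily ι (Discrete.functor (id : V → V) ⋙ ι) :=
  ⟨fun v ↦ ⟨⟨v⟩, ⟨Iso.refl _⟩⟩, fun ⟨v⟩ ↦ ⟨v, ⟨Iso.refl _⟩⟩⟩

variable (ι) in
lemma isGeneratingFamily_smallModel [EssentiallySmall.{v} V] : IsGeneratingFamily ι
    (Discrete.functor fun t : SmallModel.{v} V ↦ ι.obj ((equivSmallModel V).inverse.obj t)) :=
  ⟨fun v ↦ ⟨⟨(equivSmallModel V).functor.obj v⟩,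
    ⟨ι.mapIso ((equivSmallModel V).unitIso.symm.app v)⟩⟩, fun ⟨_⟩ ↦ ⟨_, ⟨Iso.refl _⟩⟩⟩

namespace FOp

section

variable [MonoidalClosed C] [HasColimits C] [EssentiallySmall.{v} V] [Small.{v} T]
  (hF : IsFeynmanCategory.{v} ι) (hJ : IsGeneratingFamily ι J)

include hF hJ

lemma eval_isRightAdjoint_of_small : (eval (C := C) J).IsRightAdjoint := by
  have := hF.locallySmall
  let e : Discrete (Shrink.{v} T) ≌ Discrete T := Discrete.equivalence (equivShrink T).symm
  have hJ' : IsGeneratingFamily ι (e.functor ⋙ J) :=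
    ⟨fun v ↦ by
      obtain ⟨t, ⟨i⟩⟩ := hJ.exists_iso v
      exact ⟨e.inverse.obj t, ⟨J.mapIso (e.counitIso.app t) ≪≫ i⟩⟩, fun t ↦ hJ.exists_iso' _⟩
  have := eval_isRightAdjoint (C := C) _ hF hJ'
  let i : eval (C := C) (e.functor ⋙ J) ⋙ (Functor.whiskeringLeft _ _ C).obj e.inverse ≅
      eval J :=
    NatIso.ofComponents (fun O ↦ Functor.isoWhiskerRight e.counitIso (J ⋙ O.functor)) (by
      intro O Q f
      ext t
      exact (f.natTrans.naturality (J.map (e.counit.app t))).symm)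
  have : ((Functor.whiskeringLeft _ _ C).obj e.inverse).IsRightAdjoint :=
    inferInstanceAs e.congrLeft.functor.IsRightAdjoint
  exact Functor.isRightAdjoint_of_iso i

lemma locallySmall_of_isGeneratingFamily : LocallySmall.{v} (FOp F C) :=
  have := eval_faithful (C := C) J hF hJ
  locallySmall_of_faithful (eval (C := C) J)

end

section

variable [MonoidalClosed C] [HasColimits C] [EssentiallySmall.{v} V]
  (hF : IsFeynmanCategory.{v} ι)

include hF

variable (C) in
lemma hasColimitsOfSize : HasColimitsOfSize.{v, v} (FOp F C) :=
  hasColimits _ hF (isGeneratingFamily_smallModel ι)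

variable (C) in
lemma hasLimitsOfSize [HasLimits C] : HasLimitsOfSize.{v, v} (FOp F C) :=
  ⟨fun K _ ↦ hasLimitsOfShape hF K⟩

/-- The evaluation of `F`-Ops at a vertex. -/
abbrev evalAt (F : Type u₂) [Category.{v₂} F] [MonoidalCategory F] [SymmetricCategory F]
    (C : Type u) [Category.{v} C] [MonoidalCategory C] [SymmetricCategory C] (X : F) :
    FOp F C ⥤ C :=
  forget F C ⋙ (evaluation F C).obj X

/-- Up to isomorphism, evaluation at a vertex is a coordinate of a right adjoint. -/
lemma evalAt_preservesLimitsOfShape (v : V) (K : Type w) [SmallCategory K]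
    [HasLimitsOfShape K C] : PreservesLimitsOfShape K (evalAt F C (ι.obj v)) := by
  obtain ⟨t, ⟨e⟩⟩ := (isGeneratingFamily_smallModel ι).exists_iso v
  have := eval_isRightAdjoint_of_small (C := C) _ hF (isGeneratingFamily_smallModel ι)
  let i : eval (C := C) _ ⋙ (evaluation _ _).obj t ≅ evalAt F C (ι.obj v) :=
    NatIso.ofComponents (fun O ↦ O.functor.mapIso e) (fun f ↦ (f.natTrans.naturality _).symm)
  exact preservesLimitsOfShape_of_natIso i

variable [HasLimits C] [ModelCategory C]

theorem weakEquivalence_of_llp (R : MonoidalFibrantReplacement C) (P : CoherentPathObjects C)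
    {O Q : FOp F C} (f : O ⟶ Q)
    (hf : ∀ {A B : FOp F C} (p : A ⟶ B), (∀ v, Fibration (p.natTrans.app (ι.obj v))) →
      HasLiftingProperty f p) (v : V) : WeakEquivalence (f.natTrans.app (ι.obj v)) := by
  have := hasLimitsOfSize C hF
  have : HasTerminal (FOp F C) := hasLimitsOfShape_of_essentiallySmall.{v} _ _
  have : HasBinaryProducts (FOp F C) := hasLimitsOfShape_of_essentiallySmall.{v} _ _
  have (v : V) := evalAt_preservesLimitsOfShape (C := C) hF v (Discrete PEmpty.{1})
  have (v : V) := evalAt_preservesLimitsOfShape (C := C) hF v (Discrete WalkingPair)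
  obtain ⟨RO, RQ, rO, rQ, Rf, h, hrO, hrQ, hRO, hRQ, hRQ'⟩ := exists_fibrantReplacement hF R f
  obtain ⟨PQ, i, p₀, p₁, h₀, h₁, hi, hp⟩ := exists_pathObject hF P RQ hRQ hRQ'
  exact weakEquivalence_map_of_pathObject (fun v ↦ evalAt F C (ι.obj v)) f hf rO rQ Rf h hrO hrQ
    hRO i p₀ p₁ h₀ h₁ hi hp v

theorem exists_modelCategory (hC : IsCofibrantlyGenerated.{v} C)
    (hsmall : ∀ X : C, IsSmallObject.{v} X) (R : MonoidalFibrantReplacement C)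
    (P : CoherentPathObjects C) : ∃ _ : ModelCategory (FOp F C),
      (∀ {O Q : FOp F C} (φ : O ⟶ Q),
        WeakEquivalence φ ↔ ∀ v : V, WeakEquivalence (φ.natTrans.app (ι.obj v))) ∧
      (∀ {O Q : FOp F C} (φ : O ⟶ Q),
        Fibration φ ↔ ∀ v : V, Fibration (φ.natTrans.app (ι.obj v))) := by
  -- The groupoid `V` is only essentially small, so the transfer runs over the objects of a small
  -- model. Weak equivalences and fibrations do not see the difference, being invariant under
  -- isomorphism.
  have hJ := isGeneratingFamily_smallModel.{v₁, v₂, v} ι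
  have := hasLimitsOfSize C hF
  have := hasColimitsOfSize C hF
  have : HasFiniteLimits (FOp F C) := hasFiniteLimits_of_hasLimitsOfSize.{v, v} _
  have := locallySmall_of_isGeneratingFamily (C := C) _ hF hJ
  have := eval_isRightAdjoint_of_small (C := C) _ hF hJ
  obtain ⟨I, K, h⟩ := VSeq.isCofibrantlyGenerated (T := SmallModel.{v} V) hC hsmall
  obtain ⟨M, hw, hf⟩ := exists_modelCategory_of_adjunction
    (Adjunction.ofIsRightAdjoint (eval (C := C) _))
    (fun K _ _ ↦ have := IsFiltered.isSifted (C := K); eval_preservesSiftedColimits _ K) (isSmallObject_of_discrete hsmall) h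
    (fun f hf' ↦ (hJ.weakEquivalence_eval_iff _ f).2 (weakEquivalence_of_llp hF R P f
      (fun p hp ↦ hf' p ((hJ.fibration_eval_iff _ p).2 hp).mem)))
  exact ⟨M, fun φ ↦ (hw φ).trans (hJ.weakEquivalence_eval_iff _ φ), fun φ ↦ (hf φ).trans (hJ.fibration_eval_iff _ φ)⟩

theorem isCofibrantlyGeneratedBy_strictMap [Small.{v} T] [ModelCategory (FOp F C)]
    (hweq : ∀ {O Q : FOp F C} (φ : O ⟶ Q),
      WeakEquivalence φ ↔ ∀ v : V, WeakEquivalence (φ.natTrans.app (ι.obj v)))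
    (hfib : ∀ {O Q : FOp F C} (φ : O ⟶ Q),
      Fibration φ ↔ ∀ v : V, Fibration (φ.natTrans.app (ι.obj v)))
    (hsmall : ∀ X : C, IsSmallObject.{v} X) (hJ : IsGeneratingFamily ι J)
    {L : VSeq T C ⥤ FOp F C} (adj : L ⊣ eval J) {I K : MorphismProperty (VSeq T C)}
    (h : IsCofibrantlyGeneratedBy.{v} (VSeq T C) I K) :
    IsCofibrantlyGeneratedBy.{v} (FOp F C) (I.strictMap L) (K.strictMap L) := by
  have := hasColimitsOfSize C hF
  have := locallySmall_of_isGeneratingFamily (C := C) J hF hJ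
  exact h.strictMap adj (fun K _ _ ↦ have := IsFiltered.isSifted (C := K); eval_preservesSiftedColimits J K)
    (isSmallObject_of_discrete hsmall)
    (fun φ ↦ (hweq φ).trans (hJ.weakEquivalence_eval_iff J φ).symm)
    (fun φ ↦ (hfib φ).trans (hJ.fibration_eval_iff J φ).symm)

end

end FOp

end

/-- Let `(V, F, ι)` be a Feynman category and `C` a cofibrantly generated model category which is
closed symmetric monoidal, such that all objects are small, `C` has a symmetric monoidal fibrant
replacement functor and tensor-coherent path objects for fibrant objects. Then the category of
`F`-Ops in `C` is a model category, complete and cocomplete, cofibrantly generated, with functorial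
factorizations, whose weak equivalences and fibrations are the maps which are such at every `v : V`.
If `V` has a small set of objects, it is transferred along the adjunction between the forgetful
functor to `V`-sequences and its left adjoint. -/
theorem mainTheorem1
    {V : Type u₁} [Groupoid.{v₁} V] [EssentiallySmall.{v} V]
    {F : Type u₂} [Category.{v₂} F] [MonoidalCategory F] [SymmetricCategory F]
    (ι : V ⥤ F) (hF : IsFeynmanCategory.{v} ι)
    {C : Type u} [Category.{v} C] [MonoidalCategory C] [SymmetricCategory C] [MonoidalClosed C]
    [HasLimits C] [HasColimits C] [ModelCategory C]
    (hC : IsCofibrantlyGenerated.{v} C)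
    (hsmall : ∀ X : C, IsSmallObject.{v} X)
    (hR : Nonempty (MonoidalFibrantReplacement C))
    (hP : Nonempty (CoherentPathObjects C)) :
    HasLimitsOfSize.{v, v} (FOp F C) ∧ HasColimitsOfSize.{v, v} (FOp F C) ∧
    ∃ _ : ModelCategory (FOp F C),
      (∀ {O Q : FOp F C} (φ : O ⟶ Q),
        WeakEquivalence φ ↔ ∀ v : V, WeakEquivalence (φ.natTrans.app (ι.obj v))) ∧
      (∀ {O Q : FOp F C} (φ : O ⟶ Q),
        Fibration φ ↔ ∀ v : V, Fibration (φ.natTrans.app (ι.obj v))) ∧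
      (cofibrations (FOp F C)).HasFunctorialFactorization (trivialFibrations (FOp F C)) ∧
      (trivialCofibrations (FOp F C)).HasFunctorialFactorization (fibrations (FOp F C)) ∧
      IsCofibrantlyGenerated.{v} (FOp F C) ∧
      (Small.{v} V →
        (∀ {O Q : FOp F C} (φ : O ⟶ Q),
          WeakEquivalence φ ↔ WeakEquivalence ((FOp.toVSeq C ι).map φ)) ∧
        (∀ {O Q : FOp F C} (φ : O ⟶ Q), Fibration φ ↔ Fibration ((FOp.toVSeq C ι).map φ)) ∧
        ∃ (L : VSeq V C ⥤ FOp F C) (_ : L ⊣ FOp.toVSeq C ι),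
          IsCofibrantlyGenerated.{v} (VSeq V C) ∧
          ∀ I J : MorphismProperty (VSeq V C), IsCofibrantlyGeneratedBy.{v} (VSeq V C) I J →
            IsCofibrantlyGeneratedBy.{v} (FOp F C) (I.strictMap L) (J.strictMap L)) := by
  obtain ⟨R⟩ := hR
  obtain ⟨P⟩ := hP
  refine ⟨FOp.hasLimitsOfSize C hF, FOp.hasColimitsOfSize C hF, ?_⟩
  obtain ⟨M, hweq, hfib⟩ := FOp.exists_modelCategory hF hC hsmall R P
  have key : ∃ I J : MorphismProperty (FOp F C), IsCofibrantlyGeneratedBy.{v} (FOp F C) I J := by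
    obtain ⟨I, K, h⟩ := VSeq.isCofibrantlyGenerated (T := SmallModel.{v} V) hC hsmall
    have hJ := isGeneratingFamily_smallModel.{v₁, v₂, v} ι
    have := FOp.eval_isRightAdjoint_of_small (C := C) _ hF hJ
    exact ⟨_, _, FOp.isCofibrantlyGeneratedBy_strictMap _ hF hweq hfib hsmall hJ
      (Adjunction.ofIsRightAdjoint (FOp.eval (C := C) _)) h⟩
  obtain ⟨I, K, h⟩ := key
  refine ⟨M, hweq, hfib, h.hasFunctorialFactorization_cofibrations,
    h.hasFunctorialFactorization_trivialCofibrations, ⟨I, K, h⟩, fun _ ↦ ⟨fun φ ↦ ?_, fun φ ↦ ?_, ?_⟩⟩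
  · rw [hweq, VSeq.weakEquivalence_iff_levelwise]
    exact ⟨fun h v ↦ h v.as, fun h v ↦ h ⟨v⟩⟩
  · rw [hfib, VSeq.fibration_iff_levelwise]
    exact ⟨fun h v ↦ h v.as, fun h v ↦ h ⟨v⟩⟩
  -- When `V` has a small set of objects, the vertices themselves serve as generating family, and
  -- evaluation at them is the forgetful functor to `V`-sequences by definition.
  · have hJ := isGeneratingFamily_discrete ι
    have := FOp.eval_isRightAdjoint_of_small (C := C) _ hF hJ
    have adj := Adjunction.ofIsRightAdjoint (FOp.eval (C := C) (Discrete.functor (id : V → V) ⋙ ι))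
    exact ⟨_, adj, VSeq.isCofibrantlyGenerated hC hsmall, fun I K h ↦
      FOp.isCofibrantlyGeneratedBy_strictMap _ hF hweq hfib hsmall hJ adj h⟩
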